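/- **Setting.** All graphs are finite, simple and labeled by $\{1,\dots,|G|\}$. A graph is prime if it has at least 3 vertices and its only modules are $\emptyset$, the singletons and the whole vertex set. Let $\mathcal P$ be a set of prime graphs stable by relabeling, $P(z)=\sum_{H\in\mathcal P}\frac{z^{|H|}}{|H|!}$, $R_0$ its radius of convergence and $\Lambda(w)=P(e^w-1)+e^w-1-w$. Condition (C) says that $R_0>0$ and that the limit in $[0,+\infty]$ of $\Lambda'$ at $\log(1+R_0)^-$ is $>1$. A substitution tree is a rooted non-plane tree with leaves labeled bijectively by $\{1,\dots,|t|\}$ ($|t|$ is the number of leaves), in which each internal node has $d\ge 2$ children, ordered by minimal leaf label, and is decorated with a graph of size $d$, whose $i$-th vertex stands for the $i$-th child. A node is linear if its decoration is a complete graph ($\oplus$) or an edgeless graph ($\ominus$). $\mathcal T_{\mathcal P}$ is the set of substitution trees all of whose decorations are $\oplus$, $\ominus$ or in $\mathcal P$, and with no child of an $\oplus$-node decorated with $\oplus$ and no child of an $\ominus$-node decorated with $\ominus$. For a partial injection $\mathfrak I$ from the leaf labels of $t$ to $\mathbb N$ (a marking), the induced subtree $t_{\mathfrak I}$ has as leaves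 the marked leaves, relabeled by their marks, and as internal nodes the first common ancestors of two or more marked leaves; a node $\mathfrak n$ of $t_{\mathfrak I}$ coming from the node $\phi(\mathfrak n)$ of $t$ is decorated with the subgraph of the decoration of $\phi(\mathfrak n)$ induced on the children whose subtrees contain a marked leaf, relabeled according to the order of the minimal marks. Let $\tau$ be a substitution tree of size at least 2. $\mathcal T_\tau$ is the set of pairs $(t,\mathfrak I)$ with $t\in\mathcal T_{\mathcal P}$ and $t_{\mathfrak I}=\tau$; for a set $\mathfrak N$ of internal nodes of $\tau$ containing all the non-linear ones, $\mathcal T_{\tau,\mathfrak N}$ is the set of those pairs for which $\mathfrak N$ is the set of $\mathfrak n$ such that $\phi(\mathfrak n)$ is non-linear. $T_\tau$ and $T_{\tau,\mathfrak N}$ are their exponential generating functions, counted by the total number of leaves of $t$. For graphs $G,H$, let $\mathrm{Occ}_G(H)$ be the number of partial injections $\mathfrak J$ from the labels of $H$ to $\mathbb N$ with $H_{\mathfrak J}=G$ as labeled graphs, and $\mathrm{Occ}_{G,\mathcal P}(z)=\sum_{H\in\mathcal P}\frac{\mathrm{Occ}_G(H)z^{|H|-|G|}}{|H|!}$. A $\Delta$-domain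 at $\rho>0$ is a set $\{\rho z: |z|\le r,\ z\ne1,\ |\arg(1-z)|<\varphi\}$ with $r>1$ and $\frac\pi2<\varphi<\pi$. **Statement.** Assume Condition (C). There is exactly one $\kappa\in[0,\log(1+R_0))$ with $\Lambda'(\kappa)=1$. Let $K=e^\kappa-1$, $R=\kappa-\Lambda(\kappa)$, $\mu=\sqrt{2R\Lambda''(\kappa)}$; then $R>0$ and $\mu>0$. Let $e$ be the number of edges of $\tau$, $d_{\mathfrak n}$ the number of children and $\mathrm{dec}(\mathfrak n)$ the decoration of a node $\mathfrak n$, and $\mathfrak N_{\mathrm l}$, $\mathfrak N_{\mathrm{nl}}$ the sets of linear and non-linear nodes of $\tau$. 1. If $\mathcal T_\tau\neq\emptyset$, then $T_\tau$ has radius of convergence $R$. In all cases $T_\tau$ has an analytic continuation to a $\Delta$-domain at $R$, in which, as $z\to R$, $$T_\tau(z)=\frac{1+K}{\mu}B_\tau\Big(1-\frac zR\Big)^{-\frac{e+1}2}(1+o(1)),$$ $$B_\tau=\frac{R^{|\tau|}}{\mu^e}\prod_{\mathfrak n\in\mathfrak N_{\mathrm{nl}}}\mathrm{Occ}_{\mathrm{dec}(\mathfrak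 n),\mathcal P}(K)(1+K)^{d_{\mathfrak n}}\prod_{\mathfrak n\in\mathfrak N_{\mathrm l}}\Big(\mathrm{Occ}_{\mathrm{dec}(\mathfrak n),\mathcal P}(K)(1+K)^{d_{\mathfrak n}}+1\Big).$$ 2. For every set $\mathfrak N$ of internal nodes of $\tau$ containing $\mathfrak N_{\mathrm{nl}}$: if $\mathcal T_{\tau,\mathfrak N}\ne\emptyset$, then $T_{\tau,\mathfrak N}$ has radius of convergence $R$. In all cases $T_{\tau,\mathfrak N}$ has an analytic continuation to a $\Delta$-domain at $R$, in which, as $z\to R$, $$T_{\tau,\mathfrak N}(z)=\frac{1+K}{\mu}C_{\tau,\mathfrak N}\Big(1-\frac zR\Big)^{-\frac{e+1}2}(1+o(1)),\qquad C_{\tau,\mathfrak N}=\frac{(1+K)^fR^{|\tau|}}{\mu^e}\prod_{\mathfrak n\in\mathfrak N}\mathrm{Occ}_{\mathrm{dec}(\mathfrak n),\mathcal P}(K),$$ where $f=\sum_{\mathfrak n\in\mathfrak N}d_{\mathfrak n}$ is the number of edges of $\tau$ from a node of $\mathfrak N$ to one of its children. (If the set of marked trees is empty, the series is $0$ and the expansion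 says that the constant $B_\tau$, resp. $C_{\tau,\mathfrak N}$, is $0$.) -/

import Mathlib

open Filter Topology Asymptotics
open scoped ENNReal

namespace ModDec

/-! ### Graphs -/

/-- A module of a graph: vertices outside `M` do not distinguish two elements of `M`. -/
def IsModule {V : Type} (G : SimpleGraph V) (M : Set V) : Prop :=
  ∀ x ∈ M, ∀ y ∈ M, ∀ z ∉ M, (G.Adj x z ↔ G.Adj y z)

/-- A prime graph: at least three vertices, and all its modules are trivial. -/
def IsPrime {n : ℕ} (G : SimpleGraph (Fin n)) : Prop :=
  3 ≤ n ∧ ∀ M : Set (Fin n), IsModule G M → M = ∅ ∨ M = Set.univ ∨ ∃ v, M = {v}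

/-- The decorations `⊕` (complete graph) and `⊖` (graph without edges). -/
def IsLinear {n : ℕ} (G : SimpleGraph (Fin n)) : Prop := G = ⊤ ∨ G = ⊥

/-- A set of labeled graphs, given as the family of its subsets of graphs of size `n`.
The vertex set of a labeled graph of size `n` is identified with its set of labels `Fin n`. -/
abbrev GraphClass : Type := ∀ n : ℕ, Set (SimpleGraph (Fin n))

/-- A set of prime graphs that is stable by relabeling. -/
def IsPrimeClass (P : GraphClass) : Prop :=
  (∀ n, ∀ G ∈ P n, IsPrime G) ∧
    ∀ n, ∀ G ∈ P n, ∀ π : Equiv.Perm (Fin n), G.map π.toEmbedding ∈ P n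

/-- The number of partial injections `J` from the labels of `H` to the labels of `G` such that the
induced labeled subgraph `H_J` is the labeled graph `G`; the inverses of these partial injections
are the embeddings of `G` in `H` as an induced subgraph. -/
noncomputable def occ {k n : ℕ} (G : SimpleGraph (Fin k)) (H : SimpleGraph (Fin n)) : ℕ :=
  Nat.card (G ↪g H)

/-! ### Trees -/

/-- Rooted trees with leaves labeled in `ℕ`, and internal nodes decorated with graphs, the vertices
of the decoration being the children of the node, in their order. -/
inductive STree : Type
  | leaf (label : ℕ) : STree
  | node (d : ℕ) (G : SimpleGraph (Fin d)) (c : Fin d → STree) : STree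

namespace STree

/-- The labels of the leaves. -/
def labels : STree → Multiset ℕ
  | leaf l => {l}
  | node _ _ c => ∑ i, (c i).labels

/-- The size of a tree is its number of leaves. -/
def size (t : STree) : ℕ := t.labels.card

/-- The minimal leaf label. -/
noncomputable def minLabel (t : STree) : ℕ := sInf {l | l ∈ t.labels}

/-- Every internal node has at least two children, and the children of each node are ordered
increasingly by their minimal leaf label. A non-plane tree with distinct leaf labels has exactly one
plane representative of this form, so that non-plane trees are encoded by these representatives. -/
def IsOrdered : STree → Prop
  | leaf _ => True
  | node d _ c => 2 ≤ d ∧ StrictMono (fun i => (c i).minLabel) ∧ ∀ i, (c i).IsOrdered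

/-- Substitution trees: the leaves have distinct labels, which are `1, …, size`. -/
def IsSubstitutionTree (t : STree) : Prop :=
  t.IsOrdered ∧ t.labels = (Finset.Icc 1 t.size).val

/-- The root is decorated with `⊕`. -/
def RootIsJoin : STree → Prop
  | leaf _ => False
  | node _ G _ => G = ⊤

/-- The root is decorated with `⊖`. -/
def RootIsUnion : STree → Prop
  | leaf _ => False
  | node _ G _ => G = ⊥

/-- All decorations are `⊕`, `⊖` or in `P`, no child of a node decorated with `⊕` is decorated
with `⊕`, and no child of a node decorated with `⊖` is decorated with `⊖`. -/
def IsReducedOver (P : GraphClass) : STree → Prop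
  | leaf _ => True
  | node d G c => (IsLinear G ∨ G ∈ P d) ∧ (G = ⊤ → ∀ i, ¬ (c i).RootIsJoin) ∧
      (G = ⊥ → ∀ i, ¬ (c i).RootIsUnion) ∧ ∀ i, (c i).IsReducedOver P

/-- For a set `P` of prime graphs: the modular decomposition trees whose nodes are linear
or in `P`. -/
def modularTrees (P : GraphClass) : Set STree :=
  {t | t.IsSubstitutionTree ∧ t.IsReducedOver P}

/-- The type of internal nodes of a tree. In a tree `node d G c` these are the root, `none`, and the
internal nodes of the trees attached to the root. -/
def Node : STree → Type
  | leaf _ => Empty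
  | node d _ c => Option (Σ i : Fin d, (c i).Node)

/-- A tree has finitely many internal nodes. -/
instance instFintypeNode : ∀ t : STree, Fintype t.Node
  | leaf _ => inferInstanceAs (Fintype Empty)
  | node d _ c =>
    haveI : ∀ i, Fintype (c i).Node := fun i => instFintypeNode (c i)
    inferInstanceAs (Fintype (Option (Σ i : Fin d, (c i).Node)))

/-- The root of a tree that is not a leaf, as an internal node. -/
def rootNode {d : ℕ} {G : SimpleGraph (Fin d)} {c : Fin d → STree} : (node d G c).Node :=
  (none : Option (Σ i : Fin d, (c i).Node))

/-- An internal node of the `i`-th tree attached to the root, as an internal node of the tree. -/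
def childNode {d : ℕ} {G : SimpleGraph (Fin d)} {c : Fin d → STree} (i : Fin d) (n : (c i).Node) :
    (node d G c).Node :=
  (some ⟨i, n⟩ : Option (Σ i : Fin d, (c i).Node))

/-- The number of children of an internal node, and its decoration. -/
def decoration : (t : STree) → t.Node → Σ d : ℕ, SimpleGraph (Fin d)
  | leaf _, n => Empty.elim n
  | node d G _, none => ⟨d, G⟩
  | node _ _ c, some ⟨i, n⟩ => (c i).decoration n

/-- The number of children of an internal node. -/
def arity (t : STree) (n : t.Node) : ℕ := (t.decoration n).1

/-- The decoration of an internal node. -/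
def dec (t : STree) (n : t.Node) : SimpleGraph (Fin (t.arity n)) := (t.decoration n).2

/-- Linear internal nodes are those decorated with `⊕` or `⊖`. -/
def LinearNode (t : STree) (n : t.Node) : Prop := IsLinear (t.dec n)

/-- The number of edges. -/
def numEdges : STree → ℕ
  | leaf _ => 0
  | node _ _ c => ∑ i, ((c i).numEdges + 1)

/-- No leaf is marked by the partial injection `I`. -/
def Unmarked (I : ℕ ≃. ℕ) (t : STree) : Prop := ∀ l ∈ t.labels, I l = none

/-- `Induces I t τ φ` says that the subtree of `t` induced by the marking `I` is `τ`, and that the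
internal node `n` of `τ` comes from the internal node `φ n` of `t`.

A marked leaf becomes a leaf labeled by its mark (`leaf`). A node is a first common ancestor of
marked leaves if and only if at least two of the trees attached to it contain marked leaves. If only
the `i`-th one does, then the node disappears (`skip`). Otherwise the node is kept (`branch`), its
children being indexed through `σ` by the attached trees that contain marked leaves, and its
decoration is the corresponding induced subgraph. For an ordered `τ` the injection `σ` lists the
attached trees with marked leaves by increasing minimal mark. -/
inductive Induces (I : ℕ ≃. ℕ) : (t τ : STree) → (τ.Node → t.Node) → Prop
  | leaf {l m : ℕ} {φ : (leaf m).Node → (leaf l).Node} (h : I l = some m) :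
      Induces I (leaf l) (leaf m) φ
  | skip {d : ℕ} {G : SimpleGraph (Fin d)} {c : Fin d → STree} {τ : STree}
      {φ : τ.Node → (node d G c).Node} (i : Fin d) (ψ : τ.Node → (c i).Node)
      (h : Induces I (c i) τ ψ) (hu : ∀ j, j ≠ i → (c j).Unmarked I)
      (hφ : ∀ n, φ n = childNode i (ψ n)) :
      Induces I (node d G c) τ φ
  | branch {d k : ℕ} {G : SimpleGraph (Fin d)} {H : SimpleGraph (Fin k)} {c : Fin d → STree}
      {c' : Fin k → STree} {φ : (node k H c').Node → (node d G c).Node}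
      (σ : Fin k ↪ Fin d) (ψ : ∀ j, (c' j).Node → (c (σ j)).Node)
      (hk : 2 ≤ k) (h : ∀ j, Induces I (c (σ j)) (c' j) (ψ j))
      (hu : ∀ i, (∀ j, σ j ≠ i) → (c i).Unmarked I)
      (hH : H = G.comap σ)
      (hroot : φ rootNode = rootNode)
      (hφ : ∀ j n, φ (childNode j n) = childNode (σ j) (ψ j n)) :
      Induces I (node d G c) (node k H c') φ

/-- Pairs `(t, I)` where `I` is a partial injection from the labels of the leaves of `t` to `ℕ`. -/
def IsMarkedTree (p : STree × (ℕ ≃. ℕ)) : Prop :=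
  ∀ l m, p.2 l = some m → l ∈ p.1.labels

/-- The marked trees `(t, I)` with `t` a modular decomposition tree with linear nodes or nodes
in `P`, such that the induced subtree is `τ`. -/
def inducing (P : GraphClass) (τ : STree) : Set (STree × (ℕ ≃. ℕ)) :=
  {p | p.1 ∈ modularTrees P ∧ IsMarkedTree p ∧ ∃ φ, Induces p.2 p.1 τ φ}

/-- The marked trees `(t, I)` in `inducing P τ` such that `N` is the set of internal nodes of `τ`
that come from a non-linear node of `t`. -/
def inducingWith (P : GraphClass) (τ : STree) (N : Finset τ.Node) : Set (STree × (ℕ ≃. ℕ)) :=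
  {p | p.1 ∈ modularTrees P ∧ IsMarkedTree p ∧
    ∃ φ, Induces p.2 p.1 τ φ ∧ ∀ n, n ∈ N ↔ ¬ p.1.LinearNode (φ n)}

end STree

/-! ### Power series -/

/-- The coefficients of the exponential generating function of a set of marked trees, counted by
the total number of leaves. -/
noncomputable def egf (A : Set (STree × (ℕ ≃. ℕ))) (n : ℕ) : ℝ :=
  ({p ∈ A | p.1.size = n}.ncard : ℝ) / n.factorial

/-- The coefficients of the exponential generating function `P(z)` of a set of graphs. -/
noncomputable def classCoeff (P : GraphClass) (n : ℕ) : ℝ := ((P n).ncard : ℝ) / n.factorial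

/-- The radius of convergence of `∑ aₙ zⁿ`. -/
noncomputable def seriesRadius (a : ℕ → ℝ) : ℝ≥0∞ :=
  (FormalMultilinearSeries.ofScalars ℝ a).radius

/-- The value `P(x)`. -/
noncomputable def classSeries (P : GraphClass) (x : ℝ) : ℝ := ∑' n, classCoeff P n * x ^ n

open Classical in
/-- The value at `x` of the series `∑_{H ∈ P} Occ_G(H) x^(|H| - |G|) / |H|!`; only the graphs `H`
with `|H| = m + |G|` contribute to the term of degree `m`. -/
noncomputable def occSeries (P : GraphClass) {k : ℕ} (G : SimpleGraph (Fin k)) (x : ℝ) : ℝ :=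
  ∑' m : ℕ, (∑ H : SimpleGraph (Fin (m + k)) with H ∈ P (m + k), (occ G H : ℝ)) /
    (m + k).factorial * x ^ m

/-- The function `Λ(w) = P(exp w - 1) + exp w - 1 - w`. -/
noncomputable def Lam (P : GraphClass) (w : ℝ) : ℝ :=
  classSeries P (Real.exp w - 1) + Real.exp w - 1 - w

/-- The radius of convergence `log (1 + R₀)` of `Λ`, with `R₀` that of `P`. -/
noncomputable def lamRadius (P : GraphClass) : EReal :=
  ENNReal.log (1 + seriesRadius (classCoeff P))

/-- Condition (C): `R₀ > 0`, and the limit in `[0, ∞]` of `Λ'` at `log (1 + R₀)` from the left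
is greater than `1`. -/
def ConditionC (P : GraphClass) : Prop :=
  0 < seriesRadius (classCoeff P) ∧
    ∃ L : EReal, 1 < L ∧
      Tendsto (fun w : ℝ => ((deriv (Lam P) w : ℝ) : EReal))
        (comap (fun w : ℝ => (w : EReal)) (𝓝[<] lamRadius P)) (𝓝 L)

/-- `κ` is a solution in `[0, log (1 + R₀))` of `Λ'(κ) = 1`. -/
def IsKappa (P : GraphClass) (κ : ℝ) : Prop :=
  0 ≤ κ ∧ (κ : EReal) < lamRadius P ∧ deriv (Lam P) κ = 1

/-- `R = κ - Λ(κ)`. -/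
noncomputable def RR (P : GraphClass) (κ : ℝ) : ℝ := κ - Lam P κ

/-- `K = exp κ - 1`. -/
noncomputable def KK (κ : ℝ) : ℝ := Real.exp κ - 1

/-- `μ = √(2 R Λ''(κ))`. -/
noncomputable def muu (P : GraphClass) (κ : ℝ) : ℝ :=
  Real.sqrt (2 * RR P κ * deriv (deriv (Lam P)) κ)

/-- The constant `C_{τ, N}`; the number of edges of `τ` from a node in `N` to one of its children is
the sum of the numbers of children of the nodes in `N`. -/
noncomputable def CC (P : GraphClass) (κ : ℝ) (τ : STree) (N : Finset τ.Node) : ℝ :=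
  (1 + KK κ) ^ (∑ n ∈ N, τ.arity n) * RR P κ ^ τ.size / muu P κ ^ τ.numEdges *
    ∏ n ∈ N, occSeries P (τ.dec n) (KK κ)

open Classical in
/-- The constant `B_τ`. -/
noncomputable def BB (P : GraphClass) (κ : ℝ) (τ : STree) : ℝ :=
  RR P κ ^ τ.size / muu P κ ^ τ.numEdges *
    (∏ n : τ.Node with ¬ τ.LinearNode n,
      occSeries P (τ.dec n) (KK κ) * (1 + KK κ) ^ τ.arity n) *
    ∏ n : τ.Node with τ.LinearNode n,
      (occSeries P (τ.dec n) (KK κ) * (1 + KK κ) ^ τ.arity n + 1)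

/-- `D` is a `Δ`-domain at `w`. -/
def IsDeltaDomain (w : ℂ) (D : Set ℂ) : Prop :=
  ∃ r φ : ℝ, 1 < r ∧ Real.pi / 2 < φ ∧ φ < Real.pi ∧
    D = (fun z => z * w) '' {z : ℂ | ‖z‖ ≤ r ∧ z ≠ 1 ∧ |Complex.arg (1 - z)| < φ}

/-- `g` is analytic on `D` and equal to `∑ aₙ zⁿ` for `|z| < ρ`. For a `Δ`-domain `D` at `ρ`, where
`ρ` is the radius of convergence, this says that `g` is the analytic continuation of the series
to `D`. -/
def IsContinuation (a : ℕ → ℝ) (ρ : ℝ) (D : Set ℂ) (g : ℂ → ℂ) : Prop :=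
  AnalyticOnNhd ℂ g D ∧ ∀ z : ℂ, ‖z‖ < ρ → HasSum (fun n => (a n : ℂ) * z ^ n) (g z)

/-- The series `∑ aₙ zⁿ` extends analytically to a `Δ`-domain at `R`, where the extension is
`c (1 - z / R)^(-(e + 1) / 2) (1 + o(1))` as `z` tends to `R`. -/
def HasDeltaExpansion (a : ℕ → ℝ) (R c : ℝ) (e : ℕ) : Prop :=
  ∃ D : Set ℂ, IsDeltaDomain (R : ℂ) D ∧ ∃ g : ℂ → ℂ, IsContinuation a R D g ∧
    g ~[𝓝[D] (R : ℂ)] fun z => (c : ℂ) * (1 - z / (R : ℂ)) ^ (-((e : ℂ) + 1) / 2)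

end ModDec

namespace ModDec

/-! ### Power series with real coefficients as complex functions -/

/-! All generating functions are written in terms of one function $W$, the exponential generating
function of the trees whose root is not $\oplus$ (equally, not $\ominus$). Decomposition at the root
gives $W=z+\Lambda(W)$, and all trees together have the series $e^W-1$. So $W$ is the inverse
`invPsi` of $\psi(w)=w-\Lambda(w)$, and $W'(1-\Lambda'(W))=1$.

Counting. Let the unmarked leaves carry the labels in $U$ and the marked ones those in $D$, and
count only the unmarked ones in the series. If the root of $t$ is not a node of $\tau$, exactly one
child carries marks (`skippingTrees`); otherwise the children of the root of $\tau$ are spread over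
distinct children of the root of $t$, along an embedding of the decoration of $\tau$
(`branchingTrees`). For each kind of parent this gives an equation, and the three equations form a
linear system that `solveKinds` solves explicitly: up to a factor $e^{-W}$ and a lower order term,
the solution is $W'$ times the contribution of the branching trees. The functions are thus defined
analytically, by recursion on $\tau$, and not as formal series. That their derivatives at $0$ are
the numbers of trees (`numTrees_unmarkedTrees`, `numTrees_markedTrees`) follows by induction on the
number of labels from `numTrees_nodeTrees_eq_iteratedDeriv`, which matches the Leibniz rule with the
distribution of labels among the children. Choosing the marked leaves then multiplies the series by
$z^{|\tau|}$ (`ncard_inducingSet_eq_iteratedDeriv`).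

Analysis. The coefficients of $\Lambda$ are nonnegative, so $|\Lambda'|<1$ on $|w|<\kappa$, and
$\psi$ is injective and open there. On $|w|=\kappa$ one has $|\psi(w)|\ge\kappa-\Lambda(\kappa)=R$,
with equality only at $w=\kappa$. Hence $\psi$ of the disc contains the closed disc of radius $R$
except the point $R$. At $\kappa$ the function $1-\psi/R$ has a double zero, so near $R$ its inverse
is an analytic function of $\sqrt{1-z/R}$, and $W'\sim\mu^{-1}(1-z/R)^{-1/2}$. By compactness $W$
extends to a $\Delta$-domain (`IsKappa.exists_deltaDomain`).

Transfer. By induction on $\tau$ (`tendsto_genC`), the children of the root contribute the exponents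
$(e_j+1)/2$, whose sum is $e/2$, and the factor $W'$ at the root adds $1/2$. The constant is a
product over the nodes of $\tau$: a node coming from a non-linear one contributes
$\mathrm{Occ}(K)(1+K)^d$, and one coming from a linear one contributes $1$. The two statements
differ only in which of these cases are allowed, so a predicate `A` on the nodes treats both at
once. If the constant is not $0$, the series is unbounded at $R$, which fixes the radius of
convergence; if it is $0$, the series vanishes identically. -/

/-- The complex function `z ↦ ∑ aₙ zⁿ`. -/
noncomputable def pser (a : ℕ → ℝ) (z : ℂ) : ℂ := ∑' n, (a n : ℂ) * z ^ n

/-- The series `∑ aₙ zⁿ` converges absolutely for `|z| < ρ`. -/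
def ConvergesBelow (a : ℕ → ℝ) (ρ : ℝ≥0∞) : Prop :=
  ∀ r : ℝ, 0 ≤ r → ENNReal.ofReal r < ρ → Summable fun n => |a n| * r ^ n

/-- The coefficients of the derivative. -/
def derivCoeff (a : ℕ → ℝ) (n : ℕ) : ℝ := (n + 1) * a (n + 1)

lemma convergesBelow_seriesRadius (a : ℕ → ℝ) : ConvergesBelow a (seriesRadius a) := by
  intro r hr h
  lift r to NNReal using hr
  rw [ENNReal.ofReal_coe_nnreal] at h
  have := (FormalMultilinearSeries.ofScalars ℝ a).summable_norm_mul_pow h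
  simpa [FormalMultilinearSeries.ofScalars_norm] using this

/-- Between $r$ and $\rho$ there is room for some $s$, and the geometric factor $(r/s)^m$ absorbs
any polynomial one. Derivatives, shifts and series of occurrences are all dominated in this way. -/
lemma ConvergesBelow.of_le {a b : ℕ → ℝ} {ρ : ℝ≥0∞} (ha : ConvergesBelow a ρ) (k : ℕ)
    (hb : ∀ m, |b m| ≤ (m + k : ℝ) ^ k * |a (m + k)|) : ConvergesBelow b ρ := by
  intro r hr hrρ
  obtain ⟨s, hs1', hs2⟩ := ENNReal.lt_iff_exists_nnreal_btwn.1 hrρ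
  have hs1 : r < s := (ENNReal.ofReal_lt_coe_iff hr).1 hs1'
  have hs0 : (0 : ℝ) < s := hr.trans_lt hs1
  have hsum := ha s s.2 (by rwa [ENNReal.ofReal_coe_nnreal])
  obtain ⟨C, hC⟩ : ∃ C, ∀ n, |a n| * (s : ℝ) ^ n ≤ C := by
    obtain ⟨C, hC⟩ := hsum.tendsto_atTop_zero.bddAbove_range
    exact ⟨C, fun n => hC ⟨n, rfl⟩⟩
  have hq : ‖r / s‖ < 1 := by
    rw [Real.norm_of_nonneg (by positivity)]
    exact (div_lt_one hs0).2 hs1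
  have h1 : Summable fun m : ℕ => ((m : ℝ) ^ k * (r / s) ^ m) :=
    summable_pow_mul_geometric_of_norm_lt_one k hq
  have h0 : Summable fun m : ℕ => ((r / s) ^ m) :=
    summable_geometric_of_norm_lt_one hq
  have h2 : Summable fun m : ℕ => ((m + k : ℝ) ^ k * (r / s) ^ m) := by
    -- The factor $(m+k)^k$ is at most $(2k)^k$ if $m\le k$, and at most $2^k m^k$ otherwise; the
    -- sum of the two bounds covers both cases.
    refine Summable.of_nonneg_of_le (fun m => by positivity) (fun m => ?_)
      ((h1.mul_left (2 ^ k)).add (h0.mul_left ((2 * k : ℝ) ^ k)))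
    rcases le_total (m : ℝ) k with h | h
    · have : (m + k : ℝ) ^ k ≤ (2 * k) ^ k := by gcongr; linarith
      calc (m + k : ℝ) ^ k * (r / s) ^ m ≤ (2 * k) ^ k * (r / s) ^ m := by gcongr
        _ ≤ _ := by have : 0 ≤ 2 ^ k * ((m : ℝ) ^ k * (r / s) ^ m) := by positivity
                    linarith
    · have : (m + k : ℝ) ^ k ≤ 2 ^ k * m ^ k := by rw [← mul_pow]; gcongr; linarith
      calc (m + k : ℝ) ^ k * (r / s) ^ m ≤ 2 ^ k * m ^ k * (r / s) ^ m := by gcongr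
        _ ≤ _ := by have : 0 ≤ (2 * k : ℝ) ^ k * ((r / s) ^ m) := by positivity
                    linarith
  refine Summable.of_nonneg_of_le (fun m => by positivity) (fun m => ?_)
    (h2.mul_left (C / s ^ k))
  have h3 : |a (m + k)| ≤ C / s ^ (m + k) := by
    rw [le_div_iff₀ (by positivity)]; exact hC _
  calc |b m| * r ^ m ≤ (m + k : ℝ) ^ k * (C / s ^ (m + k)) * r ^ m := by
        gcongr
        exact (hb m).trans (by gcongr)
    _ = _ := by rw [div_pow, pow_add]; field_simp

lemma ConvergesBelow.derivCoeff {a : ℕ → ℝ} {ρ : ℝ≥0∞} (ha : ConvergesBelow a ρ) :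
    ConvergesBelow (derivCoeff a) ρ :=
  ha.of_le 1 fun m => by
    rw [ModDec.derivCoeff, abs_mul, abs_of_nonneg (by positivity : (0 : ℝ) ≤ m + 1)]; simp

lemma norm_mul_pow_eq (a : ℕ → ℝ) (z : ℂ) (n : ℕ) : ‖(a n : ℂ) * z ^ n‖ = |a n| * ‖z‖ ^ n := by
  simp

lemma ConvergesBelow.summable {a : ℕ → ℝ} {ρ : ℝ≥0∞} (ha : ConvergesBelow a ρ) {z : ℂ}
    (hz : ENNReal.ofReal ‖z‖ < ρ) : Summable fun n => (a n : ℂ) * z ^ n := by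
  refine Summable.of_norm ?_
  simpa using ha ‖z‖ (norm_nonneg _) hz

lemma ConvergesBelow.summable_real {a : ℕ → ℝ} {ρ : ℝ≥0∞} (ha : ConvergesBelow a ρ) {x : ℝ}
    (hx : ENNReal.ofReal |x| < ρ) : Summable fun n => a n * x ^ n := by
  refine Summable.of_norm ?_
  simpa using ha |x| (abs_nonneg _) hx

lemma pser_ofReal (a : ℕ → ℝ) (x : ℝ) : pser a (x : ℂ) = ((∑' n, a n * x ^ n : ℝ) : ℂ) := by
  rw [pser, Complex.ofReal_tsum]; simp

lemma ConvergesBelow.hasDerivAt {a : ℕ → ℝ} {ρ : ℝ≥0∞} (ha : ConvergesBelow a ρ) {z : ℂ}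
    (hz : ENNReal.ofReal ‖z‖ < ρ) : HasDerivAt (pser a) (pser (ModDec.derivCoeff a) z) z := by
  obtain ⟨s, hs1', hs2⟩ := ENNReal.lt_iff_exists_nnreal_btwn.1 hz
  have hs1 : ‖z‖ < s := (ENNReal.ofReal_lt_coe_iff (norm_nonneg z)).1 hs1'
  have hs0 : (0 : ℝ) < s := (norm_nonneg z).trans_lt hs1
  have hu : Summable fun n : ℕ => |a n| * (n * (s : ℝ) ^ (n - 1)) := by
    rw [← summable_nat_add_iff 1]
    have := ha.derivCoeff s s.2 (by rwa [ENNReal.ofReal_coe_nnreal])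
    refine this.congr fun n => ?_
    rw [ModDec.derivCoeff, abs_mul, abs_of_nonneg (by positivity : (0 : ℝ) ≤ n + 1)]
    push_cast
    ring
  have h := hasDerivAt_tsum_of_isPreconnected (𝕜 := ℂ) (g := fun n y => (a n : ℂ) * y ^ n)
    (g' := fun n y => (a n : ℂ) * (n * y ^ (n - 1))) (t := Metric.ball 0 s) (y₀ := 0) (y := z) hu
    Metric.isOpen_ball (convex_ball _ _).isPreconnected
    (fun n y _ => (hasDerivAt_pow n y).const_mul _)
    (fun n y hy => by
      rw [mem_ball_zero_iff] at hy
      simp only [norm_mul, Complex.norm_real, Real.norm_eq_abs, norm_pow, Complex.norm_natCast]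
      gcongr)
    (by simpa using hs0) (ha.summable (by simpa using pos_of_gt hs2))
    (by simpa using hs1)
  -- The term of index $0$ vanishes; the shift by one turns the differentiated terms into those of
  -- `derivCoeff`.
  have h2 : (∑' n, (a n : ℂ) * (n * z ^ (n - 1))) = pser (ModDec.derivCoeff a) z := by
    rw [pser, tsum_eq_zero_add' ]
    · simp [ModDec.derivCoeff]
      exact tsum_congr fun n => by ring
    · refine (ha.derivCoeff.summable hz).congr fun n => ?_
      simp [ModDec.derivCoeff]; ring
  rw [h2] at h
  exact h

lemma isOpen_ofReal_norm_lt (ρ : ℝ≥0∞) : IsOpen {z : ℂ | ENNReal.ofReal ‖z‖ < ρ} :=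
  isOpen_lt (ENNReal.continuous_ofReal.comp continuous_norm) continuous_const

lemma ConvergesBelow.analyticAt {a : ℕ → ℝ} {ρ : ℝ≥0∞} (ha : ConvergesBelow a ρ) {z : ℂ}
    (hz : ENNReal.ofReal ‖z‖ < ρ) : AnalyticAt ℂ (pser a) z := by
  have : DifferentiableOn ℂ (pser a) {z : ℂ | ENNReal.ofReal ‖z‖ < ρ} := fun w hw =>
    (ha.hasDerivAt hw).differentiableAt.differentiableWithinAt
  exact this.analyticAt ((isOpen_ofReal_norm_lt ρ).mem_nhds hz)

lemma pser_zero (a : ℕ → ℝ) : pser a 0 = a 0 := by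
  rw [pser, tsum_eq_single 0] <;> simp +contextual

/-- Nonnegative coefficients let the triangle inequality act term by term, so the values on a disc
are controlled by the value at its rightmost point. All later bounds on $|w|\le\kappa$ rest on this.
-/
lemma norm_pser_le {a : ℕ → ℝ} {ρ : ℝ≥0∞} (ha : ConvergesBelow a ρ) (h0 : ∀ n, 0 ≤ a n)
    {z : ℂ} {x : ℝ} (hzx : ‖z‖ ≤ x) (hx : ENNReal.ofReal x < ρ) :
    ‖pser a z‖ ≤ (pser a x).re := by
  have hx0 : 0 ≤ x := (norm_nonneg z).trans hzx
  rw [pser_ofReal, Complex.ofReal_re]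
  refine tsum_of_norm_bounded (ha.summable_real (by rwa [abs_of_nonneg hx0])).hasSum fun n => ?_
  rw [norm_mul_pow_eq, abs_of_nonneg (h0 n)]
  exact mul_le_mul_of_nonneg_left (pow_le_pow_left₀ (norm_nonneg _) hzx n) (h0 n)

lemma pser_re_mono {a : ℕ → ℝ} {ρ : ℝ≥0∞} (ha : ConvergesBelow a ρ) (h0 : ∀ n, 0 ≤ a n)
    {x y : ℝ} (hx : 0 ≤ x) (hxy : x ≤ y) (hy : ENNReal.ofReal y < ρ) :
    (pser a x).re ≤ (pser a y).re :=
  (Complex.re_le_norm _).trans (norm_pser_le ha h0 (by simpa [abs_of_nonneg hx]) hy)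

lemma pser_re_nonneg {a : ℕ → ℝ} (h0 : ∀ n, 0 ≤ a n) {x : ℝ} (hx : 0 ≤ x) :
    0 ≤ (pser a x).re := by
  rw [pser_ofReal, Complex.ofReal_re]
  exact tsum_nonneg fun n => mul_nonneg (h0 n) (pow_nonneg hx n)

lemma pser_ofReal_re (a : ℕ → ℝ) (x : ℝ) : ((pser a x).re : ℂ) = pser a x := by
  rw [pser_ofReal, Complex.ofReal_re]

/-- The expansion `∑ aₙ zⁿ = ∑_{n < N} aₙ zⁿ + z^N ∑ a_{n + N} zⁿ`. -/
lemma ConvergesBelow.pser_eq_sum_add {a : ℕ → ℝ} {ρ : ℝ≥0∞} (ha : ConvergesBelow a ρ) (N : ℕ)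
    {z : ℂ} (hz : ENNReal.ofReal ‖z‖ < ρ) :
    pser a z = ∑ n ∈ Finset.range N, (a n : ℂ) * z ^ n + z ^ N * pser (fun n => a (n + N)) z := by
  rw [pser, ← (ha.summable hz).sum_add_tsum_nat_add N, pser, ← tsum_mul_left]
  congr 1
  exact tsum_congr fun n => by ring

lemma ConvergesBelow.shift {a : ℕ → ℝ} {ρ : ℝ≥0∞} (ha : ConvergesBelow a ρ) (N : ℕ) :
    ConvergesBelow (fun n => a (n + N)) ρ :=
  ha.of_le N fun m => by
    rcases Nat.eq_zero_or_pos N with rfl | hN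
    · simp
    · have : (1 : ℝ) ≤ (m + N : ℝ) ^ N := one_le_pow₀ (by
        have : (1 : ℝ) ≤ N := by exact_mod_cast hN
        linarith [Nat.cast_nonneg (α := ℝ) m])
      exact le_mul_of_one_le_left (abs_nonneg _) this

/-! ### Derivatives at the origin of products -/

lemma analyticAt_finset_prod {ι : Type*} (s : Finset ι) {f : ι → ℂ → ℂ} {x : ℂ}
    (h : ∀ i ∈ s, AnalyticAt ℂ (f i) x) : AnalyticAt ℂ (fun z => ∏ i ∈ s, f i z) x :=
  Finset.analyticAt_fun_prod s h

/-- The Leibniz rule for the derivatives of a product, one factor being chosen for each of the `n`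
derivations. -/
lemma iteratedDeriv_prod {ι : Type*} [Fintype ι] [DecidableEq ι] (n : ℕ) (F : ι → ℂ → ℂ) {x : ℂ}
    (hF : ∀ i, AnalyticAt ℂ (F i) x) :
    iteratedDeriv n (fun z => ∏ i, F i z) x =
      ∑ f : Fin n → ι, ∏ i, iteratedDeriv (Finset.univ.filter (f · = i)).card (F i) x := by
  induction n generalizing F with
  | zero => simp
  | succ n ih =>
    -- Each term of the derivative is again a product over the same index set, with one factor
    -- updated, so the induction hypothesis applies to it.
    have h1 : deriv (fun z => ∏ i, F i z) =ᶠ[𝓝 x]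
        fun z => ∑ i, ∏ j, (Function.update F i (deriv (F i))) j z := by
      have : ∀ᶠ z in 𝓝 x, ∀ i, AnalyticAt ℂ (F i) z :=
        eventually_all.2 fun i => (hF i).eventually_analyticAt
      filter_upwards [this] with z hz
      rw [deriv_fun_finsetProd (fun i _ => (hz i).differentiableAt)]
      refine Finset.sum_congr rfl fun i _ => ?_
      rw [← Finset.mul_prod_erase _ _ (Finset.mem_univ i), smul_eq_mul, mul_comm]
      congr 1
      · simp
      · refine Finset.prod_congr rfl fun j hj => ?_
        rw [Function.update_of_ne (Finset.ne_of_mem_erase hj)]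
    have hF' : ∀ i j, AnalyticAt ℂ (Function.update F i (deriv (F i)) j) x := by
      intro i j
      rcases eq_or_ne j i with rfl | h
      · simpa using (hF j).deriv
      · simpa [Function.update_of_ne h] using hF j
    rw [iteratedDeriv_succ', h1.iteratedDeriv_eq, iteratedDeriv_fun_sum]
    -- A map from `Fin (n + 1)` is its value at $0$, the factor hit by the first derivation,
    -- together with a map from `Fin n`.
    · rw [← (Fin.consEquiv fun _ => ι).sum_comp, Fintype.sum_prod_type]
      refine Finset.sum_congr rfl fun i _ => ?_
      rw [ih _ (hF' i)]
      refine Finset.sum_congr rfl fun f _ => Finset.prod_congr rfl fun j _ => ?_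
      simp only [Fin.consEquiv_apply]
      rw [Fin.card_filter_univ_succ]
      rcases eq_or_ne j i with rfl | h
      · simp [iteratedDeriv_succ']
      · simp [Function.update_of_ne h, h.symm]
    · intro i _
      exact (analyticAt_finset_prod _ fun j _ => hF' i j).contDiffAt

/-- The Leibniz rule for the derivatives of a product, in terms of the maps from a set of the right
cardinality to the set of factors. -/
lemma iteratedDeriv_prod_of_card {ι α : Type*} [Fintype ι] [DecidableEq ι] [Fintype α]
    [DecidableEq α] (F : ι → ℂ → ℂ) {x : ℂ} (hF : ∀ i, AnalyticAt ℂ (F i) x) :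
    iteratedDeriv (Fintype.card α) (fun z => ∏ i, F i z) x =
      ∑ f : α → ι, ∏ i, iteratedDeriv (Finset.univ.filter (f · = i)).card (F i) x := by
  rw [iteratedDeriv_prod _ F hF]
  refine Fintype.sum_equiv ((Fintype.equivFin α).symm.arrowCongr (Equiv.refl ι)) _ _ fun f =>
    Finset.prod_congr rfl fun i _ => ?_
  congr 1
  refine Finset.card_equiv (Fintype.equivFin α).symm fun a => ?_
  simp [Equiv.arrowCongr]

/-- Each derivation lowers the exponent of $g$ by at most one, so after $n<M$ of them a factor $g$
remains, and it vanishes at $x$. -/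
lemma iteratedDeriv_pow_mul_eq_zero {g h : ℂ → ℂ} (n M : ℕ) (hnM : n < M) {x : ℂ}
    (hg : AnalyticAt ℂ g x) (hh : AnalyticAt ℂ h x) (h0 : g x = 0) :
    iteratedDeriv n (fun z => g z ^ M * h z) x = 0 := by
  induction n generalizing M h with
  | zero => simp [h0, Nat.pos_iff_ne_zero.1 hnM]
  | succ n ih =>
    obtain ⟨M, rfl⟩ : ∃ M', M = M' + 1 := ⟨M - 1, by omega⟩
    have : deriv (fun z => g z ^ (M + 1) * h z) =ᶠ[𝓝 x]
        fun z => g z ^ M * ((M + 1) * deriv g z * h z + g z * deriv h z) := by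
      filter_upwards [hg.eventually_analyticAt, hh.eventually_analyticAt] with z h1 h2
      rw [deriv_fun_mul (h1.differentiableAt.fun_pow _) h2.differentiableAt,
        deriv_fun_pow h1.differentiableAt]
      push_cast
      ring
    rw [iteratedDeriv_succ', this.iteratedDeriv_eq]
    refine ih M (by omega) ?_
    exact ((analyticAt_const.mul hg.deriv).mul hh).add (hg.mul hh.deriv)

/-- The derivatives at a zero of `g` of the product of a power series in `g` with `h`. -/
lemma ConvergesBelow.iteratedDeriv_comp_mul {a : ℕ → ℝ} {ρ : ℝ≥0∞} (ha : ConvergesBelow a ρ)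
    (hρ : 0 < ρ) {g h : ℂ → ℂ} {x : ℂ} (hg : AnalyticAt ℂ g x) (hh : AnalyticAt ℂ h x)
    (h0 : g x = 0) (n N : ℕ) (hnN : n < N) :
    iteratedDeriv n (fun z => pser a (g z) * h z) x =
      ∑ m ∈ Finset.range N, (a m : ℂ) * iteratedDeriv n (fun z => g z ^ m * h z) x := by
  have hev : ∀ᶠ z in 𝓝 x, ENNReal.ofReal ‖g z‖ < ρ :=
    hg.continuousAt.eventually_mem ((isOpen_ofReal_norm_lt ρ).mem_nhds (by simpa [h0] using hρ))
  -- The series is cut at degree $N$. Its tail carries the factor $g^N$ with $N>n$ and does not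
  -- contribute to the derivative of order $n$.
  have h1 : (fun z => pser a (g z) * h z) =ᶠ[𝓝 x]
      fun z => (∑ m ∈ Finset.range N, (a m : ℂ) * (g z ^ m * h z)) +
        g z ^ N * (pser (fun n => a (n + N)) (g z) * h z) := by
    filter_upwards [hev] with z hz
    rw [ha.pser_eq_sum_add N hz, add_mul, Finset.sum_mul]
    congr 1
    · exact Finset.sum_congr rfl fun m _ => by ring
    · ring
  have hr : AnalyticAt ℂ (fun z => pser (fun n => a (n + N)) (g z) * h z) x := by
    refine AnalyticAt.mul ?_ hh
    exact ((ha.shift N).analyticAt (by simpa [h0] using hρ)).comp hg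
  have hm : ∀ m, AnalyticAt ℂ (fun z => g z ^ m * h z) x := fun m => (hg.fun_pow m).mul hh
  rw [h1.iteratedDeriv_eq, iteratedDeriv_fun_add, iteratedDeriv_fun_sum,
    iteratedDeriv_pow_mul_eq_zero n N hnN hg hr h0, add_zero]
  · refine Finset.sum_congr rfl fun m _ => ?_
    rw [iteratedDeriv_const_mul_field]
  · exact fun m _ => (analyticAt_const.mul (hm m)).contDiffAt
  · exact (Finset.analyticAt_fun_sum _ fun m _ => analyticAt_const.mul (hm m)).contDiffAt
  · exact ((hg.fun_pow N).mul hr).contDiffAt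

/-! ### The series counting occurrences -/

open Classical in
/-- The coefficients of `occSeries`. -/
noncomputable def ocoef (P : GraphClass) {k : ℕ} (H : SimpleGraph (Fin k)) (m : ℕ) : ℝ :=
  (∑ G : SimpleGraph (Fin (m + k)) with G ∈ P (m + k), (occ H G : ℝ)) / (m + k).factorial

lemma occSeries_eq_pser (P : GraphClass) {k : ℕ} (H : SimpleGraph (Fin k)) (x : ℝ) :
    (occSeries P H x : ℂ) = pser (ocoef P H) x := by
  rw [pser_ofReal]; rfl

lemma occSeries_eq_pser_re (P : GraphClass) {k : ℕ} (H : SimpleGraph (Fin k)) (x : ℝ) :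
    occSeries P H x = (pser (ocoef P H) x).re := by
  rw [← occSeries_eq_pser, Complex.ofReal_re]

lemma ocoef_nonneg (P : GraphClass) {k : ℕ} (H : SimpleGraph (Fin k)) (m : ℕ) :
    0 ≤ ocoef P H m := by
  unfold ocoef; positivity

/-- Embeddings as induced subgraphs are injections along which the graph pulls back. -/
def embeddingEquivComap {k n : ℕ} (H : SimpleGraph (Fin k)) (G : SimpleGraph (Fin n)) :
    (H ↪g G) ≃ {σ : Fin k ↪ Fin n // G.comap σ = H} where
  toFun e := ⟨e.toEmbedding, by
    ext a b
    exact e.map_rel_iff⟩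
  invFun σ := ⟨σ.1, by
    intro a b
    obtain ⟨σ, rfl⟩ := σ
    rfl⟩
  left_inv _ := rfl
  right_inv _ := rfl

lemma occ_eq_card {k n : ℕ} (H : SimpleGraph (Fin k)) (G : SimpleGraph (Fin n)) :
    occ H G = Nat.card {σ : Fin k ↪ Fin n // G.comap σ = H} :=
  Nat.card_congr (embeddingEquivComap H G)

lemma occ_eq_descFactorial {k n : ℕ} {H : SimpleGraph (Fin k)} {G : SimpleGraph (Fin n)}
    (h : ∀ σ : Fin k ↪ Fin n, G.comap σ = H) : occ H G = n.descFactorial k := by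
  rw [occ_eq_card, Nat.card_congr (Equiv.subtypeUnivEquiv h), Nat.card_eq_fintype_card,
    Fintype.card_embedding_eq]
  simp

lemma occ_le {k n : ℕ} (H : SimpleGraph (Fin k)) (G : SimpleGraph (Fin n)) :
    occ H G ≤ n ^ k := by
  rw [occ_eq_card]
  refine (Nat.card_le_card_of_injective _ Subtype.val_injective).trans ?_
  rw [Nat.card_eq_fintype_card, Fintype.card_embedding_eq]
  simpa using Nat.descFactorial_le_pow n k

open Classical in
lemma classCoeff_eq (P : GraphClass) (n : ℕ) :
    classCoeff P n = (∑ G : SimpleGraph (Fin n) with G ∈ P n, (1 : ℝ)) / n.factorial := by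
  rw [classCoeff, Finset.sum_const, nsmul_eq_mul, mul_one, ← Set.ncard_coe_finset]
  simp

lemma classCoeff_nonneg (P : GraphClass) (n : ℕ) : 0 ≤ classCoeff P n := by
  unfold classCoeff; positivity

lemma ocoef_le (P : GraphClass) {k : ℕ} (H : SimpleGraph (Fin k)) (m : ℕ) :
    ocoef P H m ≤ (m + k : ℝ) ^ k * classCoeff P (m + k) := by
  classical
  rw [classCoeff_eq, ocoef, mul_div_assoc', Finset.mul_sum]
  gcongr with G hG
  rw [mul_one]
  exact_mod_cast occ_le H G

lemma convergesBelow_ocoef (P : GraphClass) {k : ℕ} (H : SimpleGraph (Fin k)) :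
    ConvergesBelow (ocoef P H) (seriesRadius (classCoeff P)) :=
  (convergesBelow_seriesRadius _).of_le k fun m => by
    rw [abs_of_nonneg (ocoef_nonneg _ _ _), abs_of_nonneg (classCoeff_nonneg _ _)]
    exact ocoef_le P H m

/-- With at most one distinguished child there is no adjacency to prescribe. This is why unmarked
trees ($k=0$) and skipped nodes ($k=1$) involve only $P$ and $P'$. -/
lemma comap_eq_of_subsingleton {k n : ℕ} (hk : k ≤ 1) (H : SimpleGraph (Fin k))
    (G : SimpleGraph (Fin n)) (σ : Fin k ↪ Fin n) : G.comap σ = H := by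
  have : Subsingleton (Fin k) := Fin.subsingleton_iff_le_one.2 hk
  ext a b
  simp [Subsingleton.elim a b]

lemma ocoef_zero (P : GraphClass) (H : SimpleGraph (Fin 0)) : ocoef P H = classCoeff P := by
  classical
  ext m
  rw [classCoeff_eq, ocoef]
  congr 1
  refine Finset.sum_congr rfl fun G _ => ?_
  rw [occ_eq_descFactorial (comap_eq_of_subsingleton zero_le_one H G)]
  simp

lemma ocoef_one (P : GraphClass) (H : SimpleGraph (Fin 1)) :
    ocoef P H = derivCoeff (classCoeff P) := by
  classical
  ext m
  rw [derivCoeff, classCoeff_eq, ocoef, mul_div_assoc', Finset.mul_sum]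
  congr 1
  refine Finset.sum_congr rfl fun G _ => ?_
  rw [occ_eq_descFactorial (comap_eq_of_subsingleton le_rfl H G)]
  simp

/-! ### Kinds of nodes -/

/-- The three kinds of nodes of modular decomposition trees. -/
inductive Kind : Type
  | join : Kind
  | union : Kind
  | prime : Kind
  deriving DecidableEq

instance : Fintype Kind := ⟨{Kind.join, Kind.union, Kind.prime}, fun q => by cases q <;> simp⟩

/-- The graphs that decorate the nodes of a given kind. -/
def Kind.graphs (P : GraphClass) : Kind → GraphClass
  | join => fun n => {G | 2 ≤ n ∧ G = ⊤}
  | union => fun n => {G | 2 ≤ n ∧ G = ⊥}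
  | prime => P

/-- In a complete or edgeless graph every set of vertices is a module, and $\{0,1\}$ is a nontrivial
one as soon as there is a third vertex. -/
lemma isPrime_not_isLinear {n : ℕ} {G : SimpleGraph (Fin n)} (h : IsPrime G) : ¬ IsLinear G := by
  obtain ⟨hn, h⟩ := h
  intro hl
  obtain ⟨n, rfl⟩ : ∃ m, n = m + 3 := ⟨n - 3, by omega⟩
  have hm : IsModule G {0, 1} := by
    intro x hx y hy z hz
    have hxz : x ≠ z := fun h => hz (h ▸ hx)
    have hyz : y ≠ z := fun h => hz (h ▸ hy)
    rcases hl with rfl | rfl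
    · simp [hxz, hyz]
    · exact Iff.rfl
  rcases h _ hm with h | h | ⟨v, h⟩
  · exact absurd h (Set.insert_nonempty _ _).ne_empty
  · have : (2 : Fin (n + 3)) ∈ ({0, 1} : Set (Fin (n + 3))) := h ▸ Set.mem_univ _
    simp [Fin.ext_iff, Nat.mod_eq_of_lt (show 2 < n + 3 by omega)] at this
  · have h0 : (0 : Fin (n + 3)) ∈ ({v} : Set (Fin (n + 3))) := h ▸ (by simp)
    have h1 : (1 : Fin (n + 3)) ∈ ({v} : Set (Fin (n + 3))) := h ▸ (by simp)
    have := (Set.mem_singleton_iff.1 h0).trans (Set.mem_singleton_iff.1 h1).symm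
    simp at this

lemma top_ne_bot_of_two_le {n : ℕ} (hn : 2 ≤ n) :
    (⊤ : SimpleGraph (Fin n)) ≠ ⊥ := by
  have : Nontrivial (Fin n) := Fin.nontrivial_iff_two_le.2 hn
  exact top_ne_bot

/-- The condition $2\le n$ in the linear kinds matters, since the complete and the edgeless graph
coincide on fewer vertices. Uniqueness of the kind is what makes the decomposition by the root a
disjoint union. -/
lemma Kind.eq_of_mem_graphs {P : GraphClass} (hP : IsPrimeClass P) {q q' : Kind} {n : ℕ}
    {G : SimpleGraph (Fin n)} (h : G ∈ q.graphs P n) (h' : G ∈ q'.graphs P n) : q = q' := by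
  cases q <;> cases q' <;> simp only [Kind.graphs, Set.mem_ofPred_eq] at h h' <;> try rfl
  · exact absurd (h.2.symm.trans h'.2) (top_ne_bot_of_two_le h.1)
  · exact absurd (Or.inl h.2) (isPrime_not_isLinear (hP.1 _ _ h'))
  · exact absurd (h'.2.symm.trans h.2) (top_ne_bot_of_two_le h.1)
  · exact absurd (Or.inr h.2) (isPrime_not_isLinear (hP.1 _ _ h'))
  · exact absurd (Or.inl h'.2) (isPrime_not_isLinear (hP.1 _ _ h))
  · exact absurd (Or.inr h'.2) (isPrime_not_isLinear (hP.1 _ _ h))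

lemma Kind.two_le_of_mem_graphs {P : GraphClass} (hP : IsPrimeClass P) {q : Kind} {n : ℕ}
    {G : SimpleGraph (Fin n)} (h : G ∈ q.graphs P n) : 2 ≤ n := by
  cases q
  · exact h.1
  · exact h.1
  · exact le_trans (by norm_num) (hP.1 _ _ h).1

lemma Kind.isLinear_iff {P : GraphClass} (hP : IsPrimeClass P) {q : Kind} {n : ℕ}
    {G : SimpleGraph (Fin n)} (h : G ∈ q.graphs P n) : IsLinear G ↔ q ≠ Kind.prime := by
  cases q
  · exact iff_of_true (Or.inl h.2) (by simp)
  · exact iff_of_true (Or.inr h.2) (by simp)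
  · simpa using isPrime_not_isLinear (hP.1 _ _ h)

lemma Kind.comap_mem_graphs {P : GraphClass} (hP : IsPrimeClass P) {q : Kind} {n : ℕ}
    {G : SimpleGraph (Fin n)} (h : G ∈ q.graphs P n) (π : Equiv.Perm (Fin n)) :
    G.comap π ∈ q.graphs P n := by
  cases q
  · obtain ⟨h1, rfl⟩ := h
    refine ⟨h1, ?_⟩
    ext a b; simp
  · obtain ⟨h1, rfl⟩ := h
    refine ⟨h1, ?_⟩
    ext a b; simp
  · have := hP.2 n G h π.symm
    rw [SimpleGraph.map_symm] at this
    exact this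

/-- The coefficients of `exp` truncated so that degree `m` appears only if `2 ≤ m + k`. -/
noncomputable def expCoeff (k m : ℕ) : ℝ := if 2 ≤ m + k then (m.factorial : ℝ)⁻¹ else 0

-- The class has one graph of each size $n\ge2$, and all its induced subgraphs of a given size are
-- equal. Either all $(m+k)!/m!$ injections are occurrences of $H$ or none is, so the coefficient is
-- $1/m!$ or $0$.
open Classical in
lemma ocoef_linear {P : GraphClass} (L : ∀ n, SimpleGraph (Fin n))
    (hL : ∀ k n (σ : Fin k ↪ Fin n), (L n).comap σ = L k)
    (hP : ∀ n, P n = {G | 2 ≤ n ∧ G = L n}) {k : ℕ} (H : SimpleGraph (Fin k)) (m : ℕ) :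
    ocoef P H m = if H = L k then expCoeff k m else 0 := by
  rw [ocoef, expCoeff]
  have hP' : ∀ G, G ∈ P (m + k) ↔ 2 ≤ m + k ∧ G = L (m + k) := fun G => by rw [hP]; exact Iff.rfl
  by_cases hm : 2 ≤ m + k
  · have h1 : (∑ G : SimpleGraph (Fin (m + k)) with G ∈ P (m + k),
        (occ H G : ℝ)) = occ H (L (m + k)) := by
      rw [Finset.sum_filter]
      exact (Finset.sum_eq_single (L (m + k)) (fun G _ hG => if_neg fun h => hG ((hP' G).1 h).2)
        (by simp)).trans (if_pos ((hP' _).2 ⟨hm, rfl⟩))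
    rw [h1, if_pos hm]
    split_ifs with h
    · subst h
      rw [occ_eq_descFactorial (hL _ _)]
      have := Nat.factorial_mul_descFactorial (Nat.le_add_left k m)
      rw [Nat.add_sub_cancel] at this
      rw [← this]
      have h1 := Nat.factorial_ne_zero m
      have h2 : (m + k).descFactorial k ≠ 0 := by
        intro h0; rw [h0, mul_zero] at this; exact Nat.factorial_ne_zero _ this.symm
      push_cast
      field_simp
    · have : IsEmpty {σ : Fin k ↪ Fin (m + k) // (L (m + k)).comap σ = H} :=
        ⟨fun σ => h (σ.2.symm.trans (hL _ _ _))⟩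
      rw [occ_eq_card, Nat.card_of_isEmpty]
      simp
  · simp [hm, hP']

lemma ocoef_join (P : GraphClass) {k : ℕ} (H : SimpleGraph (Fin k)) (h : H = ⊤) :
    ocoef (Kind.join.graphs P) H = expCoeff k := by
  classical
  ext m
  rw [ocoef_linear (P := Kind.join.graphs P) (fun _ => ⊤) (fun k n σ => by ext; simp) (fun _ => rfl), if_pos h]

lemma ocoef_union (P : GraphClass) {k : ℕ} (H : SimpleGraph (Fin k)) (h : H = ⊥) :
    ocoef (Kind.union.graphs P) H = expCoeff k := by
  classical
  ext m
  rw [ocoef_linear (P := Kind.union.graphs P) (fun _ => ⊥) (fun k n σ => by ext; simp) (fun _ => rfl), if_pos h]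

lemma ocoef_join_of_ne (P : GraphClass) {k : ℕ} (H : SimpleGraph (Fin k)) (h : H ≠ ⊤) :
    ocoef (Kind.join.graphs P) H = 0 := by
  classical
  ext m
  rw [ocoef_linear (P := Kind.join.graphs P) (fun _ => ⊤) (fun k n σ => by ext; simp) (fun _ => rfl), if_neg h]
  rfl

lemma ocoef_union_of_ne (P : GraphClass) {k : ℕ} (H : SimpleGraph (Fin k)) (h : H ≠ ⊥) :
    ocoef (Kind.union.graphs P) H = 0 := by
  classical
  ext m
  rw [ocoef_linear (P := Kind.union.graphs P) (fun _ => ⊥) (fun k n σ => by ext; simp) (fun _ => rfl), if_neg h]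
  rfl

lemma hasSum_exp (z : ℂ) : HasSum (fun n : ℕ => ((n.factorial : ℝ)⁻¹ : ℝ) * z ^ n)
    (Complex.exp z) := by
  rw [Complex.exp_eq_exp_ℂ]
  have h : (fun n : ℕ => (((n.factorial : ℝ)⁻¹ : ℝ) : ℂ) * z ^ n) =
      fun n => z ^ n / n.factorial := by
    ext n
    push_cast
    rw [inv_mul_eq_div]
  rw [h]
  exact NormedSpace.expSeries_div_hasSum_exp z

/-- The truncation says that a linear node has at least two children: besides $k$ distinguished ones
there must be at least two others for $k=0$, one for $k=1$, and none for $k\ge2$. -/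
lemma pser_expCoeff (k : ℕ) (z : ℂ) :
    pser (expCoeff k) z =
      Complex.exp z - (if k < 2 then 1 else 0) - (if k < 1 then z else 0) := by
  have h0 : HasSum (fun n : ℕ => if n = 0 then (if k < 2 then (1 : ℂ) else 0) else 0)
      (if k < 2 then 1 else 0) := by
    simpa using hasSum_ite_eq (0 : ℕ) (if k < 2 then (1 : ℂ) else 0)
  have h1 : HasSum (fun n : ℕ => if n = 1 then (if k < 1 then z else 0) else 0)
      (if k < 1 then z else 0) := hasSum_ite_eq (1 : ℕ) _
  rw [pser, ← (((hasSum_exp z).sub h0).sub h1).tsum_eq]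
  refine tsum_congr fun n => ?_
  rcases n with _ | _ | n
  · by_cases h : k < 2 <;> simp [expCoeff, h, not_le.2, not_lt.1]
  · by_cases h : k < 1
    · simp [expCoeff, h]
      omega
    · simp [expCoeff, h, show 2 ≤ 1 + k by omega]
  · simp [expCoeff, show 2 ≤ n + 1 + 1 + k by omega]

lemma convergesBelow_expCoeff (k : ℕ) (ρ : ℝ≥0∞) : ConvergesBelow (expCoeff k) ρ := by
  intro r hr _
  refine Summable.of_nonneg_of_le (fun n => by positivity) (fun n => ?_)
    (Real.summable_pow_div_factorial r)
  rw [expCoeff]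
  split_ifs
  · rw [abs_of_nonneg (by positivity), inv_mul_eq_div]
  · simp; positivity

lemma Kind.convergesBelow (P : GraphClass) (q : Kind) {k : ℕ} (H : SimpleGraph (Fin k)) :
    ConvergesBelow (ocoef (q.graphs P) H) (seriesRadius (classCoeff P)) := by
  have h0 : ConvergesBelow 0 (seriesRadius (classCoeff P)) := fun r _ _ => by simp
  cases q
  · by_cases h : H = ⊤
    · rw [ocoef_join P H h]; exact convergesBelow_expCoeff _ _
    · rw [ocoef_join_of_ne P H h]; exact h0
  · by_cases h : H = ⊥
    · rw [ocoef_union P H h]; exact convergesBelow_expCoeff _ _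
    · rw [ocoef_union_of_ne P H h]; exact h0
  · exact convergesBelow_ocoef P H

/-! ### Labels of trees -/

lemma notMem_of_nodup_sum {ι α : Type*} [Fintype ι] [DecidableEq α]
    {m : ι → Multiset α} (h : (∑ i, m i).Nodup) {i j : ι} {a : α} (hi : a ∈ m i) (hj : a ∈ m j) :
    i = j := by
  classical
  by_contra hij
  have h1 : (∑ i, m i).count a ≤ 1 := Multiset.nodup_iff_count_le_one.1 h a
  rw [Multiset.count_sum'] at h1
  have h2 : ∑ l ∈ ({i, j} : Finset ι), (m l).count a ≤ ∑ l, (m l).count a :=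
    Finset.sum_le_sum_of_subset (Finset.subset_univ _)
  rw [Finset.sum_pair hij] at h2
  have := Multiset.count_pos.2 hi
  have := Multiset.count_pos.2 hj
  omega

lemma sum_val_eq_biUnion_val {ι : Type*} [Fintype ι] {s : ι → Finset ℕ}
    (h : ∀ i j, i ≠ j → Disjoint (s i) (s j)) :
    ∑ i, (s i).val = (Finset.univ.biUnion s).val := by
  classical
  have h' : ((Finset.univ : Finset ι) : Set ι).PairwiseDisjoint s := fun i _ j _ hij => h i j hij
  rw [← Finset.disjiUnion_eq_biUnion _ _ h', Finset.disjiUnion_val]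
  rfl

namespace STree

lemma labels_node {d : ℕ} (G : SimpleGraph (Fin d)) (c : Fin d → STree) :
    (node d G c).labels = ∑ i, (c i).labels := rfl

lemma labels_ne_zero {t : STree} (ht : t.IsOrdered) : t.labels ≠ 0 := by
  induction t with
  | leaf l => simp [labels]
  | node d G c ih =>
    obtain ⟨hd, _, hc⟩ := ht
    rw [labels_node, Ne, Finset.sum_eq_zero_iff]
    exact fun h => ih ⟨0, by omega⟩ (hc _) (h _ (Finset.mem_univ _))

lemma minLabel_mem {t : STree} (ht : t.IsOrdered) : t.minLabel ∈ t.labels :=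
  Nat.sInf_mem (s := {l | l ∈ t.labels}) (Multiset.exists_mem_of_ne_zero (labels_ne_zero ht))

lemma labels_le_sum {d : ℕ} (c : Fin d → STree) (i : Fin d) :
    (c i).labels ≤ ∑ i, (c i).labels :=
  Finset.single_le_sum (f := fun i => (c i).labels) (fun _ _ => Multiset.zero_le _)
    (Finset.mem_univ i)

lemma le_card_labels {d : ℕ} {c : Fin d → STree} (hc : ∀ i, (c i).IsOrdered) :
    d ≤ (∑ i, (c i).labels).card := by
  rw [Multiset.card_sum]
  calc d = ∑ _i : Fin d, 1 := by simp
    _ ≤ _ := Finset.sum_le_sum fun i _ =>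
      Nat.one_le_iff_ne_zero.2 fun h => labels_ne_zero (hc i) (Multiset.card_eq_zero.1 h)

lemma card_labels_lt {d : ℕ} (hd : 2 ≤ d) {c : Fin d → STree} (hc : ∀ i, (c i).IsOrdered)
    (i : Fin d) : (c i).labels.card < (∑ i, (c i).labels).card := by
  obtain ⟨j, hj⟩ : ∃ j : Fin d, j ≠ i := by
    have : Nontrivial (Fin d) := Fin.nontrivial_iff_two_le.2 hd
    exact exists_ne i
  rw [Multiset.card_sum]
  refine Finset.single_lt_sum (f := fun i => (c i).labels.card) hj (Finset.mem_univ _)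
    (Finset.mem_univ _) ?_ fun _ _ _ => Nat.zero_le _
  exact Multiset.card_pos.2 (labels_ne_zero (hc j))

/-- There are finitely many ordered trees with given labels. -/
lemma finite_isOrdered (s : Multiset ℕ) : {t : STree | t.IsOrdered ∧ t.labels = s}.Finite := by
  induction hn : s.card using Nat.strong_induction_on generalizing s with
  | _ n ih =>
    subst hn
    have h1 : {t : STree | t.IsOrdered ∧ ∃ s' ≤ s, s'.card < s.card ∧ t.labels = s'}.Finite := by
      refine Set.Finite.subset ((Set.Finite.biUnion (s := {s' | s' ≤ s ∧ s'.card < s.card})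
        (t := fun s' => {t : STree | t.IsOrdered ∧ t.labels = s'})
        ((Multiset.powerset s).toFinset.finite_toSet.subset fun s' hs' => ?_)
        fun s' hs' => ih _ hs'.2 _ rfl)) ?_
      · simpa using hs'.1
      · rintro t ⟨ht, s', h1, h2, h3⟩
        exact Set.mem_biUnion (x := s') ⟨h1, h2⟩ ⟨ht, h3⟩
    have h2 : (⋃ d ∈ Set.Iic s.card, ⋃ G : SimpleGraph (Fin d), (fun c => node d G c) ''
        (Set.pi Set.univ fun _ : Fin d =>
          {t : STree | t.IsOrdered ∧ ∃ s' ≤ s, s'.card < s.card ∧ t.labels = s'})).Finite :=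
      (Set.finite_Iic _).biUnion fun d _ => Set.finite_iUnion fun G =>
        (Set.Finite.pi' fun _ => h1).image _ |>.subset (by
          refine Set.image_mono fun c hc => ?_
          exact fun i => hc i (Set.mem_univ i))
    have h3 : (leaf '' {l | l ∈ s}).Finite :=
      (s.toFinset.finite_toSet.subset fun l hl => by simpa using hl).image _
    refine (h3.union h2).subset ?_
    rintro t ⟨ht, rfl⟩
    cases t with
    | leaf l => exact Or.inl ⟨l, by simp [labels], rfl⟩
    | node d G c =>
      obtain ⟨hd, _, hc⟩ := ht
      refine Or.inr (Set.mem_biUnion (x := d) (le_card_labels hc) (Set.mem_iUnion.2 ⟨G, c, ?_, rfl⟩))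
      exact fun i _ => ⟨hc i, _, labels_le_sum c i, card_labels_lt hd hc i, rfl⟩

lemma finite_subtype_labels {A : Set STree} (hA : ∀ t ∈ A, t.IsOrdered) (s : Multiset ℕ) :
    Finite {t : STree // t ∈ A ∧ t.labels = s} :=
  ((finite_isOrdered s).subset fun t (ht : t ∈ A ∧ t.labels = s) =>
    (⟨hA t ht.1, ht.2⟩ : t.IsOrdered ∧ t.labels = s)).to_subtype

end STree

open STree

/-! ### Tuples of trees -/

/-- The trees of the class `A`, if they have no labels out of `T`, have the labels in `D`, and
further labels in `U`. -/
def SplitsOver (A : Set STree) (T U D : Finset ℕ) : Prop :=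
  ∀ t ∈ A, t.labels ≤ T.val → ∃ U' ⊆ U, t.labels = (U' ∪ D).val

/-- The number of trees in a set with a given set of labels. -/
noncomputable def numTrees (A : Set STree) (S : Finset ℕ) : ℕ :=
  Nat.card {t : STree // t ∈ A ∧ t.labels = S.val}

/-- The elements of `U` on which `f` takes the value `i`. -/
def fiber {U : Finset ℕ} {ι : Type*} [DecidableEq ι] (f : U → ι) (i : ι) : Finset ℕ :=
  (Finset.univ.filter fun u => f u = i).map (Function.Embedding.subtype _)

lemma mem_fiber {U : Finset ℕ} {ι : Type*} [DecidableEq ι] {f : U → ι} {i : ι} {a : ℕ} :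
    a ∈ fiber f i ↔ ∃ h : a ∈ U, f ⟨a, h⟩ = i := by
  simp [fiber]

lemma fiber_subset {U : Finset ℕ} {ι : Type*} [DecidableEq ι] (f : U → ι) (i : ι) :
    fiber f i ⊆ U := fun _ ha => (mem_fiber.1 ha).1

lemma card_fiber {U : Finset ℕ} {ι : Type*} [DecidableEq ι] (f : U → ι) (i : ι) :
    (fiber f i).card = (Finset.univ.filter fun u => f u = i).card := Finset.card_map _

lemma biUnion_fiber_union {U : Finset ℕ} {ι : Type*} [DecidableEq ι] [Fintype ι] (f : U → ι)
    (D : ι → Finset ℕ) :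
    Finset.univ.biUnion (fun i => fiber f i ∪ D i) = U ∪ Finset.univ.biUnion D := by
  ext a
  simp only [Finset.mem_biUnion, Finset.mem_union, Finset.mem_univ, true_and, mem_fiber]
  constructor
  · rintro ⟨i, ⟨h, _⟩ | h⟩
    · exact Or.inl h
    · exact Or.inr ⟨i, h⟩
  · rintro (h | ⟨i, h⟩)
    · exact ⟨f ⟨a, h⟩, Or.inl ⟨h, rfl⟩⟩
    · exact ⟨i, Or.inr h⟩

lemma disjoint_fiber_union {U : Finset ℕ} {ι : Type*} [DecidableEq ι] (f : U → ι)
    {D : ι → Finset ℕ} (hU : ∀ i, Disjoint U (D i)) (hD : ∀ i j, i ≠ j → Disjoint (D i) (D j))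
    (i j : ι) (hij : i ≠ j) : Disjoint (fiber f i ∪ D i) (fiber f j ∪ D j) := by
  rw [Finset.disjoint_union_left, Finset.disjoint_union_right, Finset.disjoint_union_right]
  refine ⟨⟨?_, (hU j).mono_left (fiber_subset f i)⟩,
    ((hU i).mono_left (fiber_subset f j)).symm, hD i j hij⟩
  rw [Finset.disjoint_left]
  intro a ha hb
  obtain ⟨h1, h2⟩ := mem_fiber.1 ha
  obtain ⟨_, h3⟩ := mem_fiber.1 hb
  exact hij (h2.symm.trans h3)

/-- A tuple is sorted by the map sending each $u\in U$ to the index of the tree that contains it.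
For a fixed map all label sets are known, because `SplitsOver` puts exactly $D_i$ into the $i$-th
tree, and the trees are then chosen independently. -/
lemma card_tuples {d : ℕ} (A : Fin d → Set STree) (U : Finset ℕ) (D : Fin d → Finset ℕ)
    (hord : ∀ i, ∀ t ∈ A i, t.IsOrdered)
    (hU : ∀ i, Disjoint U (D i)) (hD : ∀ i j, i ≠ j → Disjoint (D i) (D j))
    (hA : ∀ i, SplitsOver (A i) (U ∪ Finset.univ.biUnion D) U (D i)) :
    Nat.card {c : Fin d → STree // (∀ i, c i ∈ A i) ∧
        ∑ i, (c i).labels = (U ∪ Finset.univ.biUnion D).val} =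
      ∑ f : U → Fin d, ∏ i, numTrees (A i) (fiber f i ∪ D i) := by
  classical
  have hfin : ∀ i S, Finite {t : STree // t ∈ A i ∧ t.labels = S} := fun i S =>
    finite_subtype_labels (hord i) S
  let Φ : (Σ f : U → Fin d, ∀ i, {t : STree // t ∈ A i ∧ t.labels = (fiber f i ∪ D i).val}) →
      {c : Fin d → STree // (∀ i, c i ∈ A i) ∧
        ∑ i, (c i).labels = (U ∪ Finset.univ.biUnion D).val} := fun x =>
    ⟨fun i => (x.2 i).1, fun i => (x.2 i).2.1, by
      rw [Finset.sum_congr rfl fun i _ => (x.2 i).2.2,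
        sum_val_eq_biUnion_val (disjoint_fiber_union x.1 hU hD), biUnion_fiber_union]⟩
  have hΦ : Function.Bijective Φ := by
    constructor
    · rintro ⟨f, c⟩ ⟨f', c'⟩ h
      have hcc : ∀ i, (c i).1 = (c' i).1 := fun i => congrFun (congrArg Subtype.val h) i
      have hff : f = f' := by
        ext1 u
        have h1 : (u : ℕ) ∈ (c (f u)).1.labels := by
          rw [(c (f u)).2.2]
          exact Finset.mem_union_left _ (mem_fiber.2 ⟨u.2, rfl⟩)
        rw [hcc, (c' (f u)).2.2, Finset.mem_val, Finset.mem_union] at h1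
        rcases h1 with h1 | h1
        · exact (mem_fiber.1 h1).2.symm
        · exact absurd h1 (Finset.disjoint_left.1 (hU _) u.2)
      subst hff
      congr 1
      funext i
      exact Subtype.ext (hcc i)
    · rintro ⟨c, hc, hl⟩
      have hnd : (∑ i, (c i).labels).Nodup := hl ▸ Finset.nodup _
      have hex : ∀ u : U, ∃ i, (u : ℕ) ∈ (c i).labels := by
        intro u
        have : (u : ℕ) ∈ ∑ i, (c i).labels := by
          rw [hl]; exact Finset.mem_union_left _ u.2
        simpa [Multiset.mem_sum] using this
      choose f hf using hex
      refine ⟨⟨f, fun i => ⟨c i, hc i, ?_⟩⟩, rfl⟩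
      obtain ⟨U', hU', h1⟩ := hA i (c i) (hc i) (hl ▸ labels_le_sum c i)
      rw [h1]
      congr 2
      ext a
      rw [mem_fiber]
      constructor
      · intro ha
        refine ⟨hU' ha, notMem_of_nodup_sum hnd (hf ⟨a, hU' ha⟩) ?_⟩
        rw [h1]; exact Finset.mem_union_left _ ha
      · rintro ⟨ha, rfl⟩
        have := hf ⟨a, ha⟩
        rw [h1, Finset.mem_val, Finset.mem_union] at this
        exact this.resolve_right (Finset.disjoint_left.1 (hU _) ha)
  rw [← Nat.card_congr (Equiv.ofBijective Φ hΦ), Nat.card_sigma]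
  exact Finset.sum_congr rfl fun f _ => Nat.card_pi

open STree

/-! ### Trees with a given root and given classes of subtrees attached to it -/

/-- The class of the `i`-th tree, when the trees indexed through `σ` are in the classes `A j` and
the other ones are in the class `B`. -/
def childClass {k d : ℕ} (A : Fin k → Set STree) (B : Set STree) (σ : Fin k ↪ Fin d) :
    Fin d → Set STree := Function.extend σ A fun _ => B

/-- Trees with the root decorated in `𝒢`, where `k` of the attached trees are in the classes `A j`
and induce the subgraph `H` of the decoration of the root, and where the other ones are in `B`. -/
def nodeTrees (𝒢 : GraphClass) {k : ℕ} (H : SimpleGraph (Fin k)) (A : Fin k → Set STree)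
    (B : Set STree) : Set STree :=
  {t | ∃ (d : ℕ) (G : SimpleGraph (Fin d)) (c : Fin d → STree) (σ : Fin k ↪ Fin d),
    t = node d G c ∧ G ∈ 𝒢 d ∧ G.comap σ = H ∧ StrictMono (fun i => (c i).minLabel) ∧
      ∀ i, c i ∈ childClass A B σ i}

/-- The decoration, the distinguished attached trees and the attached trees of elements of
`nodeTrees` with label set `S`, without the condition on their order. -/
def nodeData (𝒢 : GraphClass) {k : ℕ} (H : SimpleGraph (Fin k)) (A : Fin k → Set STree)
    (B : Set STree) (S : Finset ℕ) (d : ℕ) :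
    Set ((SimpleGraph (Fin d) × (Fin k ↪ Fin d)) × (Fin d → STree)) :=
  {x | (x.1.1 ∈ 𝒢 d ∧ x.1.1.comap x.1.2 = H) ∧
    (∀ i, x.2 i ∈ childClass A B x.1.2 i) ∧ ∑ i, (x.2 i).labels = S.val}

lemma childClass_apply {k d : ℕ} (A : Fin k → Set STree) (B : Set STree) (σ : Fin k ↪ Fin d)
    (j : Fin k) : childClass A B σ (σ j) = A j := σ.injective.extend_apply _ _ _

lemma childClass_of_notMem {k d : ℕ} (A : Fin k → Set STree) (B : Set STree) (σ : Fin k ↪ Fin d)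
    {i : Fin d} (h : ¬ ∃ j, σ j = i) : childClass A B σ i = B := Function.extend_apply' _ _ _ h

lemma childClass_trans {k d : ℕ} (A : Fin k → Set STree) (B : Set STree) (σ : Fin k ↪ Fin d)
    (π : Equiv.Perm (Fin d)) (i : Fin d) :
    childClass A B (σ.trans π.toEmbedding) (π i) = childClass A B σ i := by
  by_cases h : ∃ j, σ j = i
  · obtain ⟨j, rfl⟩ := h
    rw [childClass_apply]
    exact childClass_apply A B (σ.trans π.toEmbedding) j
  · rw [childClass_of_notMem _ _ _ h, childClass_of_notMem]
    rintro ⟨j, hj⟩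
    exact h ⟨j, π.injective hj⟩

lemma childClass_isOrdered {k d : ℕ} {A : Fin k → Set STree} {B : Set STree}
    (hA : ∀ j, ∀ t ∈ A j, t.IsOrdered) (hB : ∀ t ∈ B, t.IsOrdered) (σ : Fin k ↪ Fin d) (i : Fin d)
    (t : STree) (ht : t ∈ childClass A B σ i) : t.IsOrdered := by
  by_cases h : ∃ j, σ j = i
  · obtain ⟨j, rfl⟩ := h
    rw [childClass_apply] at ht
    exact hA j t ht
  · rw [childClass_of_notMem _ _ _ h] at ht
    exact hB t ht

lemma minLabel_injective {d : ℕ} {c : Fin d → STree} (hc : ∀ i, (c i).IsOrdered)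
    (h : (∑ i, (c i).labels).Nodup) : Function.Injective fun i => (c i).minLabel := by
  intro i j hij
  have hi := minLabel_mem (hc i)
  rw [show (c i).minLabel = (c j).minLabel from hij] at hi
  exact notMem_of_nodup_sum h hi (minLabel_mem (hc j))

/-- Relabeling of the children. -/
def permData {k d : ℕ} (π : Equiv.Perm (Fin d))
    (x : (SimpleGraph (Fin d) × (Fin k ↪ Fin d)) × (Fin d → STree)) :
    (SimpleGraph (Fin d) × (Fin k ↪ Fin d)) × (Fin d → STree) :=
  ((x.1.1.comap π.symm, x.1.2.trans π.toEmbedding), x.2 ∘ π.symm)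

lemma permData_symm_permData {k d : ℕ} (π : Equiv.Perm (Fin d))
    (x : (SimpleGraph (Fin d) × (Fin k ↪ Fin d)) × (Fin d → STree)) :
    permData π.symm (permData π x) = x := by
  obtain ⟨⟨G, σ⟩, c⟩ := x
  simp only [permData, Prod.mk.injEq]
  refine ⟨⟨?_, ?_⟩, ?_⟩
  · ext; simp
  · ext; simp
  · ext; simp

lemma permData_mem {𝒢 : GraphClass} (h𝒢 : ∀ n, ∀ G ∈ 𝒢 n, ∀ π : Equiv.Perm (Fin n), G.comap π ∈ 𝒢 n)
    {k : ℕ} {H : SimpleGraph (Fin k)} {A : Fin k → Set STree} {B : Set STree} {S : Finset ℕ} {d : ℕ}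
    {x : (SimpleGraph (Fin d) × (Fin k ↪ Fin d)) × (Fin d → STree)}
    (hx : x ∈ nodeData 𝒢 H A B S d) (π : Equiv.Perm (Fin d)) :
    permData π x ∈ nodeData 𝒢 H A B S d := by
  obtain ⟨⟨h1, h2⟩, h3, h4⟩ := hx
  refine ⟨⟨h𝒢 d _ h1 π.symm, ?_⟩, fun i => ?_, ?_⟩
  · rw [← h2]
    ext a b
    simp [permData]
  · have := childClass_trans A B x.1.2 π (π.symm i)
    rw [Equiv.apply_symm_apply] at this
    simp only [permData]
    rw [this]
    exact h3 _
  · rw [← h4]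
    exact Equiv.sum_comp π.symm fun i => (x.2 i).labels

/-- The permutations of the children act on the data. Disjoint label sets have distinct minima, so
the action is free and each orbit has exactly one element with increasing minima; each orbit has
$d!$ elements. -/
lemma card_nodeData {𝒢 : GraphClass}
    (h𝒢 : ∀ n, ∀ G ∈ 𝒢 n, ∀ π : Equiv.Perm (Fin n), G.comap π ∈ 𝒢 n)
    {k : ℕ} {H : SimpleGraph (Fin k)} {A : Fin k → Set STree} {B : Set STree}
    (hA : ∀ j, ∀ t ∈ A j, t.IsOrdered) (hB : ∀ t ∈ B, t.IsOrdered) (S : Finset ℕ) (d : ℕ) :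
    Nat.card (nodeData 𝒢 H A B S d) =
      d.factorial * Nat.card {x // x ∈ nodeData 𝒢 H A B S d ∧
        StrictMono fun i => (x.2 i).minLabel} := by
  have hinj : ∀ x ∈ nodeData 𝒢 H A B S d, Function.Injective fun i => (x.2 i).minLabel := fun x hx =>
    minLabel_injective (fun i => childClass_isOrdered hA hB _ _ _ (hx.2.1 i))
      (hx.2.2 ▸ S.nodup)
  let Φ : Equiv.Perm (Fin d) × {x // x ∈ nodeData 𝒢 H A B S d ∧
      StrictMono fun i => (x.2 i).minLabel} → nodeData 𝒢 H A B S d := fun y =>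
    ⟨permData y.1 y.2.1, permData_mem h𝒢 y.2.2.1 _⟩
  have hΦ : Function.Bijective Φ := by
    constructor
    · rintro ⟨π, x, hx, hm⟩ ⟨π', x', hx', hm'⟩ h
      have h1 : permData π x = permData π' x' := congrArg Subtype.val h
      have h2 : (fun i => ((permData π x).2 i).minLabel) ∘ π =
          (fun i => ((permData π x).2 i).minLabel) ∘ π' := by
        have h3 : ∀ (π : Equiv.Perm (Fin d))
            (x : (SimpleGraph (Fin d) × (Fin k ↪ Fin d)) × (Fin d → STree)),
            (fun i => ((permData π x).2 i).minLabel) ∘ π = fun i => (x.2 i).minLabel := by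
          intro π x
          ext i
          simp [permData]
        -- Both permutations sort the same tuple of distinct minimal labels, so they are equal.
        apply Tuple.unique_monotone
        · rw [h3]; exact hm.monotone
        · rw [h1, h3]; exact hm'.monotone
      have h3 : π = π' := Equiv.ext fun i =>
        hinj _ (permData_mem h𝒢 hx π) (congrFun h2 i)
      subst h3
      have h4 := congrArg (permData π.symm) h1
      rw [permData_symm_permData, permData_symm_permData] at h4
      subst h4
      rfl
    · rintro ⟨x, hx⟩
      set π := Tuple.sort fun i => (x.2 i).minLabel with hπ
      refine ⟨⟨π, permData π.symm x, permData_mem h𝒢 hx _, ?_⟩, ?_⟩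
      · have h1 := Tuple.monotone_sort fun i => (x.2 i).minLabel
        exact h1.strictMono_of_injective ((hinj x hx).comp π.injective)
      · apply Subtype.ext
        exact permData_symm_permData π.symm x
  rw [← Nat.card_congr (Equiv.ofBijective Φ hΦ), Nat.card_prod, Nat.card_perm, Nat.card_fin]

/-- A tree of `nodeTrees` comes with an unspecified $\sigma$; nonemptiness of the $D_j$ makes
$\sigma$ unique, so that counting trees is counting sorted data. The range is long enough because
each child has a leaf. -/
lemma numTrees_nodeTrees {𝒢 : GraphClass} {k : ℕ} {H : SimpleGraph (Fin k)} {A : Fin k → Set STree}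
    {B : Set STree} (hA : ∀ j, ∀ t ∈ A j, t.IsOrdered) (hB : ∀ t ∈ B, t.IsOrdered)
    {U : Finset ℕ} {D : Fin k → Finset ℕ} (hD : ∀ j, (D j).Nonempty)
    (hAs : ∀ j, SplitsOver (A j) (U ∪ Finset.univ.biUnion D) U (D j)) :
    numTrees (nodeTrees 𝒢 H A B) (U ∪ Finset.univ.biUnion D) =
      ∑ d ∈ Finset.range ((U ∪ Finset.univ.biUnion D).card + 1),
        Nat.card {x // x ∈ nodeData 𝒢 H A B (U ∪ Finset.univ.biUnion D) d ∧
          StrictMono fun i => (x.2 i).minLabel} := by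
  classical
  set S := U ∪ Finset.univ.biUnion D with hS
  have hfin : ∀ d, Finite {x // x ∈ nodeData 𝒢 H A B S d ∧
      StrictMono fun i => (x.2 i).minLabel} := by
    intro d
    have h1 : (Set.pi Set.univ fun _ : Fin d =>
        ⋃ s ∈ S.val.powerset.toFinset, {t : STree | t.IsOrdered ∧ t.labels = s}).Finite :=
      Set.Finite.pi fun _ => (Finset.finite_toSet _).biUnion fun s _ => finite_isOrdered s
    refine Set.Finite.to_subtype ((Set.finite_univ (α := SimpleGraph (Fin d) × (Fin k ↪ Fin d))).prod
      h1 |>.subset ?_)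
    rintro x ⟨hx, _⟩
    refine ⟨Set.mem_univ _, fun i _ => ?_⟩
    refine Set.mem_biUnion (x := (x.2 i).labels) ?_
      ⟨childClass_isOrdered hA hB _ _ _ (hx.2.1 i), rfl⟩
    simpa [← hx.2.2] using labels_le_sum x.2 i
  let Φ : (Σ d : Fin (S.card + 1), {x // x ∈ nodeData 𝒢 H A B S d ∧
      StrictMono fun i => (x.2 i).minLabel}) →
      {t // t ∈ nodeTrees 𝒢 H A B ∧ t.labels = S.val} := fun y =>
    ⟨node y.1 y.2.1.1.1 y.2.1.2, ⟨_, _, _, y.2.1.1.2, rfl, y.2.2.1.1.1, y.2.2.1.1.2, y.2.2.2,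
      y.2.2.1.2.1⟩, y.2.2.1.2.2⟩
  have hΦ : Function.Bijective Φ := by
    constructor
    · rintro ⟨⟨d, hd⟩, ⟨⟨G, σ⟩, c⟩, hx, hm⟩ ⟨⟨d', hd'⟩, ⟨⟨G', σ'⟩, c'⟩, hx', hm'⟩ h
      have h1 : node d G c = node d' G' c' := congrArg Subtype.val h
      obtain ⟨rfl, hG, hc⟩ := node.inj h1
      obtain rfl := eq_of_heq hG
      obtain rfl := eq_of_heq hc
      -- The index $\sigma(j)$ is recovered as that of the only child with a label in $D_j$.
      have h2 : σ = σ' := by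
        ext1 j
        have hnd : (∑ i, (c i).labels).Nodup := hx.2.2 ▸ S.nodup
        obtain ⟨a, ha⟩ := hD j
        have h3 : ∀ σ : Fin k ↪ Fin d, (∀ i, c i ∈ childClass A B σ i) →
            a ∈ (c (σ j)).labels := by
          intro σ hσ
          have h4 := hσ (σ j)
          rw [childClass_apply] at h4
          obtain ⟨U', _, h5⟩ := hAs j _ h4 (hx.2.2 ▸ labels_le_sum c (σ j))
          rw [h5]
          exact Finset.mem_union_right _ ha
        exact notMem_of_nodup_sum hnd (h3 σ hx.2.1) (h3 σ' hx'.2.1)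
      subst h2
      rfl
    · rintro ⟨t, ⟨d, G, c, σ, rfl, h1, h2, h3, h4⟩, h5⟩
      have hd : d < S.card + 1 := by
        rw [Nat.lt_succ_iff, ← Finset.card_val, ← h5]
        exact le_card_labels fun i => childClass_isOrdered hA hB σ i _ (h4 i)
      exact ⟨⟨⟨d, hd⟩, ⟨⟨G, σ⟩, c⟩, ⟨⟨h1, h2⟩, h4, h5⟩, h3⟩, rfl⟩
  rw [numTrees, ← Nat.card_congr (Equiv.ofBijective Φ hΦ), Nat.card_sigma,
    Finset.sum_range fun d => Nat.card {x // x ∈ nodeData 𝒢 H A B S d ∧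
          StrictMono fun i => (x.2 i).minLabel}]

/-- The numbers of trees in `A` with the labels in `D` and a proper part of the labels of `S` are
the derivatives of `f` at the origin. -/
def CountedBy (A : Set STree) (U D S : Finset ℕ) (f : ℂ → ℂ) : Prop :=
  ∀ U' ⊆ U, (U' ∪ D) ⊂ S → (numTrees A (U' ∪ D) : ℂ) = iteratedDeriv U'.card f 0

lemma numTrees_empty {A : Set STree} (hA : ∀ t ∈ A, t.IsOrdered) : numTrees A ∅ = 0 := by
  rw [numTrees]
  have : IsEmpty {t : STree // t ∈ A ∧ t.labels = (∅ : Finset ℕ).val} :=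
    ⟨fun t => labels_ne_zero (hA _ t.2.1) t.2.2⟩
  exact Nat.card_of_isEmpty

/-- For a fixed pair $(G,\sigma)$, the sum over the maps from $U$ to the children is the Leibniz
rule for $g^{d-k}\prod f_j$. The result does not depend on the pair, whence the factorization. -/
lemma card_nodeData_eq_iteratedDeriv {𝒢 : GraphClass} (h2 : ∀ n, ∀ G ∈ 𝒢 n, 2 ≤ n)
    {k : ℕ} {H : SimpleGraph (Fin k)} {A : Fin k → Set STree}
    {B : Set STree} (hA : ∀ j, ∀ t ∈ A j, t.IsOrdered) (hB : ∀ t ∈ B, t.IsOrdered)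
    {U : Finset ℕ} {D : Fin k → Finset ℕ} (hD : ∀ j, (D j).Nonempty)
    (hU : ∀ j, Disjoint U (D j)) (hDD : ∀ i j, i ≠ j → Disjoint (D i) (D j))
    (hAs : ∀ j, SplitsOver (A j) (U ∪ Finset.univ.biUnion D) U (D j))
    (hBs : SplitsOver B (U ∪ Finset.univ.biUnion D) U ∅)
    {f : Fin k → ℂ → ℂ} {g : ℂ → ℂ} (hf : ∀ j, AnalyticAt ℂ (f j) 0) (hg : AnalyticAt ℂ g 0)
    (hg0 : g 0 = 0) (hfA : ∀ j, CountedBy (A j) U (D j) (U ∪ Finset.univ.biUnion D) (f j))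
    (hgB : CountedBy B U ∅ (U ∪ Finset.univ.biUnion D) g) (d : ℕ) :
    (Nat.card (nodeData 𝒢 H A B (U ∪ Finset.univ.biUnion D) d) : ℂ) =
      Nat.card {p : SimpleGraph (Fin d) × (Fin k ↪ Fin d) // p.1 ∈ 𝒢 d ∧ p.1.comap p.2 = H} *
        iteratedDeriv U.card (fun z => g z ^ (d - k) * ∏ j, f j z) 0 := by
  classical
  set S := U ∪ Finset.univ.biUnion D with hS
  let e : nodeData 𝒢 H A B S d ≃ Σ p : {p : SimpleGraph (Fin d) × (Fin k ↪ Fin d) //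
      p.1 ∈ 𝒢 d ∧ p.1.comap p.2 = H}, {c : Fin d → STree //
        (∀ i, c i ∈ childClass A B p.1.2 i) ∧ ∑ i, (c i).labels = S.val} :=
    { toFun := fun x => ⟨⟨x.1.1, x.2.1⟩, ⟨x.1.2, x.2.2⟩⟩
      invFun := fun y => ⟨⟨y.1.1, y.2.1⟩, y.1.2, y.2.2⟩
      left_inv := fun _ => rfl
      right_inv := fun _ => rfl }
  have key : ∀ p : {p : SimpleGraph (Fin d) × (Fin k ↪ Fin d) // p.1 ∈ 𝒢 d ∧ p.1.comap p.2 = H},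
      (Nat.card {c : Fin d → STree //
        (∀ i, c i ∈ childClass A B p.1.2 i) ∧ ∑ i, (c i).labels = S.val} : ℂ) =
      iteratedDeriv U.card (fun z => g z ^ (d - k) * ∏ j, f j z) 0 := by
    rintro ⟨⟨G, σ⟩, hG, hσ⟩
    have hd := h2 d G hG
    let D' : Fin d → Finset ℕ := Function.extend σ D fun _ => ∅
    let F : Fin d → ℂ → ℂ := Function.extend σ f fun _ => g
    have hD'a : ∀ j, D' (σ j) = D j := fun j => σ.injective.extend_apply _ _ _
    have hD'n : ∀ i, (¬ ∃ j, σ j = i) → D' i = ∅ := fun i h => Function.extend_apply' _ _ _ h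
    have hFa : ∀ j, F (σ j) = f j := fun j => σ.injective.extend_apply _ _ _
    have hFn : ∀ i, (¬ ∃ j, σ j = i) → F i = g := fun i h => Function.extend_apply' _ _ _ h
    have hF : ∀ i, AnalyticAt ℂ (F i) 0 := by
      intro i
      by_cases h : ∃ j, σ j = i
      · obtain ⟨j, rfl⟩ := h
        rw [hFa]; exact hf j
      · rw [hFn i h]; exact hg
    have hS' : U ∪ Finset.univ.biUnion D' = S := by
      rw [hS]
      congr 1
      ext a
      simp only [Finset.mem_biUnion, Finset.mem_univ, true_and]
      constructor
      · rintro ⟨i, hi⟩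
        by_cases h : ∃ j, σ j = i
        · obtain ⟨j, rfl⟩ := h
          exact ⟨j, hD'a j ▸ hi⟩
        · rw [hD'n i h] at hi
          simp at hi
      · rintro ⟨j, hj⟩
        exact ⟨σ j, (hD'a j).symm ▸ hj⟩
    have hUD : ∀ i, Disjoint U (D' i) := by
      intro i
      by_cases h : ∃ j, σ j = i
      · obtain ⟨j, rfl⟩ := h
        rw [hD'a]; exact hU j
      · rw [hD'n i h]; simp
    have hDD' : ∀ i j, i ≠ j → Disjoint (D' i) (D' j) := by
      intro i j hij
      by_cases h : ∃ l, σ l = i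
      · by_cases h' : ∃ l, σ l = j
        · obtain ⟨l, rfl⟩ := h
          obtain ⟨l', rfl⟩ := h'
          rw [hD'a, hD'a]
          exact hDD _ _ fun h => hij (h ▸ rfl)
        · rw [hD'n j h']; simp
      · rw [hD'n i h]; simp
    have hcard := card_tuples (childClass A B σ) U D' (childClass_isOrdered hA hB σ) hUD hDD' (by
      intro i
      rw [hS']
      by_cases h : ∃ j, σ j = i
      · obtain ⟨j, rfl⟩ := h
        rw [childClass_apply, hD'a]
        exact hAs j
      · rw [childClass_of_notMem _ _ _ h, hD'n i h]
        exact hBs)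
    rw [hS'] at hcard
    rw [hcard]
    have hprod : (fun z => g z ^ (d - k) * ∏ j, f j z) = fun z => ∏ i, F i z := by
      ext z
      rw [← Finset.prod_mul_prod_compl (Finset.univ.map σ), Finset.prod_map, mul_comm]
      congr 1
      · exact Finset.prod_congr rfl fun j _ => by rw [hFa]
      · rw [Finset.prod_congr rfl (g := fun _ => g z), Finset.prod_const, Finset.card_compl,
          Finset.card_map]
        · simp
        · intro i hi
          rw [hFn i]
          simpa using hi
    rw [hprod, ← Fintype.card_coe U, iteratedDeriv_prod_of_card F hF]
    push_cast
    refine Finset.sum_congr rfl fun u _ => ?_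
    simp only [← card_fiber]
    -- If every child receives a label, then, as there are at least two children, each label set is
    -- a proper part of $S$ and `CountedBy` applies. Otherwise an undistinguished child receives
    -- none and both products vanish: no tree is without labels, and $g(0)=0$.
    by_cases hne : ∀ i, (fiber u i ∪ D' i).Nonempty
    · refine Finset.prod_congr rfl fun i _ => ?_
      have hss : fiber u i ∪ D' i ⊂ S := by
        have hsub : ∀ i, fiber u i ∪ D' i ⊆ S := by
          intro i
          rw [← hS', ← biUnion_fiber_union u D']
          exact Finset.subset_biUnion_of_mem (fun i => fiber u i ∪ D' i) (Finset.mem_univ i)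
        refine Finset.ssubset_iff_subset_ne.2 ⟨hsub i, fun h => ?_⟩
        have : Nontrivial (Fin d) := Fin.nontrivial_iff_two_le.2 hd
        obtain ⟨j, hj⟩ := exists_ne i
        obtain ⟨a, ha⟩ := hne j
        exact Finset.disjoint_left.1 (disjoint_fiber_union u hUD hDD' j i hj) ha (h ▸ hsub j ha)
      by_cases h : ∃ j, σ j = i
      · obtain ⟨j, rfl⟩ := h
        rw [hD'a] at hss ⊢
        rw [childClass_apply, hFa]
        exact hfA j _ (fiber_subset _ _) hss
      · rw [hD'n i h] at hss ⊢
        rw [childClass_of_notMem _ _ _ h, hFn i h]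
        exact hgB _ (fiber_subset _ _) hss
    · push Not at hne
      obtain ⟨i, hi⟩ := hne
      obtain ⟨hi1, hi2⟩ := Finset.union_eq_empty.1 hi
      have h : ¬ ∃ j, σ j = i := by
        rintro ⟨j, rfl⟩
        rw [hD'a] at hi2
        exact (hD j).ne_empty hi2
      rw [Finset.prod_eq_zero (Finset.mem_univ i), Finset.prod_eq_zero (Finset.mem_univ i)]
      · rw [hi1, hFn i h]
        simpa using hg0
      · rw [hi, childClass_of_notMem _ _ _ h, numTrees_empty hB, Nat.cast_zero]
  rw [Nat.card_congr e]
  have hfin : ∀ p : {p : SimpleGraph (Fin d) × (Fin k ↪ Fin d) //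
      p.1 ∈ 𝒢 d ∧ p.1.comap p.2 = H}, Finite {c : Fin d → STree //
        (∀ i, c i ∈ childClass A B p.1.2 i) ∧ ∑ i, (c i).labels = S.val} := by
    intro p
    have h1 : (Set.pi Set.univ fun _ : Fin d =>
        ⋃ s ∈ S.val.powerset.toFinset, {t : STree | t.IsOrdered ∧ t.labels = s}).Finite :=
      Set.Finite.pi fun _ => (Finset.finite_toSet _).biUnion fun s _ => finite_isOrdered s
    refine (h1.subset ?_).to_subtype
    rintro c ⟨hc, hl⟩ i _
    refine Set.mem_biUnion (x := (c i).labels) ?_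
      ⟨childClass_isOrdered hA hB _ _ _ (hc i), rfl⟩
    simpa [← hl] using labels_le_sum c i
  rw [Nat.card_sigma]
  push_cast
  rw [Finset.sum_congr rfl fun p _ => key p, Finset.sum_const, nsmul_eq_mul, Finset.card_univ,
    Nat.card_eq_fintype_card]

open Classical in
lemma card_pairs_eq_sum_occ (𝒢 : GraphClass) {k d : ℕ} (H : SimpleGraph (Fin k)) :
    Nat.card {p : SimpleGraph (Fin d) × (Fin k ↪ Fin d) // p.1 ∈ 𝒢 d ∧ p.1.comap p.2 = H} =
      ∑ G : SimpleGraph (Fin d) with G ∈ 𝒢 d, occ H G := by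
  let e : {p : SimpleGraph (Fin d) × (Fin k ↪ Fin d) // p.1 ∈ 𝒢 d ∧ p.1.comap p.2 = H} ≃
      Σ G : {G // G ∈ 𝒢 d}, {σ : Fin k ↪ Fin d // G.1.comap σ = H} :=
    { toFun := fun p => ⟨⟨p.1.1, p.2.1⟩, ⟨p.1.2, p.2.2⟩⟩
      invFun := fun y => ⟨⟨y.1.1, y.2.1⟩, y.1.2, y.2.2⟩
      left_inv := fun _ => rfl
      right_inv := fun _ => rfl }
  rw [Nat.card_congr e, Nat.card_sigma]
  simp only [← occ_eq_card]
  exact (Finset.sum_subtype (Finset.univ.filter fun G => G ∈ 𝒢 d) (by simp) fun G => occ H G).symm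

/-- The numbers of trees in `nodeTrees` are the derivatives of the corresponding generating
function. -/
theorem numTrees_nodeTrees_eq_iteratedDeriv {𝒢 : GraphClass} {ρ : ℝ≥0∞} (hρ : 0 < ρ)
    (h𝒢 : ∀ n, ∀ G ∈ 𝒢 n, ∀ π : Equiv.Perm (Fin n), G.comap π ∈ 𝒢 n) (h2 : ∀ n, ∀ G ∈ 𝒢 n, 2 ≤ n)
    {k : ℕ} {H : SimpleGraph (Fin k)} (hconv : ConvergesBelow (ocoef 𝒢 H) ρ)
    {A : Fin k → Set STree}
    {B : Set STree} (hA : ∀ j, ∀ t ∈ A j, t.IsOrdered) (hB : ∀ t ∈ B, t.IsOrdered)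
    {U : Finset ℕ} {D : Fin k → Finset ℕ} (hD : ∀ j, (D j).Nonempty)
    (hU : ∀ j, Disjoint U (D j)) (hDD : ∀ i j, i ≠ j → Disjoint (D i) (D j))
    (hAs : ∀ j, SplitsOver (A j) (U ∪ Finset.univ.biUnion D) U (D j))
    (hBs : SplitsOver B (U ∪ Finset.univ.biUnion D) U ∅)
    {f : Fin k → ℂ → ℂ} {g : ℂ → ℂ} (hf : ∀ j, AnalyticAt ℂ (f j) 0) (hg : AnalyticAt ℂ g 0)
    (hg0 : g 0 = 0) (hfA : ∀ j, CountedBy (A j) U (D j) (U ∪ Finset.univ.biUnion D) (f j))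
    (hgB : CountedBy B U ∅ (U ∪ Finset.univ.biUnion D) g) :
    (numTrees (nodeTrees 𝒢 H A B) (U ∪ Finset.univ.biUnion D) : ℂ) =
      iteratedDeriv U.card (fun z => pser (ocoef 𝒢 H) (g z) * ∏ j, f j z) 0 := by
  classical
  rw [numTrees_nodeTrees hA hB hD hAs]
  set S := U ∪ Finset.univ.biUnion D with hS
  -- The $D_j$ are disjoint and nonempty, so $|S|\ge|U|+k$. Hence $N=|S|+1-k$ exceeds the number of
  -- derivations and the truncation is exact.
  have hcard : S.card + 1 = k + (S.card + 1 - k) ∧ U.card < S.card + 1 - k := by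
    have h1 : S.card = U.card + (Finset.univ.biUnion D).card := by
      rw [hS, Finset.card_union_of_disjoint]
      simpa [Finset.disjoint_biUnion_right] using hU
    have h2 : k ≤ (Finset.univ.biUnion D).card := by
      rw [Finset.card_biUnion fun i _ j _ hij => hDD i j hij]
      calc k = ∑ _j : Fin k, 1 := by simp
        _ ≤ _ := Finset.sum_le_sum fun j _ => (hD j).card_pos
    omega
  set N := S.card + 1 - k with hN
  rw [hconv.iteratedDeriv_comp_mul hρ hg (analyticAt_finset_prod _ fun j _ => hf j) hg0 _ N
    hcard.2]
  let q : ℕ → ℂ := fun d => (∑ G : SimpleGraph (Fin d) with G ∈ 𝒢 d, (occ H G : ℂ)) / d.factorial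
  have h3 : ∀ d, (Nat.card {x // x ∈ nodeData 𝒢 H A B S d ∧
      StrictMono fun i => (x.2 i).minLabel} : ℂ) =
      q d * iteratedDeriv U.card (fun z => g z ^ (d - k) * ∏ j, f j z) 0 := by
    intro d
    have h4 := card_nodeData_eq_iteratedDeriv h2 hA hB hD hU hDD hAs hBs hf hg hg0 hfA hgB d (H := H)
    rw [card_nodeData h𝒢 hA hB, card_pairs_eq_sum_occ] at h4
    have h5 : (d.factorial : ℂ) ≠ 0 := Nat.cast_ne_zero.2 (Nat.factorial_ne_zero d)
    simp only [q]
    push_cast at h4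
    rw [div_mul_eq_mul_div, eq_div_iff h5, ← h4, mul_comm]
  push_cast
  -- A decoration of size $d<k$ admits no embedding of $H$. The remaining sizes $d=k+m$ give the
  -- terms of degree $m$ of the series of occurrences.
  rw [Finset.sum_congr rfl fun d _ => h3 d, hcard.1, Finset.sum_range_add, Finset.sum_eq_zero,
    zero_add]
  · refine Finset.sum_congr rfl fun m _ => ?_
    rw [Nat.add_sub_cancel_left, add_comm k m]
    congr 1
    simp [q, ocoef]
  · intro d hd
    have : ∀ G : SimpleGraph (Fin d), occ H G = 0 := by
      intro G
      have h6 := occ_eq_card H G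
      have : IsEmpty {σ : Fin k ↪ Fin d // G.comap σ = H} := ⟨fun σ => by
        have := Fintype.card_le_of_embedding σ.1
        simp at this
        have := Finset.mem_range.1 hd
        omega⟩
      rw [h6, Nat.card_of_isEmpty]
    simp [q, this]

namespace STree

/-! ### Marks of leaves -/

lemma filterMap_sum {ι : Type*} (s : Finset ι) (I : ℕ ≃. ℕ) (m : ι → Multiset ℕ) :
    (∑ i ∈ s, m i).filterMap I = ∑ i ∈ s, (m i).filterMap I := by
  classical
  induction s using Finset.induction_on with
  | empty => simp
  | insert a s ha ih => rw [Finset.sum_insert ha, Finset.sum_insert ha, Multiset.filterMap_add, ih]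

lemma unmarked_iff (I : ℕ ≃. ℕ) (t : STree) : t.Unmarked I ↔ t.labels.filterMap I = 0 := by
  rw [Multiset.eq_zero_iff_forall_notMem]
  simp only [Multiset.mem_filterMap, not_exists, not_and, Unmarked]
  refine ⟨fun h m l hl hm => ?_, fun h l hl => ?_⟩
  · rw [h l hl] at hm; simp at hm
  · by_contra hne
    obtain ⟨m, hm⟩ := Option.ne_none_iff_exists'.1 hne
    exact h m l hl hm

/-- The labels of the induced tree are the marks found on $t$. Through this identity, arguments
about markings reduce to arguments about labels. -/
lemma Induces.filterMap_labels {I : ℕ ≃. ℕ} {t τ : STree} {φ : τ.Node → t.Node}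
    (h : Induces I t τ φ) : t.labels.filterMap I = τ.labels := by
  induction h with
  | leaf h =>
    rw [labels, labels, ← Multiset.cons_zero, Multiset.filterMap_cons_some _ _ _ h,
      Multiset.filterMap_zero, Multiset.cons_zero]
  | @skip d G c τ φ i ψ h hu hφ ih =>
    rw [labels_node, filterMap_sum, Finset.sum_eq_single i, ih]
    · intro j _ hj
      exact (unmarked_iff _ _).1 (hu j hj)
    · simp
  | @branch d k G H c c' φ σ ψ hk h hu hH hroot hφ ih =>
    rw [labels_node, labels_node, filterMap_sum, ← Finset.sum_subset (Finset.subset_univ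
      (Finset.univ.map σ)), Finset.sum_map]
    · exact Finset.sum_congr rfl fun j _ => ih j
    · intro i _ hi
      refine (unmarked_iff _ _).1 (hu i fun j hj => hi ?_)
      simpa using ⟨j, hj⟩

/-- The marking `I` of `t` induces `τ`, where the condition `A n` on a node `n` of `τ` holds for the
linearity of the node of `t` that `n` comes from. -/
def InducesWith (I : ℕ ≃. ℕ) (τ : STree) (A : τ.Node → Prop → Prop) (t : STree) : Prop :=
  ∃ φ, Induces I t τ φ ∧ ∀ n, A n (t.LinearNode (φ n))

lemma InducesWith.filterMap_labels {I : ℕ ≃. ℕ} {t τ : STree} {A : τ.Node → Prop → Prop}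
    (h : InducesWith I τ A t) : t.labels.filterMap I = τ.labels := by
  obtain ⟨φ, h, _⟩ := h
  exact h.filterMap_labels

lemma linearNode_rootNode {d : ℕ} {G : SimpleGraph (Fin d)} {c : Fin d → STree} :
    (node d G c).LinearNode rootNode ↔ IsLinear G := Iff.rfl

lemma linearNode_childNode {d : ℕ} {G : SimpleGraph (Fin d)} {c : Fin d → STree} (i : Fin d)
    (n : (c i).Node) :
    (node d G c).LinearNode (childNode i n) ↔ (c i).LinearNode n := Iff.rfl

lemma forall_node {d : ℕ} {G : SimpleGraph (Fin d)} {c : Fin d → STree}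
    {p : (node d G c).Node → Prop} : (∀ n, p n) ↔ p rootNode ∧ ∀ i n, p (childNode i n) := by
  refine ⟨fun h => ⟨h _, fun _ _ => h _⟩, fun h n => ?_⟩
  rcases n with _ | ⟨i, n⟩
  · exact h.1
  · exact h.2 i n

lemma inducesWith_leaf_leaf {I : ℕ ≃. ℕ} {l m : ℕ} {A : (leaf m).Node → Prop → Prop} :
    InducesWith I (leaf m) A (leaf l) ↔ I l = some m := by
  constructor
  · rintro ⟨φ, h, _⟩
    cases h with
    | leaf h => exact h
  · intro h
    exact ⟨fun n => Empty.elim n, .leaf h, fun n => Empty.elim n⟩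

lemma not_inducesWith_node_leaf {I : ℕ ≃. ℕ} {l d : ℕ} {G : SimpleGraph (Fin d)}
    {c : Fin d → STree} {A : (node d G c).Node → Prop → Prop} :
    ¬ InducesWith I (node d G c) A (leaf l) := by
  rintro ⟨φ, h, _⟩
  cases h

/-- The trees attached to the root with a decoration `G` are unmarked, except the `i`-th one, which
induces `τ`. -/
lemma inducesWith_skip {I : ℕ ≃. ℕ} {τ : STree} {A : τ.Node → Prop → Prop} {d : ℕ}
    {G : SimpleGraph (Fin d)} {c : Fin d → STree} {i : Fin d} (h : InducesWith I τ A (c i))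
    (hu : ∀ j, j ≠ i → (c j).Unmarked I) : InducesWith I τ A (node d G c) := by
  obtain ⟨ψ, h1, h2⟩ := h
  exact ⟨fun n => childNode i (ψ n), .skip i ψ h1 hu fun _ => rfl, h2⟩

lemma inducesWith_leaf_node {I : ℕ ≃. ℕ} {m : ℕ} {A : (leaf m).Node → Prop → Prop} {d : ℕ}
    {G : SimpleGraph (Fin d)} {c : Fin d → STree} :
    InducesWith I (leaf m) A (node d G c) ↔
      ∃ i, InducesWith I (leaf m) A (c i) ∧ ∀ j, j ≠ i → (c j).Unmarked I := by
  constructor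
  · rintro ⟨φ, h, hA⟩
    cases h with
    | skip i ψ h hu hφ => exact ⟨i, ⟨ψ, h, fun n => Empty.elim n⟩, hu⟩
  · rintro ⟨i, h, hu⟩
    exact inducesWith_skip h hu

lemma inducesWith_node_node {I : ℕ ≃. ℕ} {k : ℕ} {H : SimpleGraph (Fin k)} {c' : Fin k → STree}
    {A : (node k H c').Node → Prop → Prop} {d : ℕ}
    {G : SimpleGraph (Fin d)} {c : Fin d → STree} :
    InducesWith I (node k H c') A (node d G c) ↔
      (∃ i, InducesWith I (node k H c') A (c i) ∧ ∀ j, j ≠ i → (c j).Unmarked I) ∨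
      (2 ≤ k ∧ A rootNode (IsLinear G) ∧ ∃ σ : Fin k ↪ Fin d, G.comap σ = H ∧
        (∀ j, InducesWith I (c' j) (fun n => A (childNode j n)) (c (σ j))) ∧
        ∀ i, (∀ j, σ j ≠ i) → (c i).Unmarked I) := by
  constructor
  · rintro ⟨φ, h, hA⟩
    cases h with
    | skip i ψ h hu hφ =>
      refine Or.inl ⟨i, ⟨ψ, h, fun n => ?_⟩, hu⟩
      have := hA n
      rw [hφ, linearNode_childNode] at this
      exact this
    | branch σ ψ hk h hu hH hroot hφ =>
      refine Or.inr ⟨hk, ?_, σ, hH.symm, fun j => ⟨ψ j, h j, fun n => ?_⟩, hu⟩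
      · have := hA rootNode
        rw [hroot, linearNode_rootNode] at this
        exact this
      · have := hA (childNode j n)
        rw [hφ, linearNode_childNode] at this
        exact this
  · rintro (⟨i, h, hu⟩ | ⟨hk, hA, σ, hH, h, hu⟩)
    · exact inducesWith_skip h hu
    · choose ψ h1 h2 using h
      refine ⟨fun n => match n with
        | none => rootNode
        | some ⟨j, n⟩ => childNode (σ j) (ψ j n), .branch σ ψ hk h1 hu hH.symm rfl fun _ _ => rfl, ?_⟩
      rw [forall_node]
      exact ⟨hA, h2⟩

end STree

open STree

/-! ### Classes of trees, by the kind of the root -/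

/-- The root is a node of kind `q`. -/
def RootKind (P : GraphClass) (q : Kind) : STree → Prop
  | leaf _ => False
  | node d G _ => G ∈ q.graphs P d

/-- Ordered trees with decorations as in modular decomposition trees. -/
def reducedTrees (P : GraphClass) : Set STree := {t | t.IsOrdered ∧ t.IsReducedOver P}

/-- Trees that may be attached to a node of kind `q`. -/
def childTrees (P : GraphClass) (q : Kind) : Set STree :=
  {t | t ∈ reducedTrees P ∧ (q ≠ Kind.prime → ¬ RootKind P q t)}

/-- The kind of the root is unique, so the separate conditions on $\oplus$ and $\ominus$ become one
condition: the children belong to the class attached to that kind. -/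
lemma node_mem_reducedTrees_iff {P : GraphClass} (hP : IsPrimeClass P) {d : ℕ}
    {G : SimpleGraph (Fin d)} {c : Fin d → STree} :
    node d G c ∈ reducedTrees P ↔ ∃ q : Kind, G ∈ q.graphs P d ∧
      StrictMono (fun i => (c i).minLabel) ∧ ∀ i, c i ∈ childTrees P q := by
  have hJ : ∀ t : STree, t.IsOrdered → (RootKind P Kind.join t ↔ t.RootIsJoin) := by
    intro t ht
    cases t with
    | leaf l => exact Iff.rfl
    | node d G c => exact ⟨fun h => h.2, fun h => ⟨ht.1, h⟩⟩
  have hU : ∀ t : STree, t.IsOrdered → (RootKind P Kind.union t ↔ t.RootIsUnion) := by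
    intro t ht
    cases t with
    | leaf l => exact Iff.rfl
    | node d G c => exact ⟨fun h => h.2, fun h => ⟨ht.1, h⟩⟩
  constructor
  · rintro ⟨⟨hd, hm, ho⟩, hG, h1, h2, hr⟩
    rcases hG with (hG | hG) | hG
    · exact ⟨Kind.join, ⟨hd, hG⟩, hm, fun i => ⟨⟨ho i, hr i⟩, fun _ =>
        (hJ _ (ho i)).not.2 (h1 hG i)⟩⟩
    · exact ⟨Kind.union, ⟨hd, hG⟩, hm, fun i => ⟨⟨ho i, hr i⟩, fun _ =>
        (hU _ (ho i)).not.2 (h2 hG i)⟩⟩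
    · exact ⟨Kind.prime, hG, hm, fun i => ⟨⟨ho i, hr i⟩, fun h => absurd rfl h⟩⟩
  · rintro ⟨q, hG, hm, hc⟩
    have hd := Kind.two_le_of_mem_graphs hP hG
    refine ⟨⟨hd, hm, fun i => (hc i).1.1⟩, ?_, ?_, ?_, fun i => (hc i).1.2⟩
    · cases q
      · exact Or.inl (Or.inl hG.2)
      · exact Or.inl (Or.inr hG.2)
      · exact Or.inr hG
    · intro h i
      obtain rfl := Kind.eq_of_mem_graphs hP (q' := Kind.join) hG ⟨hd, h⟩
      exact (hJ _ (hc i).1.1).not.1 ((hc i).2 (by simp))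
    · intro h i
      obtain rfl := Kind.eq_of_mem_graphs hP (q' := Kind.union) hG ⟨hd, h⟩
      exact (hU _ (hc i).1.1).not.1 ((hc i).2 (by simp))

/-- Trees without marks that may be attached to a node of kind `q`. -/
def unmarkedTrees (P : GraphClass) (I : ℕ ≃. ℕ) (q : Kind) : Set STree :=
  {t | t ∈ childTrees P q ∧ t.Unmarked I}

/-- Trees inducing `τ` that may be attached to a node of kind `q`. -/
def markedTrees (P : GraphClass) (I : ℕ ≃. ℕ) (q : Kind) (τ : STree) (A : τ.Node → Prop → Prop) :
    Set STree :=
  {t | t ∈ childTrees P q ∧ InducesWith I τ A t}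

/-- Unmarked trees with a root of kind `q`. -/
def rootedUnmarkedTrees (P : GraphClass) (I : ℕ ≃. ℕ) (q : Kind) : Set STree :=
  nodeTrees (q.graphs P) (⊥ : SimpleGraph (Fin 0)) (fun _ => ∅) (unmarkedTrees P I q)

/-- Trees inducing `τ`, with a root of kind `q`, and with marks in only one of the trees attached to
the root. -/
def skippingTrees (P : GraphClass) (I : ℕ ≃. ℕ) (q : Kind) (τ : STree)
    (A : τ.Node → Prop → Prop) : Set STree :=
  nodeTrees (q.graphs P) (⊥ : SimpleGraph (Fin 1)) (fun _ => markedTrees P I q τ A)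
    (unmarkedTrees P I q)

/-- Trees inducing `τ`, with a root of kind `q`, which is also the root of `τ`. -/
def branchingTrees (P : GraphClass) (I : ℕ ≃. ℕ) (q : Kind) :
    (τ : STree) → (τ.Node → Prop → Prop) → Set STree
  | leaf _, _ => ∅
  | node k H c', A => {t | 2 ≤ k ∧ A rootNode (q ≠ Kind.prime) ∧
      t ∈ nodeTrees (q.graphs P) H
        (fun j => markedTrees P I q (c' j) fun n => A (childNode j n)) (unmarkedTrees P I q)}

/-- A node of kind `q` may be attached to a node of kind `q'`. -/
def Kind.Compatible (q' q : Kind) : Prop := q' = Kind.prime ∨ q ≠ q'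

instance (q' q : Kind) : Decidable (q'.Compatible q) := inferInstanceAs (Decidable (_ ∨ _))

lemma forall_childClass_iff {k d : ℕ} {A : Fin k → Set STree} {B : Set STree} {σ : Fin k ↪ Fin d}
    {c : Fin d → STree} : (∀ i, c i ∈ childClass A B σ i) ↔
      (∀ j, c (σ j) ∈ A j) ∧ ∀ i, (∀ j, σ j ≠ i) → c i ∈ B := by
  constructor
  · intro h
    refine ⟨fun j => childClass_apply A B σ j ▸ h (σ j), fun i hi => ?_⟩
    have := h i
    rwa [childClass_of_notMem _ _ _ (by simpa using hi)] at this
  · rintro ⟨h1, h2⟩ i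
    by_cases h : ∃ j, σ j = i
    · obtain ⟨j, rfl⟩ := h
      rw [childClass_apply]; exact h1 j
    · rw [childClass_of_notMem _ _ _ h]
      exact h2 i (by simpa using h)

lemma mem_childTrees_iff_of_rootKind {P : GraphClass} (hP : IsPrimeClass P) {q q' : Kind}
    {t : STree} (ht : t ∈ reducedTrees P) (h : RootKind P q t) :
    t ∈ childTrees P q' ↔ q'.Compatible q := by
  cases t with
  | leaf l => exact absurd h id
  | node d G c =>
    constructor
    · intro h1
      by_cases hq : q' = Kind.prime
      · exact Or.inl hq
      · exact Or.inr fun e => h1.2 hq (e ▸ h)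
    · rintro (rfl | h1)
      · exact ⟨ht, fun h => absurd rfl h⟩
      · exact ⟨ht, fun _ h2 => h1 (Kind.eq_of_mem_graphs hP h h2)⟩

lemma node_mem_childTrees_iff {P : GraphClass} (hP : IsPrimeClass P) {q' : Kind} {d : ℕ}
    {G : SimpleGraph (Fin d)} {c : Fin d → STree} :
    node d G c ∈ childTrees P q' ↔ ∃ q : Kind, q'.Compatible q ∧ G ∈ q.graphs P d ∧
      StrictMono (fun i => (c i).minLabel) ∧ ∀ i, c i ∈ childTrees P q := by
  constructor
  · intro h
    obtain ⟨q, h1, h2, h3⟩ := (node_mem_reducedTrees_iff hP).1 h.1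
    exact ⟨q, (mem_childTrees_iff_of_rootKind hP h.1 h1).1 h, h1, h2, h3⟩
  · rintro ⟨q, h0, h1, h2, h3⟩
    have := (node_mem_reducedTrees_iff hP).2 ⟨q, h1, h2, h3⟩
    exact (mem_childTrees_iff_of_rootKind hP this h1).2 h0

lemma leaf_mem_childTrees (P : GraphClass) (q : Kind) (l : ℕ) : leaf l ∈ childTrees P q :=
  ⟨⟨trivial, trivial⟩, fun _ h => h⟩

/-- This is the equation $W=z+\Lambda(W)$ at the level of sets, one version for each kind of parent:
a leaf, or a root of a compatible kind with unmarked children. -/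
lemma unmarkedTrees_eq {P : GraphClass} (hP : IsPrimeClass P) (I : ℕ ≃. ℕ) (q' : Kind) :
    unmarkedTrees P I q' = {t | ∃ l, t = leaf l ∧ I l = none} ∪
      ⋃ q ∈ Finset.univ.filter q'.Compatible, rootedUnmarkedTrees P I q := by
  ext t
  rw [Set.mem_union, Set.mem_iUnion₂]
  cases t with
  | leaf l =>
    constructor
    · intro h
      exact Or.inl ⟨l, rfl, h.2 l (by simp [labels])⟩
    · rintro (⟨l', h, h'⟩ | ⟨q, _, d, G, c, σ, h, _⟩)
      · obtain rfl := STree.leaf.inj h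
        refine ⟨leaf_mem_childTrees P q' l, fun l' hl' => ?_⟩
        rw [labels, Multiset.mem_singleton] at hl'
        rw [hl', h']
      · cases h
  | node d G c =>
    constructor
    · rintro ⟨h1, h2⟩
      obtain ⟨q, h0, h1, h3, h4⟩ := (node_mem_childTrees_iff hP).1 h1
      refine Or.inr ⟨q, by simpa using h0, d, G, c, ⟨Fin.elim0, fun i => i.elim0⟩, rfl, h1,
        comap_eq_of_subsingleton zero_le_one _ _ _, h3, forall_childClass_iff.2
          ⟨fun j => j.elim0, fun i _ => ⟨h4 i, fun l hl => h2 l ?_⟩⟩⟩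
      exact Multiset.mem_of_le (labels_le_sum c i) hl
    · rintro (⟨l, h, _⟩ | ⟨q, hq, d', G', c', σ, h, h1, _, h3, h4⟩)
      · cases h
      · obtain ⟨rfl, hG, hc⟩ := node.inj h
        obtain rfl := eq_of_heq hG
        obtain rfl := eq_of_heq hc
        have h5 := (forall_childClass_iff.1 h4).2
        refine ⟨(node_mem_childTrees_iff hP).2 ⟨q, by simpa using hq, h1, h3,
          fun i => (h5 i fun j => j.elim0).1⟩, fun l hl => ?_⟩
        rw [labels_node, Multiset.mem_sum] at hl
        obtain ⟨i, _, hl⟩ := hl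
        exact (h5 i fun j => j.elim0).2 l hl

lemma skipping_iff {P : GraphClass} {I : ℕ ≃. ℕ} {q : Kind} {τ : STree}
    {A : τ.Node → Prop → Prop} {d : ℕ} {G : SimpleGraph (Fin d)} {c : Fin d → STree}
    (hG : G ∈ q.graphs P d) (hm : StrictMono fun i => (c i).minLabel)
    (hc : ∀ i, c i ∈ childTrees P q) :
    node d G c ∈ skippingTrees P I q τ A ↔
      ∃ i, InducesWith I τ A (c i) ∧ ∀ j, j ≠ i → (c j).Unmarked I := by
  constructor
  · rintro ⟨d', G', c', σ, h, _, _, _, h4⟩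
    obtain ⟨rfl, h1, h2⟩ := node.inj h
    obtain rfl := eq_of_heq h1
    obtain rfl := eq_of_heq h2
    obtain ⟨h5, h6⟩ := forall_childClass_iff.1 h4
    refine ⟨σ 0, (h5 0).2, fun j hj => (h6 j fun l hl => hj ?_).2⟩
    rw [← hl, Subsingleton.elim l 0]
  · rintro ⟨i, h1, h2⟩
    refine ⟨d, G, c, ⟨fun _ => i, fun _ _ _ => Subsingleton.elim _ _⟩, rfl, hG,
      comap_eq_of_subsingleton le_rfl _ _ _, hm, forall_childClass_iff.2
        ⟨fun _ => ⟨hc i, h1⟩, fun j hj => ⟨hc j, h2 j (hj 0).symm⟩⟩⟩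

lemma branching_iff {P : GraphClass} (hP : IsPrimeClass P) {I : ℕ ≃. ℕ} {q : Kind} {k : ℕ}
    {H : SimpleGraph (Fin k)} {c' : Fin k → STree}
    {A : (node k H c').Node → Prop → Prop} {d : ℕ} {G : SimpleGraph (Fin d)} {c : Fin d → STree}
    (hG : G ∈ q.graphs P d) (hm : StrictMono fun i => (c i).minLabel)
    (hc : ∀ i, c i ∈ childTrees P q) :
    node d G c ∈ branchingTrees P I q (node k H c') A ↔
      (2 ≤ k ∧ A rootNode (IsLinear G) ∧ ∃ σ : Fin k ↪ Fin d, G.comap σ = H ∧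
        (∀ j, InducesWith I (c' j) (fun n => A (childNode j n)) (c (σ j))) ∧
        ∀ i, (∀ j, σ j ≠ i) → (c i).Unmarked I) := by
  rw [Kind.isLinear_iff hP hG]
  refine and_congr_right fun _ => and_congr_right fun _ => ?_
  constructor
  · rintro ⟨d', G', c', σ, h, _, h3, _, h4⟩
    obtain ⟨rfl, h1, h2⟩ := node.inj h
    obtain rfl := eq_of_heq h1
    obtain rfl := eq_of_heq h2
    obtain ⟨h5, h6⟩ := forall_childClass_iff.1 h4
    exact ⟨σ, h3, fun j => (h5 j).2, fun i hi => (h6 i hi).2⟩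
  · rintro ⟨σ, h1, h2, h3⟩
    exact ⟨d, G, c, σ, rfl, hG, h1, hm, forall_childClass_iff.2
        ⟨fun j => ⟨hc _, h2 j⟩, fun i hi => ⟨hc i, h3 i hi⟩⟩⟩

lemma exists_node_of_mem_nodeTrees {P : GraphClass} {q : Kind} {k : ℕ}
    {H : SimpleGraph (Fin k)} {A : Fin k → Set STree} {B : Set STree}
    (hA : ∀ j, A j ⊆ childTrees P q) (hB : B ⊆ childTrees P q) {t : STree}
    (ht : t ∈ nodeTrees (q.graphs P) H A B) :
    ∃ (d : ℕ) (G : SimpleGraph (Fin d)) (c : Fin d → STree), t = node d G c ∧ G ∈ q.graphs P d ∧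
      StrictMono (fun i => (c i).minLabel) ∧ ∀ i, c i ∈ childTrees P q := by
  obtain ⟨d, G, c, σ, h, h1, _, h3, h4⟩ := ht
  refine ⟨d, G, c, h, h1, h3, fun i => ?_⟩
  obtain ⟨h5, h6⟩ := forall_childClass_iff.1 h4
  by_cases h : ∀ j, σ j ≠ i
  · exact hB (h6 i h)
  · push Not at h
    obtain ⟨j, rfl⟩ := h
    exact hA j (h5 j)

lemma exists_node_of_mem_skippingTrees {P : GraphClass} {I : ℕ ≃. ℕ} {q : Kind} {τ : STree}
    {A : τ.Node → Prop → Prop} {t : STree} (ht : t ∈ skippingTrees P I q τ A) :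
    ∃ (d : ℕ) (G : SimpleGraph (Fin d)) (c : Fin d → STree), t = node d G c ∧ G ∈ q.graphs P d ∧
      StrictMono (fun i => (c i).minLabel) ∧ ∀ i, c i ∈ childTrees P q :=
  exists_node_of_mem_nodeTrees (fun _ _ h => h.1) (fun _ h => h.1) ht

lemma exists_node_of_mem_branchingTrees {P : GraphClass} {I : ℕ ≃. ℕ} {q : Kind} {τ : STree}
    {A : τ.Node → Prop → Prop} {t : STree} (ht : t ∈ branchingTrees P I q τ A) :
    ∃ (d : ℕ) (G : SimpleGraph (Fin d)) (c : Fin d → STree), t = node d G c ∧ G ∈ q.graphs P d ∧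
      StrictMono (fun i => (c i).minLabel) ∧ ∀ i, c i ∈ childTrees P q := by
  cases τ with
  | leaf m => exact absurd ht (Set.notMem_empty _)
  | node k H c' => exact exists_node_of_mem_nodeTrees (fun _ _ h => h.1) (fun _ h => h.1) ht.2.2

/-- The root of $t$ either has all the marks in one child or is the first common ancestor of the
marked leaves; a tree reduced to a leaf can only induce a leaf. This is the source of the linear
system in `IsGenFun`. -/
lemma markedTrees_eq {P : GraphClass} (hP : IsPrimeClass P) (I : ℕ ≃. ℕ) (q' : Kind) (τ : STree)
    (A : τ.Node → Prop → Prop) :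
    markedTrees P I q' τ A = {t | ∃ l m, t = leaf l ∧ τ = leaf m ∧ I l = some m} ∪
      ⋃ q ∈ Finset.univ.filter q'.Compatible,
        (skippingTrees P I q τ A ∪ branchingTrees P I q τ A) := by
  have key : ∀ {d : ℕ} {G : SimpleGraph (Fin d)} {c : Fin d → STree} {q : Kind},
      G ∈ q.graphs P d → (StrictMono fun i => (c i).minLabel) → (∀ i, c i ∈ childTrees P q) →
      (InducesWith I τ A (node d G c) ↔
        node d G c ∈ skippingTrees P I q τ A ∪ branchingTrees P I q τ A) := by
    intro d G c q h1 h2 h3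
    rw [Set.mem_union, skipping_iff h1 h2 h3]
    cases τ with
    | leaf m =>
      rw [inducesWith_leaf_node]
      exact ⟨Or.inl, fun h => h.resolve_right (Set.notMem_empty _)⟩
    | node k H c' => rw [inducesWith_node_node, branching_iff hP h1 h2 h3]
  ext t
  rw [Set.mem_union, Set.mem_iUnion₂]
  constructor
  · rintro ⟨h1, h2⟩
    cases t with
    | leaf l =>
      cases τ with
      | leaf m => exact Or.inl ⟨l, m, rfl, rfl, inducesWith_leaf_leaf.1 h2⟩
      | node k H c' => exact absurd h2 not_inducesWith_node_leaf
    | node d G c =>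
      obtain ⟨q, h0, h1, h3, h4⟩ := (node_mem_childTrees_iff hP).1 h1
      exact Or.inr ⟨q, by simpa using h0, (key h1 h3 h4).1 h2⟩
  · rintro (⟨l, m, rfl, rfl, h⟩ | ⟨q, hq, h⟩)
    · exact ⟨leaf_mem_childTrees P q' l, inducesWith_leaf_leaf.2 h⟩
    · obtain ⟨d, G, c, rfl, h1, h3, h4⟩ : ∃ (d : ℕ) (G : SimpleGraph (Fin d)) (c : Fin d → STree),
          t = node d G c ∧ G ∈ q.graphs P d ∧
          StrictMono (fun i => (c i).minLabel) ∧ ∀ i, c i ∈ childTrees P q := by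
        rcases h with h | h
        · exact exists_node_of_mem_skippingTrees h
        · exact exists_node_of_mem_branchingTrees h
      exact ⟨(node_mem_childTrees_iff hP).2 ⟨q, by simpa using hq, h1, h3, h4⟩, (key h1 h3 h4).2 h⟩

/-- At a branching root at least two children carry marks, since every subtree of an ordered $\tau$
has a label; at a skipped one only one child does. -/
lemma disjoint_skippingTrees_branchingTrees {P : GraphClass} (hP : IsPrimeClass P) (I : ℕ ≃. ℕ)
    (q : Kind) {τ : STree} (hτ : τ.IsOrdered) (A : τ.Node → Prop → Prop) :
    Disjoint (skippingTrees P I q τ A) (branchingTrees P I q τ A) := by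
  rw [Set.disjoint_left]
  intro t hs hb
  obtain ⟨d, G, c, rfl, h1, h2, h3⟩ := exists_node_of_mem_skippingTrees hs
  rw [skipping_iff h1 h2 h3] at hs
  cases τ with
  | leaf m => exact Set.notMem_empty _ hb
  | node k H c' =>
    rw [branching_iff hP h1 h2 h3] at hb
    obtain ⟨i, _, hi⟩ := hs
    obtain ⟨hk, _, σ, _, hσ, _⟩ := hb
    obtain ⟨j, hj⟩ : ∃ j, σ j ≠ i := by
      by_contra! h
      have : (⟨0, by omega⟩ : Fin k) = ⟨1, by omega⟩ := σ.injective ((h _).trans (h _).symm)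
      simp at this
    have h4 := (hσ j).filterMap_labels
    rw [(unmarked_iff _ _).1 (hi _ hj)] at h4
    exact labels_ne_zero (hτ.2.2 j) h4.symm

/-! ### Numbers of trees in unions of classes -/

lemma numTrees_union {A B : Set STree} (hA : ∀ t ∈ A, t.IsOrdered) (hB : ∀ t ∈ B, t.IsOrdered)
    (h : Disjoint A B) (S : Finset ℕ) : numTrees (A ∪ B) S = numTrees A S + numTrees B S := by
  have key : ∀ A : Set STree, numTrees A S = (A ∩ {t | t.labels = S.val}).ncard := fun A => rfl
  have hf : ∀ A : Set STree, (∀ t ∈ A, t.IsOrdered) → (A ∩ {t | t.labels = S.val}).Finite :=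
    fun A hA => (finite_isOrdered S.val).subset fun t ht => ⟨hA t ht.1, ht.2⟩
  rw [key, key, key, Set.union_inter_distrib_right, Set.ncard_union_eq
    (h.mono Set.inter_subset_left Set.inter_subset_left) (hf A hA) (hf B hB)]

lemma numTrees_biUnion {ι : Type*} [DecidableEq ι] (s : Finset ι) {A : ι → Set STree}
    (hA : ∀ i, ∀ t ∈ A i, t.IsOrdered) (h : ∀ i j, i ≠ j → Disjoint (A i) (A j)) (S : Finset ℕ) :
    numTrees (⋃ i ∈ s, A i) S = ∑ i ∈ s, numTrees (A i) S := by
  induction s using Finset.induction_on with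
  | empty =>
    have : IsEmpty {t : STree // t ∈ (∅ : Set STree) ∧ t.labels = S.val} :=
      ⟨fun t => Set.notMem_empty _ t.2.1⟩
    simp [numTrees]
  | insert a s ha ih =>
    rw [Finset.set_biUnion_insert, numTrees_union (hA a), Finset.sum_insert ha, ih]
    · intro t ht
      obtain ⟨i, _, hi⟩ := Set.mem_iUnion₂.1 ht
      exact hA i t hi
    · rw [Set.disjoint_iUnion₂_right]
      exact fun i hi => h a i fun h => ha (h ▸ hi)

open STree

/-! ### Counting with generating functions -/

lemma unmarkedTrees_isOrdered {P : GraphClass} {I : ℕ ≃. ℕ} {q : Kind} (t : STree)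
    (ht : t ∈ unmarkedTrees P I q) : t.IsOrdered := ht.1.1.1

lemma markedTrees_isOrdered {P : GraphClass} {I : ℕ ≃. ℕ} {q : Kind} {τ : STree}
    {A : τ.Node → Prop → Prop} (t : STree) (ht : t ∈ markedTrees P I q τ A) : t.IsOrdered :=
  ht.1.1.1

lemma nodeTrees_isOrdered {𝒢 : GraphClass} (h2 : ∀ n, ∀ G ∈ 𝒢 n, 2 ≤ n) {k : ℕ}
    {H : SimpleGraph (Fin k)} {A : Fin k → Set STree} {B : Set STree}
    (hA : ∀ j, ∀ t ∈ A j, t.IsOrdered) (hB : ∀ t ∈ B, t.IsOrdered) (t : STree)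
    (ht : t ∈ nodeTrees 𝒢 H A B) : t.IsOrdered := by
  obtain ⟨d, G, c, σ, rfl, h1, _, h3, h4⟩ := ht
  exact ⟨h2 d G h1, h3, fun i => childClass_isOrdered hA hB σ i _ (h4 i)⟩

/-- The leaves with a label in `D` are those with marks, which are the labels of `τ`. -/
structure MarkedOnto (I : ℕ ≃. ℕ) (D : Finset ℕ) (τ : STree) : Prop where
  mem_labels_iff : ∀ m, m ∈ τ.labels ↔ ∃ l ∈ D, I l = some m
  marked : ∀ l ∈ D, ∃ m, I l = some m

lemma pequiv_inj {I : ℕ ≃. ℕ} {l l' m : ℕ} (h : I l = some m) (h' : I l' = some m) : l = l' :=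
  I.inj h h'

lemma nodup_of_le_val {s : Multiset ℕ} {T : Finset ℕ} (h : s ≤ T.val) : s.Nodup :=
  Multiset.nodup_of_le h T.nodup

lemma splitsOver_unmarkedTrees (P : GraphClass) {I : ℕ ≃. ℕ} (q : Kind) {U D : Finset ℕ}
    (hD : ∀ l ∈ D, ∃ m, I l = some m) : SplitsOver (unmarkedTrees P I q) (U ∪ D) U ∅ := by
  intro t ht hle
  refine ⟨⟨t.labels, nodup_of_le_val hle⟩, fun l hl => ?_, by simp⟩
  have h1 : l ∈ U ∪ D := Multiset.mem_of_le hle hl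
  refine (Finset.mem_union.1 h1).resolve_right fun h2 => ?_
  obtain ⟨m, hm⟩ := hD l h2
  rw [ht.2 l hl] at hm
  simp at hm

/-- The marks on the tree are exactly the labels of $\tau$, and a marking is injective, so the
marked leaves are exactly those labeled in $D$ and all others have labels in $U$. -/
lemma splitsOver_markedTrees (P : GraphClass) {I : ℕ ≃. ℕ} (q : Kind) {U D D' : Finset ℕ}
    {τ : STree} (A : τ.Node → Prop → Prop)
    (hD' : ∀ l ∈ D', ∃ m, I l = some m) (hD : MarkedOnto I D τ) :
    SplitsOver (markedTrees P I q τ A) (U ∪ D') U D := by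
  classical
  intro t ht hle
  have hlab := ht.2.filterMap_labels
  refine ⟨U.filter (· ∈ t.labels), Finset.filter_subset _ _, ?_⟩
  have h1 : t.labels = (⟨t.labels, nodup_of_le_val hle⟩ : Finset ℕ).val := rfl
  rw [h1]
  congr 1
  ext l
  rw [Finset.mem_union, Finset.mem_filter, ← Finset.mem_val]
  constructor
  · intro hl
    have h2 : l ∈ U ∪ D' := Multiset.mem_of_le hle hl
    by_cases hlU : l ∈ U
    · exact Or.inl ⟨hlU, hl⟩
    · refine Or.inr ?_
      obtain ⟨m, hm⟩ := hD' l ((Finset.mem_union.1 h2).resolve_left hlU)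
      have h3 : m ∈ τ.labels := by
        rw [← hlab]
        exact (Multiset.mem_filterMap _ _).2 ⟨l, hl, hm⟩
      obtain ⟨l', h4, h5⟩ := (hD.mem_labels_iff m).1 h3
      rwa [pequiv_inj hm h5]
  · rintro (⟨_, hl⟩ | hl)
    · exact hl
    · obtain ⟨m, hm⟩ := hD.marked l hl
      have h3 : m ∈ τ.labels := (hD.mem_labels_iff m).2 ⟨l, hl, hm⟩
      rw [← hlab] at h3
      obtain ⟨l', h4, h5⟩ := (Multiset.mem_filterMap _ _).1 h3
      rw [pequiv_inj hm h5]
      exact h4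

/-- The contribution to the generating function of a tree that is reduced to a leaf. -/
noncomputable def leafTerm : STree → ℂ
  | leaf _ => 1
  | node _ _ _ => 0

open Classical in
/-- The generating function of the trees inducing `τ` with a root of kind `q` that is also the root
of `τ`, in terms of the ones of the trees inducing the trees attached to the root of `τ`. -/
noncomputable def branchTerm (P : GraphClass) (B : ℂ → ℂ) (q : Kind) :
    (τ : STree) → (A : τ.Node → Prop → Prop) →
    (C : ∀ τ : STree, (τ.Node → Prop → Prop) → ℂ → ℂ) → ℂ → ℂ
  | leaf _, _, _ => 0
  | node _ H c', A, C => fun z => if A rootNode (q ≠ Kind.prime) then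
      pser (ocoef (q.graphs P) H) (B z) * ∏ j, C (c' j) (fun n => A (childNode j n)) z else 0

/-- The functions `B q` satisfy near the origin the equations for the generating functions of trees
that may be attached to nodes of kind `q`, and the functions `C q τ A` the equations for those of
trees that moreover induce `τ`. -/
structure IsGenFun (P : GraphClass) (B : Kind → ℂ → ℂ)
    (C : Kind → ∀ τ : STree, (τ.Node → Prop → Prop) → ℂ → ℂ) : Prop where
  analyticAt_B : ∀ q, AnalyticAt ℂ (B q) 0
  B_zero : ∀ q, B q 0 = 0
  B_eq : ∀ q', B q' =ᶠ[𝓝 0] fun z => z + ∑ q with q'.Compatible q,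
    pser (ocoef (q.graphs P) (⊥ : SimpleGraph (Fin 0))) (B q z)
  analyticAt_C : ∀ q τ A, AnalyticAt ℂ (C q τ A) 0
  C_eq : ∀ q' τ A, C q' τ A =ᶠ[𝓝 0] fun z => leafTerm τ + ∑ q with q'.Compatible q,
    (pser (ocoef (q.graphs P) (⊥ : SimpleGraph (Fin 1))) (B q z) * C q τ A z +
      branchTerm P (B q) q τ A (C q) z)

lemma numTrees_unmarked_leaves {I : ℕ ≃. ℕ} {U : Finset ℕ} (hU : ∀ l ∈ U, I l = none) :
    numTrees {t | ∃ l, t = leaf l ∧ I l = none} U = if U.card = 1 then 1 else 0 := by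
  rw [numTrees]
  split_ifs with h
  · obtain ⟨l, rfl⟩ := Finset.card_eq_one.1 h
    rw [Nat.card_eq_one_iff_exists]
    refine ⟨⟨leaf l, ⟨l, rfl, hU l (by simp)⟩, by simp [labels]⟩, ?_⟩
    rintro ⟨_, ⟨l', rfl, _⟩, h2⟩
    rw [labels, Finset.singleton_val, Multiset.singleton_inj] at h2
    subst h2
    rfl
  · have : IsEmpty {t // t ∈ {t | ∃ l, t = leaf l ∧ I l = none} ∧ t.labels = U.val} := by
      constructor
      rintro ⟨_, ⟨l', rfl, _⟩, h2⟩
      apply h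
      rw [Finset.card, ← h2, labels, Multiset.card_singleton]
    exact Nat.card_of_isEmpty

lemma numTrees_marked_leaves {I : ℕ ≃. ℕ} {U D : Finset ℕ} {τ : STree} (hU : ∀ l ∈ U, I l = none)
    (hD : MarkedOnto I D τ) :
    (numTrees {t | ∃ l m, t = leaf l ∧ τ = leaf m ∧ I l = some m} (U ∪ D) : ℂ) =
      if U.card = 0 then leafTerm τ else 0 := by
  cases τ with
  | node k H c' =>
    have : IsEmpty {t // t ∈ {t | ∃ l m, t = leaf l ∧ node k H c' = leaf m ∧ I l = some m} ∧
        t.labels = (U ∪ D).val} := by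
      constructor
      rintro ⟨_, ⟨l', m', rfl, h, _⟩, h2⟩
      cases h
    rw [numTrees, Nat.card_of_isEmpty]
    simp [leafTerm]
  | leaf m =>
    obtain ⟨l, hlD, hl⟩ := (hD.mem_labels_iff m).1 (by simp [labels])
    have hDl : D = {l} := by
      ext a
      rw [Finset.mem_singleton]
      constructor
      · intro ha
        obtain ⟨m', hm'⟩ := hD.marked a ha
        have := (hD.mem_labels_iff m').2 ⟨a, ha, hm'⟩
        rw [labels, Multiset.mem_singleton] at this
        subst this
        exact pequiv_inj hm' hl
      · rintro rfl; exact hlD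
    subst hDl
    rw [numTrees]
    split_ifs with h
    · rw [Finset.card_eq_zero] at h
      subst h
      rw [leafTerm, Nat.cast_eq_one, Nat.card_eq_one_iff_exists]
      refine ⟨⟨leaf l, ⟨l, m, rfl, rfl, hl⟩, by simp [labels]⟩, ?_⟩
      rintro ⟨_, ⟨l', m', rfl, _, _⟩, h2⟩
      rw [labels, Finset.empty_union, Finset.singleton_val, Multiset.singleton_inj] at h2
      subst h2
      rfl
    · have : IsEmpty {t // t ∈ {t | ∃ l m', t = leaf l ∧ leaf m = leaf m' ∧ I l = some m'} ∧
          t.labels = (U ∪ {l}).val} := by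
        constructor
        rintro ⟨_, ⟨l', m', rfl, hm, hl'⟩, h2⟩
        obtain ⟨a, ha⟩ := Finset.card_ne_zero.1 h
        have h3 : a ∈ (leaf l').labels := by
          rw [h2]; exact Finset.mem_union_left _ ha
        rw [labels, Multiset.mem_singleton] at h3
        subst h3
        rw [hU a ha] at hl'
        simp at hl'
      rw [Nat.card_of_isEmpty, Nat.cast_zero]

lemma iteratedDeriv_id_zero (n : ℕ) :
    iteratedDeriv n (fun z : ℂ => z) 0 = if n = 1 then 1 else 0 := by
  rcases n with _ | _ | n
  · simp
  · simp [iteratedDeriv_one]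
  · rw [iteratedDeriv_succ', iteratedDeriv_succ']
    simp

lemma iteratedDeriv_const_zero (n : ℕ) (c : ℂ) :
    iteratedDeriv n (fun _ : ℂ => c) 0 = if n = 0 then c else 0 := by
  rw [iteratedDeriv_const]

lemma disjoint_of_exists_node {P : GraphClass} (hP : IsPrimeClass P) {A : Kind → Set STree}
    (hA : ∀ q, ∀ t ∈ A q, ∃ (d : ℕ) (G : SimpleGraph (Fin d)) (c : Fin d → STree),
      t = node d G c ∧ G ∈ q.graphs P d) (q q' : Kind) (h : q ≠ q') : Disjoint (A q) (A q') := by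
  rw [Set.disjoint_left]
  intro t ht ht'
  obtain ⟨d, G, c, rfl, hG⟩ := hA q t ht
  obtain ⟨d', G', c', h1, hG'⟩ := hA q' _ ht'
  obtain ⟨rfl, h2, _⟩ := node.inj h1
  obtain rfl := eq_of_heq h2
  exact h (Kind.eq_of_mem_graphs hP hG hG')

lemma IsGenFun.analyticAt_pser {P : GraphClass} {B : Kind → ℂ → ℂ}
    {C : Kind → ∀ τ : STree, (τ.Node → Prop → Prop) → ℂ → ℂ} (h : IsGenFun P B C)
    (hρ : 0 < seriesRadius (classCoeff P)) (q : Kind) {k : ℕ} (H : SimpleGraph (Fin k)) :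
    AnalyticAt ℂ (fun z => pser (ocoef (q.graphs P) H) (B q z)) 0 :=
  ((Kind.convergesBelow P q H).analyticAt (by simpa [h.B_zero q] using hρ)).comp
    (h.analyticAt_B q)

/-- The numbers of unmarked trees. -/
theorem numTrees_unmarkedTrees {P : GraphClass} (hP : IsPrimeClass P)
    (hρ : 0 < seriesRadius (classCoeff P)) {B : Kind → ℂ → ℂ}
    {C : Kind → ∀ τ : STree, (τ.Node → Prop → Prop) → ℂ → ℂ} (h : IsGenFun P B C) {I : ℕ ≃. ℕ}
    (U : Finset ℕ) (hU : ∀ l ∈ U, I l = none) (q' : Kind) :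
    (numTrees (unmarkedTrees P I q') U : ℂ) = iteratedDeriv U.card (B q') 0 := by
  classical
  induction hn : U.card using Nat.strong_induction_on generalizing U q' with
  | _ n ih =>
    subst hn
    have hord : ∀ q, ∀ t ∈ rootedUnmarkedTrees P I q, t.IsOrdered := fun q =>
      nodeTrees_isOrdered (fun n G hG => Kind.two_le_of_mem_graphs hP hG)
        (fun j => j.elim0) unmarkedTrees_isOrdered
    have hnode : ∀ q, (numTrees (rootedUnmarkedTrees P I q) U : ℂ) = iteratedDeriv U.card
        (fun z => pser (ocoef (q.graphs P) (⊥ : SimpleGraph (Fin 0))) (B q z)) 0 := by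
      intro q
      -- No child is distinguished: $k=0$, and the families over `Fin 0` get arbitrary values.
      -- Proper parts of the label set are covered by the induction hypothesis.
      have h1 := numTrees_nodeTrees_eq_iteratedDeriv hρ (𝒢 := q.graphs P)
        (fun n G hG π => Kind.comap_mem_graphs hP hG π)
        (fun n G hG => Kind.two_le_of_mem_graphs hP hG)
        (H := (⊥ : SimpleGraph (Fin 0))) (Kind.convergesBelow P q _)
        (A := fun _ => ∅) (B := unmarkedTrees P I q) (fun j => j.elim0) unmarkedTrees_isOrdered
        (U := U) (D := fun _ => ∅) (fun j => j.elim0) (fun j => j.elim0) (fun j => j.elim0)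
        (fun j => j.elim0) (splitsOver_unmarkedTrees P q (by simp)) (f := fun _ => 0) (g := B q)
        (fun j => j.elim0) (h.analyticAt_B q) (h.B_zero q) (fun j => j.elim0) (by
          intro U' hU' hss
          simp only [Finset.univ_eq_empty, Finset.biUnion_empty, Finset.union_empty] at hss ⊢
          exact ih _ (Finset.card_lt_card hss) U' (fun l hl => hU l (hU' hl)) q rfl)
      simpa [rootedUnmarkedTrees] using h1
    rw [unmarkedTrees_eq hP, numTrees_union, numTrees_biUnion, numTrees_unmarked_leaves hU,
      (h.B_eq q').iteratedDeriv_eq, iteratedDeriv_fun_add, iteratedDeriv_fun_sum,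
      iteratedDeriv_id_zero]
    · push_cast
      congr 1
      exact Finset.sum_congr rfl fun q _ => hnode q
    · exact fun q _ => (h.analyticAt_pser hρ q _).contDiffAt
    · exact contDiffAt_id
    · exact (Finset.analyticAt_fun_sum _ fun q _ => h.analyticAt_pser hρ q _).contDiffAt
    · exact hord
    · refine disjoint_of_exists_node hP fun q t ht => ?_
      obtain ⟨d, G, c, _, h1, h2, _⟩ := ht
      exact ⟨d, G, c, h1, h2⟩
    · rintro _ ⟨l, rfl, _⟩
      exact trivial
    · intro t ht
      obtain ⟨q, _, hq⟩ := Set.mem_iUnion₂.1 ht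
      exact hord q t hq
    · rw [Set.disjoint_left]
      rintro _ ⟨l, rfl, _⟩ ht
      obtain ⟨q, _, d, G, c, σ, h1, _⟩ := Set.mem_iUnion₂.1 ht
      cases h1

lemma branchingTrees_isOrdered {P : GraphClass} {I : ℕ ≃. ℕ} {q : Kind} (hP : IsPrimeClass P)
    {τ : STree} {A : τ.Node → Prop → Prop} (t : STree) (ht : t ∈ branchingTrees P I q τ A) :
    t.IsOrdered := by
  obtain ⟨d, G, c, rfl, h1, h2, h3⟩ := exists_node_of_mem_branchingTrees ht
  exact ⟨Kind.two_le_of_mem_graphs hP h1, h2, fun i => (h3 i).1.1⟩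

lemma skippingTrees_isOrdered {P : GraphClass} {I : ℕ ≃. ℕ} {q : Kind} (hP : IsPrimeClass P)
    {τ : STree} {A : τ.Node → Prop → Prop} (t : STree) (ht : t ∈ skippingTrees P I q τ A) :
    t.IsOrdered := by
  obtain ⟨d, G, c, rfl, h1, h2, h3⟩ := exists_node_of_mem_skippingTrees ht
  exact ⟨Kind.two_le_of_mem_graphs hP h1, h2, fun i => (h3 i).1.1⟩

lemma IsGenFun.analyticAt_branchTerm {P : GraphClass} {B : Kind → ℂ → ℂ}
    {C : Kind → ∀ τ : STree, (τ.Node → Prop → Prop) → ℂ → ℂ} (h : IsGenFun P B C)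
    (hρ : 0 < seriesRadius (classCoeff P)) (q : Kind) (τ : STree) (A : τ.Node → Prop → Prop) :
    AnalyticAt ℂ (branchTerm P (B q) q τ A (C q)) 0 := by
  cases τ with
  | leaf m => exact analyticAt_const
  | node k H c' =>
    simp only [branchTerm]
    split_ifs
    · exact (h.analyticAt_pser hρ q H).mul (analyticAt_finset_prod _ fun j _ => h.analyticAt_C _ _ _)
    · exact analyticAt_const

open Classical in
/-- The part of the set of labels `D` with marks in the `j`-th tree attached to the root. -/
noncomputable def childMarks (I : ℕ ≃. ℕ) (D : Finset ℕ) {k : ℕ} (c' : Fin k → STree) (j : Fin k) :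
    Finset ℕ := D.filter fun l => ∃ m ∈ (c' j).labels, I l = some m

lemma mem_childMarks {I : ℕ ≃. ℕ} {D : Finset ℕ} {k : ℕ} {c' : Fin k → STree} {j : Fin k} {l : ℕ} :
    l ∈ childMarks I D c' j ↔ l ∈ D ∧ ∃ m ∈ (c' j).labels, I l = some m := by
  classical
  exact Finset.mem_filter

lemma MarkedOnto.child {I : ℕ ≃. ℕ} {D : Finset ℕ} {k : ℕ} {H : SimpleGraph (Fin k)}
    {c' : Fin k → STree} (h : MarkedOnto I D (node k H c')) (j : Fin k) :
    MarkedOnto I (childMarks I D c' j) (c' j) where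
  mem_labels_iff m := by
    constructor
    · intro hm
      obtain ⟨l, hl, hlm⟩ := (h.mem_labels_iff m).1 (by
        rw [labels_node, Multiset.mem_sum]
        exact ⟨j, Finset.mem_univ _, hm⟩)
      exact ⟨l, mem_childMarks.2 ⟨hl, m, hm, hlm⟩, hlm⟩
    · rintro ⟨l, hl, hlm⟩
      obtain ⟨_, m', hm', hlm'⟩ := mem_childMarks.1 hl
      rw [hlm] at hlm'
      obtain rfl := Option.some.inj hlm'
      exact hm'
  marked l hl := h.marked l (mem_childMarks.1 hl).1

lemma MarkedOnto.biUnion_childMarks {I : ℕ ≃. ℕ} {D : Finset ℕ} {k : ℕ} {H : SimpleGraph (Fin k)}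
    {c' : Fin k → STree} (h : MarkedOnto I D (node k H c')) :
    Finset.univ.biUnion (childMarks I D c') = D := by
  classical
  ext l
  simp only [Finset.mem_biUnion, Finset.mem_univ, true_and, mem_childMarks]
  refine ⟨fun ⟨j, hj, _⟩ => hj, fun hl => ?_⟩
  obtain ⟨m, hm⟩ := h.marked l hl
  have := (h.mem_labels_iff m).2 ⟨l, hl, hm⟩
  rw [labels_node, Multiset.mem_sum] at this
  obtain ⟨j, _, hj⟩ := this
  exact ⟨j, hl, m, hj, hm⟩

lemma MarkedOnto.nonempty {I : ℕ ≃. ℕ} {D : Finset ℕ} {τ : STree} (hτ : τ.IsOrdered)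
    (h : MarkedOnto I D τ) : D.Nonempty := by
  obtain ⟨m, hm⟩ := Multiset.exists_mem_of_ne_zero (labels_ne_zero hτ)
  obtain ⟨l, hl, _⟩ := (h.mem_labels_iff m).1 hm
  exact ⟨l, hl⟩

lemma disjoint_childMarks {I : ℕ ≃. ℕ} {D : Finset ℕ} {k : ℕ} {c' : Fin k → STree}
    (hnd : (∑ j, (c' j).labels).Nodup) (i j : Fin k) (hij : i ≠ j) :
    Disjoint (childMarks I D c' i) (childMarks I D c' j) := by
  classical
  rw [Finset.disjoint_left]
  intro l hi hj
  obtain ⟨_, m, hm, hlm⟩ := mem_childMarks.1 hi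
  obtain ⟨_, m', hm', hlm'⟩ := mem_childMarks.1 hj
  rw [hlm] at hlm'
  obtain rfl := Option.some.inj hlm'
  exact hij (notMem_of_nodup_sum hnd hm hm')

/-- The numbers of marked trees. -/
theorem numTrees_markedTrees {P : GraphClass} (hP : IsPrimeClass P)
    (hρ : 0 < seriesRadius (classCoeff P)) {B : Kind → ℂ → ℂ}
    {C : Kind → ∀ τ : STree, (τ.Node → Prop → Prop) → ℂ → ℂ} (h : IsGenFun P B C) {I : ℕ ≃. ℕ}
    (U D : Finset ℕ) (hU : ∀ l ∈ U, I l = none) (τ : STree) (hτ : τ.IsOrdered)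
    (hnd : τ.labels.Nodup) (A : τ.Node → Prop → Prop) (hD : MarkedOnto I D τ) (q' : Kind) :
    (numTrees (markedTrees P I q' τ A) (U ∪ D) : ℂ) = iteratedDeriv U.card (C q' τ A) 0 := by
  classical
  induction hn : (U ∪ D).card using Nat.strong_induction_on generalizing U D τ q' with
  | _ n ih =>
    subst hn
    have hdisj : ∀ {D' : Finset ℕ}, (∀ l ∈ D', ∃ m, I l = some m) → Disjoint U D' := by
      intro D' h1
      rw [Finset.disjoint_left]
      intro l hl hl'
      obtain ⟨m, hm⟩ := h1 l hl'
      rw [hU l hl] at hm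
      simp at hm
    have hunm : ∀ q, CountedBy (unmarkedTrees P I q) U ∅ (U ∪ D) (B q) := by
      intro q U' hU' _
      rw [Finset.union_empty]
      exact numTrees_unmarkedTrees hP hρ h U' (fun l hl => hU l (hU' hl)) q
    -- The only distinguished child ($k=1$) induces the same $\tau$ with the same $D$, but has fewer
    -- labels. For this reason the induction is on $|U\cup D|$ and not on $\tau$.
    have hskip : ∀ q, (numTrees (skippingTrees P I q τ A) (U ∪ D) : ℂ) = iteratedDeriv U.card
        (fun z => pser (ocoef (q.graphs P) (⊥ : SimpleGraph (Fin 1))) (B q z) * C q τ A z) 0 := by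
      intro q
      have hb : Finset.univ.biUnion (fun _ : Fin 1 => D) = D := by simp
      have h1 := numTrees_nodeTrees_eq_iteratedDeriv hρ (𝒢 := q.graphs P)
        (fun n G hG π => Kind.comap_mem_graphs hP hG π)
        (fun n G hG => Kind.two_le_of_mem_graphs hP hG)
        (H := (⊥ : SimpleGraph (Fin 1))) (Kind.convergesBelow P q _)
        (A := fun _ => markedTrees P I q τ A) (B := unmarkedTrees P I q)
        (fun _ => markedTrees_isOrdered) unmarkedTrees_isOrdered
        (U := U) (D := fun _ => D) (fun _ => hD.nonempty hτ) (fun _ => hdisj hD.marked)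
        (fun i j hij => absurd (Subsingleton.elim i j) hij)
        (by rw [hb]; exact fun _ => splitsOver_markedTrees P q A hD.marked hD)
        (by rw [hb]; exact splitsOver_unmarkedTrees P q hD.marked)
        (f := fun _ => C q τ A) (g := B q)
        (fun _ => h.analyticAt_C q τ A) (h.analyticAt_B q) (h.B_zero q) (by
          rw [hb]
          intro _ U' hU' hss
          exact ih _ (Finset.card_lt_card hss) U' D (fun l hl => hU l (hU' hl)) τ hτ hnd A hD q rfl)
        (by rw [hb]; exact hunm q)
      rw [hb] at h1
      simpa [skippingTrees] using h1
    -- The marked labels are split as $D=\bigsqcup D_j$ according to the child of the root of $\tau$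
    -- that carries the mark.
    have hbranch : ∀ q, (numTrees (branchingTrees P I q τ A) (U ∪ D) : ℂ) = iteratedDeriv U.card
        (branchTerm P (B q) q τ A (C q)) 0 := by
      intro q
      have hempty : ∀ S, numTrees ∅ S = 0 := fun S => by simp [numTrees]
      cases τ with
      | leaf m =>
        simp only [branchingTrees, branchTerm, hempty]
        change ((0 : ℕ) : ℂ) = iteratedDeriv U.card (fun _ => 0) 0
        simp
      | node k H c' =>
        by_cases hA : A rootNode (q ≠ Kind.prime)
        · have hset : branchingTrees P I q (node k H c') A = nodeTrees (q.graphs P) H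
              (fun j => markedTrees P I q (c' j) fun n => A (childNode j n))
              (unmarkedTrees P I q) := by
            ext t
            exact ⟨fun ht => ht.2.2, fun ht => ⟨hτ.1, hA, ht⟩⟩
          have hb := hD.biUnion_childMarks
          have h1 := numTrees_nodeTrees_eq_iteratedDeriv hρ (𝒢 := q.graphs P)
            (fun n G hG π => Kind.comap_mem_graphs hP hG π)
            (fun n G hG => Kind.two_le_of_mem_graphs hP hG)
            (H := H) (Kind.convergesBelow P q _)
            (A := fun j => markedTrees P I q (c' j) fun n => A (childNode j n))
            (B := unmarkedTrees P I q)
            (fun _ => markedTrees_isOrdered) unmarkedTrees_isOrdered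
            (U := U) (D := childMarks I D c') (fun j => (hD.child j).nonempty (hτ.2.2 j))
            (fun j => hdisj (hD.child j).marked)
            (disjoint_childMarks hnd)
            (by rw [hb]; exact fun j => splitsOver_markedTrees P q _ hD.marked (hD.child j))
            (by rw [hb]; exact splitsOver_unmarkedTrees P q hD.marked)
            (f := fun j => C q (c' j) fun n => A (childNode j n)) (g := B q)
            (fun _ => h.analyticAt_C q _ _) (h.analyticAt_B q) (h.B_zero q) (by
              rw [hb]
              intro j U' hU' hss
              exact ih _ (Finset.card_lt_card hss) U' _ (fun l hl => hU l (hU' hl)) _ (hτ.2.2 j)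
                (Multiset.nodup_of_le (labels_le_sum c' j) hnd) _ (hD.child j) q rfl)
            (by rw [hb]; exact hunm q)
          rw [hb] at h1
          rw [hset, h1]
          simp only [branchTerm, if_pos hA]
        · have hset : branchingTrees P I q (node k H c') A = ∅ := by
            ext t
            exact ⟨fun ht => absurd ht.2.1 hA, fun ht => absurd ht (Set.notMem_empty _)⟩
          rw [hset, hempty]
          simp only [branchTerm, if_neg hA]
          simp
    have hordU : ∀ q, ∀ t ∈ skippingTrees P I q τ A ∪ branchingTrees P I q τ A, t.IsOrdered := by
      rintro q t (ht | ht)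
      · exact skippingTrees_isOrdered hP t ht
      · exact branchingTrees_isOrdered hP t ht
    have hterm : ∀ q, AnalyticAt ℂ (fun z =>
        pser (ocoef (q.graphs P) (⊥ : SimpleGraph (Fin 1))) (B q z) * C q τ A z) 0 := fun q =>
      (h.analyticAt_pser hρ q _).mul (h.analyticAt_C q τ A)
    rw [markedTrees_eq hP, numTrees_union, numTrees_biUnion, Nat.cast_add,
      numTrees_marked_leaves hU hD, (h.C_eq q' τ A).iteratedDeriv_eq, iteratedDeriv_fun_add,
      iteratedDeriv_fun_sum, iteratedDeriv_const_zero]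
    · push_cast
      congr 1
      refine Finset.sum_congr rfl fun q _ => ?_
      rw [numTrees_union (skippingTrees_isOrdered hP) (branchingTrees_isOrdered hP)
        (disjoint_skippingTrees_branchingTrees hP I q hτ A), Nat.cast_add, hskip, hbranch,
        iteratedDeriv_fun_add (hterm q).contDiffAt (h.analyticAt_branchTerm hρ q τ A).contDiffAt]
    · exact fun q _ => ((hterm q).add (h.analyticAt_branchTerm hρ q τ A)).contDiffAt
    · exact contDiffAt_const
    · exact (Finset.analyticAt_fun_sum _ fun q _ =>
        (hterm q).add (h.analyticAt_branchTerm hρ q τ A)).contDiffAt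
    · exact hordU
    · refine disjoint_of_exists_node hP fun q t ht => ?_
      rcases ht with ht | ht
      · obtain ⟨d, G, c, h1, h2, _⟩ := exists_node_of_mem_skippingTrees ht
        exact ⟨d, G, c, h1, h2⟩
      · obtain ⟨d, G, c, h1, h2, _⟩ := exists_node_of_mem_branchingTrees ht
        exact ⟨d, G, c, h1, h2⟩
    · rintro _ ⟨l, m, rfl, _⟩
      exact trivial
    · intro t ht
      obtain ⟨q, _, hq⟩ := Set.mem_iUnion₂.1 ht
      exact hordU q t hq
    · rw [Set.disjoint_left]
      rintro _ ⟨l, m, rfl, _⟩ ht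
      obtain ⟨q, _, hq⟩ := Set.mem_iUnion₂.1 ht
      rcases hq with hq | hq
      · obtain ⟨d, G, c, h1, _⟩ := exists_node_of_mem_skippingTrees hq
        cases h1
      · obtain ⟨d, G, c, h1, _⟩ := exists_node_of_mem_branchingTrees hq
        cases h1

open STree

/-! ### Generating functions of marked trees -/

open Classical in
/-- The partial injection with a given injection from `L` to `E` as its inverse. -/
noncomputable def pequivOfEmbedding {L E : Finset ℕ} (e : L ↪ E) : ℕ ≃. ℕ where
  toFun l := if h : ∃ m : L, (e m : ℕ) = l then some h.choose else none
  invFun m := if h : m ∈ L then some (e ⟨m, h⟩) else none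
  inv l m := by
    constructor
    · intro h
      split_ifs at h with hm
      · split_ifs with hl
        · have h1 : (e hl.choose : ℕ) = l := hl.choose_spec
          have h2 : (e ⟨m, hm⟩ : ℕ) = l := by simpa using h
          have h3 := e.injective (Subtype.ext (h1.trans h2.symm))
          rw [h3]
        · exact absurd ⟨⟨m, hm⟩, by simpa using h⟩ hl
    · intro h
      split_ifs at h with hl
      · have h1 : (hl.choose : ℕ) = m := by simpa using h
        have h2 : m ∈ L := h1 ▸ hl.choose.2
        rw [dif_pos h2]
        have h3 : (⟨m, h2⟩ : L) = hl.choose := Subtype.ext h1.symm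
        rw [h3, hl.choose_spec]

lemma pequivOfEmbedding_eq_some {L E : Finset ℕ} (e : L ↪ E) {l m : ℕ} :
    pequivOfEmbedding e l = some m ↔ ∃ h : m ∈ L, (e ⟨m, h⟩ : ℕ) = l := by
  refine (PEquiv.eq_some_iff _).symm.trans ?_
  change (if h : m ∈ L then some (e ⟨m, h⟩ : ℕ) else none) = some l ↔ _
  by_cases h : m ∈ L <;> simp [h]

/-- `I` is a partial injection from `E` onto `L`. -/
def IsMarkingOnto (E L : Finset ℕ) (I : ℕ ≃. ℕ) : Prop :=
  (∀ l m, I l = some m → l ∈ E ∧ m ∈ L) ∧ ∀ m ∈ L, ∃ l, I l = some m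

/-- A marking with image $L$ is determined by its inverse, an injection of $L$ into $E$; hence the
markings are counted by a falling factorial. -/
lemma bijective_pequivOfEmbedding (L E : Finset ℕ) :
    Function.Bijective fun e : L ↪ E =>
      (⟨pequivOfEmbedding e, fun l m h => by
        obtain ⟨h1, rfl⟩ := (pequivOfEmbedding_eq_some e).1 h
        exact ⟨(e _).2, h1⟩,
        fun m hm => ⟨e ⟨m, hm⟩, (pequivOfEmbedding_eq_some e).2 ⟨hm, rfl⟩⟩⟩ :
          {I : ℕ ≃. ℕ // IsMarkingOnto E L I}) := by
  constructor
  · intro e e' h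
    have h1 : pequivOfEmbedding e = pequivOfEmbedding e' := congrArg Subtype.val h
    ext m
    have h2 := (pequivOfEmbedding_eq_some e).2 ⟨m.2, rfl⟩
    rw [h1] at h2
    obtain ⟨_, h3⟩ := (pequivOfEmbedding_eq_some e').1 h2
    exact h3.symm
  · rintro ⟨I, h1, h2⟩
    have h2' := h2
    choose f hf using h2'
    refine ⟨⟨fun m => ⟨f m m.2, (h1 _ _ (hf m m.2)).1⟩, fun m m' h => ?_⟩, ?_⟩
    · have h3 : f m m.2 = f m' m'.2 := congrArg Subtype.val h
      have h4 := hf m m.2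
      rw [h3, hf m' m'.2] at h4
      exact Subtype.ext (Option.some.inj h4).symm
    · apply Subtype.ext
      apply PEquiv.ext
      intro l
      ext m
      change pequivOfEmbedding _ l = some m ↔ I l = some m
      rw [pequivOfEmbedding_eq_some]
      constructor
      · rintro ⟨hm, rfl⟩
        exact hf m hm
      · intro h
        exact ⟨(h1 _ _ h).2, I.inj (hf m _) h⟩

lemma card_isMarkingOnto (E L : Finset ℕ) :
    Nat.card {I : ℕ ≃. ℕ // IsMarkingOnto E L I} = E.card.descFactorial L.card := by
  rw [← Nat.card_congr (Equiv.ofBijective _ (bijective_pequivOfEmbedding L E)),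
    Nat.card_eq_fintype_card, Fintype.card_embedding_eq]
  simp

lemma finite_isMarkingOnto (E L : Finset ℕ) : Finite {I : ℕ ≃. ℕ // IsMarkingOnto E L I} :=
  Finite.of_equiv _ (Equiv.ofBijective _ (bijective_pequivOfEmbedding L E))

/-- At $0$ only the $k$-th derivative of $z^k$ survives, and $k!\binom nk$ is the number of ways to
place $k$ distinct marks on $n$ labels. -/
lemma iteratedDeriv_pow_mul {F : ℂ → ℂ} (hF : AnalyticAt ℂ F 0) (n k : ℕ) :
    iteratedDeriv n (fun z => z ^ k * F z) 0 = n.descFactorial k * iteratedDeriv (n - k) F 0 := by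
  rcases lt_or_ge n k with h | h
  · rw [iteratedDeriv_pow_mul_eq_zero (g := fun z => z) n k h analyticAt_id hF rfl,
      Nat.descFactorial_of_lt h]
    simp
  · rw [iteratedDeriv_fun_mul (by fun_prop) hF.contDiffAt, Finset.sum_eq_single k]
    · rw [Nat.descFactorial_eq_factorial_mul_choose, iteratedDeriv_fun_pow_zero, if_pos rfl]
      push_cast
      ring
    · intro i _ hi
      rw [iteratedDeriv_fun_pow_zero, if_neg hi]
      simp
    · intro hk
      simp at hk
      omega

/-- The marked trees inducing `τ`, with a condition on the linearity of the nodes that the nodes of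
`τ` come from. -/
def inducingSet (P : GraphClass) (τ : STree) (A : τ.Node → Prop → Prop) : Set (STree × (ℕ ≃. ℕ)) :=
  {p | p.1 ∈ modularTrees P ∧ IsMarkedTree p ∧ InducesWith p.2 τ A p.1}

/-- The marked trees of a given size in `inducingSet`, listed by their markings. -/
lemma card_inducingSet (P : GraphClass) {τ : STree} {L : Finset ℕ} (hL : τ.labels = L.val)
    (A : τ.Node → Prop → Prop) (n : ℕ) :
    {p ∈ inducingSet P τ A | p.1.size = n}.ncard =
      Nat.card (Σ I : {I : ℕ ≃. ℕ // IsMarkingOnto (Finset.Icc 1 n) L I},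
        {t // t ∈ markedTrees P I.1 Kind.prime τ A ∧ t.labels = (Finset.Icc 1 n).val}) := by
  have hlab : ∀ {t : STree}, t.IsSubstitutionTree → t.size = n →
      t.labels = (Finset.Icc 1 n).val := by
    rintro t ht rfl
    exact ht.2
  -- Any reduced tree may be attached to a prime node, so the class for `Kind.prime` is the class of
  -- all trees, without condition on the root.
  refine Nat.card_congr (β := Σ I : {I : ℕ ≃. ℕ // IsMarkingOnto (Finset.Icc 1 n) L I},
        {t // t ∈ markedTrees P I.1 Kind.prime τ A ∧ t.labels = (Finset.Icc 1 n).val})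
    { toFun := fun p => ⟨⟨p.1.2, ?_, ?_⟩, ⟨p.1.1, ⟨⟨⟨p.2.1.1.1.1, p.2.1.1.2⟩, fun h => absurd rfl h⟩,
        p.2.1.2.2⟩, hlab p.2.1.1.1 p.2.2⟩⟩
      invFun := fun y => ⟨(y.2.1, y.1.1), ⟨⟨⟨y.2.2.1.1.1.1, ?_⟩, y.2.2.1.1.1.2⟩, ?_, y.2.2.1.2⟩, ?_⟩
      left_inv := fun _ => rfl
      right_inv := fun _ => rfl }
  · intro l m hlm
    have h1 := p.2.1.2.1 l m hlm
    refine ⟨?_, ?_⟩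
    · have h2 := hlab p.2.1.1.1 p.2.2
      rw [h2] at h1
      exact h1
    · rw [← Finset.mem_val, ← hL, ← p.2.1.2.2.filterMap_labels]
      exact (Multiset.mem_filterMap _ _).2 ⟨l, h1, hlm⟩
  · intro m hm
    rw [← Finset.mem_val, ← hL, ← p.2.1.2.2.filterMap_labels] at hm
    obtain ⟨l, _, h⟩ := (Multiset.mem_filterMap _ _).1 hm
    exact ⟨l, h⟩
  · rw [size, y.2.2.2]; simp
  · intro l m hlm
    change l ∈ y.2.1.labels
    rw [y.2.2.2]
    exact (y.1.2.1 l m hlm).1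
  · change Multiset.card y.2.1.labels = n
    rw [y.2.2.2]; simp

/-- Every marking of $\{1,\dots,n\}$ leaves $n-|\tau|$ labels unmarked and admits the same number of
trees. The number of markings is produced by the factor $z^{|\tau|}$. -/
theorem ncard_inducingSet_eq_iteratedDeriv {P : GraphClass} (hP : IsPrimeClass P)
    (hρ : 0 < seriesRadius (classCoeff P)) {B : Kind → ℂ → ℂ}
    {C : Kind → ∀ τ : STree, (τ.Node → Prop → Prop) → ℂ → ℂ} (h : IsGenFun P B C) {τ : STree}
    (hτ : τ.IsSubstitutionTree) (A : τ.Node → Prop → Prop) (n : ℕ) :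
    ({p ∈ inducingSet P τ A | p.1.size = n}.ncard : ℂ) =
      iteratedDeriv n (fun z => z ^ τ.size * C Kind.prime τ A z) 0 := by
  classical
  rw [card_inducingSet P hτ.2, iteratedDeriv_pow_mul (h.analyticAt_C _ _ _)]
  have hf := finite_isMarkingOnto (Finset.Icc 1 n) (Finset.Icc 1 τ.size)
  have hfin : ∀ I : {I : ℕ ≃. ℕ // IsMarkingOnto (Finset.Icc 1 n) (Finset.Icc 1 τ.size) I},
      Finite {t // t ∈ markedTrees P I.1 Kind.prime τ A ∧ t.labels = (Finset.Icc 1 n).val} :=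
    fun I => finite_subtype_labels markedTrees_isOrdered _
  have := Fintype.ofFinite {I : ℕ ≃. ℕ // IsMarkingOnto (Finset.Icc 1 n) (Finset.Icc 1 τ.size) I}
  rw [Nat.card_sigma]
  have key : ∀ I : {I : ℕ ≃. ℕ // IsMarkingOnto (Finset.Icc 1 n) (Finset.Icc 1 τ.size) I},
      (Nat.card {t // t ∈ markedTrees P I.1 Kind.prime τ A ∧ t.labels = (Finset.Icc 1 n).val} : ℂ) =
        iteratedDeriv (n - τ.size) (C Kind.prime τ A) 0 := by
    rintro ⟨I, hI1, hI2⟩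
    set D := (Finset.Icc 1 n).filter fun l => ∃ m, I l = some m with hDdef
    set U := (Finset.Icc 1 n).filter fun l => ¬ ∃ m, I l = some m with hUdef
    have hUD : U ∪ D = Finset.Icc 1 n := by
      rw [Finset.union_comm]; exact Finset.filter_union_filter_not_eq _ _
    have hD : MarkedOnto I D τ := by
      constructor
      · intro m
        rw [hτ.2, Finset.mem_val]
        constructor
        · intro hm
          obtain ⟨l, hl⟩ := hI2 m hm
          exact ⟨l, Finset.mem_filter.2 ⟨(hI1 l m hl).1, m, hl⟩, hl⟩
        · rintro ⟨l, _, hl⟩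
          exact (hI1 l m hl).2
      · intro l hl
        exact (Finset.mem_filter.1 hl).2
    have hU : ∀ l ∈ U, I l = none := by
      intro l hl
      have := (Finset.mem_filter.1 hl).2
      by_contra hne
      exact this (Option.ne_none_iff_exists'.1 hne)
    have hcD : D.card = τ.size := by
      have hc : (Finset.Icc 1 τ.size).card = D.card := by
        choose f hf using hI2
        refine Finset.card_bij f (fun m hm => Finset.mem_filter.2 ⟨(hI1 _ _ (hf m hm)).1, m, hf m hm⟩)
          (fun m hm m' hm' h => ?_) (fun l hl => ?_)
        · have h4 := hf m hm
          rw [h, hf m' hm'] at h4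
          exact (Option.some.inj h4).symm
        · obtain ⟨_, m, hm⟩ := Finset.mem_filter.1 hl
          exact ⟨m, (hI1 _ _ hm).2, I.inj (hf _ _) hm⟩
      simpa using hc.symm
    have hcU : U.card = n - τ.size := by
      have h1 : U.card + D.card = (Finset.Icc 1 n).card := by
        rw [add_comm]; exact Finset.card_filter_add_card_filter_not _
      rw [Nat.card_Icc] at h1
      omega
    have h1 := numTrees_markedTrees hP hρ h U D hU τ hτ.1 (hτ.2 ▸ Finset.nodup _) A hD Kind.prime
    rw [hUD, hcU] at h1
    exact h1
  push_cast
  rw [Finset.sum_congr rfl fun I _ => key I, Finset.sum_const, nsmul_eq_mul, Finset.card_univ,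
    ← Nat.card_eq_fintype_card, card_isMarkingOnto]
  simp

/-- Since `ncard` is $0$ by default on infinite sets, finiteness is needed to conclude from a
vanishing coefficient that there is no tree. -/
lemma finite_inducingSet (P : GraphClass) {τ : STree} (hτ : τ.IsSubstitutionTree)
    (A : τ.Node → Prop → Prop) (n : ℕ) : {p ∈ inducingSet P τ A | p.1.size = n}.Finite := by
  have hf : Finite {I : ℕ ≃. ℕ | IsMarkingOnto (Finset.Icc 1 n) (Finset.Icc 1 τ.size) I} :=
    finite_isMarkingOnto (Finset.Icc 1 n) (Finset.Icc 1 τ.size)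
  have hfp : (Set.prod {t : STree | t.IsOrdered ∧ t.labels = (Finset.Icc 1 n).val}
      {I : ℕ ≃. ℕ | IsMarkingOnto (Finset.Icc 1 n) (Finset.Icc 1 τ.size) I}).Finite :=
    (finite_isOrdered _).prod (Set.toFinite _)
  refine hfp.subset ?_
  rintro ⟨t, I⟩ ⟨⟨h1, h2, h3⟩, rfl⟩
  dsimp only at h1 h2 h3 ⊢
  refine ⟨⟨h1.1.1, h1.1.2⟩, ?_, ?_⟩
  · intro l m hlm
    have h4 := h2 l m hlm
    refine ⟨?_, ?_⟩
    · rw [← Finset.mem_val, ← h1.1.2]; exact h4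
    · rw [← Finset.mem_val, ← hτ.2, ← h3.filterMap_labels]
      exact (Multiset.mem_filterMap _ _).2 ⟨l, h4, hlm⟩
  · intro m hm
    rw [← Finset.mem_val, ← hτ.2, ← h3.filterMap_labels] at hm
    obtain ⟨l, _, h⟩ := (Multiset.mem_filterMap _ _).1 hm
    exact ⟨l, h⟩

lemma inducing_eq_inducingSet (P : GraphClass) (τ : STree) :
    inducing P τ = inducingSet P τ fun _ _ => True := by
  ext p
  refine and_congr_right fun _ => and_congr_right fun _ => ?_
  exact ⟨fun ⟨φ, h⟩ => ⟨φ, h, fun _ => trivial⟩, fun ⟨φ, h, _⟩ => ⟨φ, h⟩⟩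

lemma inducingWith_eq_inducingSet (P : GraphClass) (τ : STree) (N : Finset τ.Node) :
    inducingWith P τ N = inducingSet P τ fun n p => (n ∈ N ↔ ¬ p) := rfl

/-! ### The function `Λ` in the complex plane -/

/-- The domain `|exp w - 1| < R₀` of `Λ`. -/
def lamDom (P : GraphClass) : Set ℂ :=
  {w | ENNReal.ofReal ‖Complex.exp w - 1‖ < seriesRadius (classCoeff P)}

/-- `Λ` as a complex function. -/
noncomputable def lamC (P : GraphClass) (w : ℂ) : ℂ :=
  pser (classCoeff P) (Complex.exp w - 1) + (Complex.exp w - 1 - w)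

/-- The derivative of `Λ`. -/
noncomputable def lamC' (P : GraphClass) (w : ℂ) : ℂ :=
  pser (derivCoeff (classCoeff P)) (Complex.exp w - 1) * Complex.exp w + (Complex.exp w - 1)

/-- The second derivative of `Λ`. -/
noncomputable def lamC'' (P : GraphClass) (w : ℂ) : ℂ :=
  pser (derivCoeff (derivCoeff (classCoeff P))) (Complex.exp w - 1) * Complex.exp w * Complex.exp w +
    pser (derivCoeff (classCoeff P)) (Complex.exp w - 1) * Complex.exp w + Complex.exp w

lemma isOpen_lamDom (P : GraphClass) : IsOpen (lamDom P) :=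
  (isOpen_ofReal_norm_lt _).preimage (by fun_prop : Continuous fun w : ℂ => Complex.exp w - 1)

lemma hasDerivAt_pser_exp {a : ℕ → ℝ} {ρ : ℝ≥0∞} (ha : ConvergesBelow a ρ) {w : ℂ}
    (hw : ENNReal.ofReal ‖Complex.exp w - 1‖ < ρ) :
    HasDerivAt (fun w => pser a (Complex.exp w - 1))
      (pser (derivCoeff a) (Complex.exp w - 1) * Complex.exp w) w :=
  HasDerivAt.comp (h₂ := pser a) (h := fun w => Complex.exp w - 1) w (ha.hasDerivAt hw)
    ((Complex.hasDerivAt_exp w).sub_const 1)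

lemma hasDerivAt_lamC {P : GraphClass} {w : ℂ} (hw : w ∈ lamDom P) :
    HasDerivAt (lamC P) (lamC' P w) w :=
  (hasDerivAt_pser_exp (convergesBelow_seriesRadius _) hw).add
    (((Complex.hasDerivAt_exp w).sub_const 1).sub (hasDerivAt_id w))

lemma hasDerivAt_lamC' {P : GraphClass} {w : ℂ} (hw : w ∈ lamDom P) :
    HasDerivAt (lamC' P) (lamC'' P w) w :=
  ((hasDerivAt_pser_exp (convergesBelow_seriesRadius _).derivCoeff hw).mul
    (Complex.hasDerivAt_exp w)).add ((Complex.hasDerivAt_exp w).sub_const 1)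

lemma analyticAt_lamC {P : GraphClass} {w : ℂ} (hw : w ∈ lamDom P) : AnalyticAt ℂ (lamC P) w :=
  DifferentiableOn.analyticAt (fun _ hv => (hasDerivAt_lamC hv).differentiableAt.differentiableWithinAt)
    ((isOpen_lamDom P).mem_nhds hw)

lemma exp_sub_one_eq_pser (w : ℂ) : Complex.exp w - 1 = pser (expCoeff 1) w := by
  rw [pser_expCoeff]; simp

lemma exp_sub_one_sub_eq_pser (w : ℂ) : Complex.exp w - 1 - w = pser (expCoeff 0) w := by
  rw [pser_expCoeff]; simp

lemma expCoeff_nonneg (k n : ℕ) : 0 ≤ expCoeff k n := by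
  unfold expCoeff; positivity

lemma norm_exp_sub_one_le {w : ℂ} {y : ℝ} (h : ‖w‖ ≤ y) : ‖Complex.exp w - 1‖ ≤ Real.exp y - 1 := by
  have h1 := norm_pser_le (convergesBelow_expCoeff 1 ⊤) (expCoeff_nonneg 1) h ENNReal.ofReal_lt_top
  rw [← exp_sub_one_eq_pser, ← exp_sub_one_eq_pser, ← Complex.ofReal_exp] at h1
  simpa only [Complex.sub_re, Complex.ofReal_re, Complex.one_re] using h1

lemma norm_exp_sub_one_sub_le {w : ℂ} {y : ℝ} (h : ‖w‖ ≤ y) :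
    ‖Complex.exp w - 1 - w‖ ≤ Real.exp y - 1 - y := by
  have h1 := norm_pser_le (convergesBelow_expCoeff 0 ⊤) (expCoeff_nonneg 0) h ENNReal.ofReal_lt_top
  rw [← exp_sub_one_sub_eq_pser, ← exp_sub_one_sub_eq_pser, ← Complex.ofReal_exp] at h1
  simpa only [Complex.sub_re, Complex.ofReal_re, Complex.one_re] using h1

lemma norm_exp_le {w : ℂ} {y : ℝ} (h : ‖w‖ ≤ y) : ‖Complex.exp w‖ ≤ Real.exp y := by
  rw [Complex.norm_exp]
  exact Real.exp_le_exp.2 ((Complex.re_le_norm w).trans h)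

/-- Equality in `norm_exp_sub_one_sub_le` occurs only on the positive half-line. -/
lemma norm_exp_sub_one_sub_lt {w : ℂ} {y : ℝ} (h : ‖w‖ = y) (hy : 0 < y) (hw : w ≠ y) :
    ‖Complex.exp w - 1 - w‖ < Real.exp y - 1 - y := by
  have hc := convergesBelow_expCoeff 0 ⊤
  -- The two lowest terms are kept together: $w^2/2+w^3/6=\frac{w^2}6(3+w)$. The strict inequality
  -- comes from $|3+w|<3+|w|$ off the positive half-line; the tail is bounded term by term.
  have h4 : ∀ w : ℂ, Complex.exp w - 1 - w =
      w ^ 2 / 6 * (3 + w) + w ^ 4 * pser (fun n => expCoeff 0 (n + 4)) w := by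
    intro w
    rw [exp_sub_one_sub_eq_pser, hc.pser_eq_sum_add 4 ENNReal.ofReal_lt_top]
    simp [Finset.sum_range_succ, expCoeff, Nat.factorial]
    ring
  have ht := norm_pser_le (hc.shift 4) (fun n => expCoeff_nonneg 0 (n + 4)) h.le
    ENNReal.ofReal_lt_top
  have hre : w.re < y := by
    have h1 := Complex.re_le_norm w
    rcases (h ▸ h1).lt_or_eq with h2 | h2
    · exact h2
    · exfalso
      apply hw
      have h3 : w.re ^ 2 + w.im ^ 2 = y ^ 2 := by
        rw [← h, ← Complex.normSq_eq_norm_sq, Complex.normSq_apply]; ring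
      have h4 : w.im = 0 := by
        rw [h2] at h3
        have : w.im ^ 2 = 0 := by linarith
        simpa using this
      exact Complex.ext (by simpa using h2) (by simpa using h4)
  have h3 : ‖3 + w‖ < 3 + y := by
    have h1 : ‖3 + w‖ ^ 2 < (3 + y) ^ 2 := by
      have h3 : w.re ^ 2 + w.im ^ 2 = y ^ 2 := by
        rw [← h, ← Complex.normSq_eq_norm_sq, Complex.normSq_apply]; ring
      rw [← Complex.normSq_eq_norm_sq, Complex.normSq_apply]
      simp only [Complex.add_re, Complex.add_im, Complex.re_ofNat, Complex.im_ofNat]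
      nlinarith
    exact lt_of_pow_lt_pow_left₀ 2 (by positivity) h1
  have hy4 : Real.exp y - 1 - y = y ^ 2 / 6 * (3 + y) +
      y ^ 4 * (pser (fun n => expCoeff 0 (n + 4)) y).re := by
    have h5 := h4 y
    rw [← pser_ofReal_re] at h5
    exact_mod_cast h5
  rw [hy4, h4]
  refine (norm_add_le _ _).trans_lt (add_lt_add_of_lt_of_le ?_ ?_)
  · rw [norm_mul, norm_div, norm_pow, h, Complex.norm_ofNat]
    gcongr
  · rw [norm_mul, norm_pow, h]
    gcongr

/-! ### The function $\Lambda$ on the real line and the point $\kappa$ -/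

section Real

variable {P : GraphClass}

/-- The derivative of `Λ` on the real line. -/
noncomputable def lam' (P : GraphClass) (x : ℝ) : ℝ :=
  (pser (derivCoeff (classCoeff P)) (Real.exp x - 1 : ℝ)).re * Real.exp x + (Real.exp x - 1)

/-- The second derivative of `Λ` on the real line. -/
noncomputable def lam'' (P : GraphClass) (x : ℝ) : ℝ :=
  (pser (derivCoeff (derivCoeff (classCoeff P))) (Real.exp x - 1 : ℝ)).re * Real.exp x * Real.exp x +
    (pser (derivCoeff (classCoeff P)) (Real.exp x - 1 : ℝ)).re * Real.exp x + Real.exp x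

lemma lamC_ofReal (x : ℝ) : lamC P x = Lam P x := by
  rw [lamC, Lam, classSeries]
  push_cast
  rw [← Complex.ofReal_exp, ← Complex.ofReal_one, ← Complex.ofReal_sub, pser_ofReal]
  push_cast
  ring

lemma exp_sub_one_ofReal (x : ℝ) : Complex.exp x - 1 = ((Real.exp x - 1 : ℝ) : ℂ) := by
  push_cast
  rfl

lemma lamC'_ofReal (x : ℝ) : lamC' P x = lam' P x := by
  rw [lamC', lam', exp_sub_one_ofReal, ← Complex.ofReal_exp, ← pser_ofReal_re]
  norm_cast

lemma lamC''_ofReal (x : ℝ) : lamC'' P x = lam'' P x := by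
  rw [lamC'', lam'', exp_sub_one_ofReal, ← Complex.ofReal_exp, ← pser_ofReal_re,
    ← pser_ofReal_re (derivCoeff (classCoeff P))]
  norm_cast

lemma hasDerivAt_lam {x : ℝ} (hx : (x : ℂ) ∈ lamDom P) : HasDerivAt (Lam P) (lam' P x) x := by
  have h := (hasDerivAt_lamC hx).real_of_complex
  rw [lamC'_ofReal, Complex.ofReal_re] at h
  have h1 : (fun x : ℝ => (lamC P x).re) = Lam P := by
    ext y
    rw [lamC_ofReal, Complex.ofReal_re]
  rwa [h1] at h

lemma hasDerivAt_lam' {x : ℝ} (hx : (x : ℂ) ∈ lamDom P) : HasDerivAt (lam' P) (lam'' P x) x := by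
  have h := (hasDerivAt_lamC' hx).real_of_complex
  rw [lamC''_ofReal, Complex.ofReal_re] at h
  have h1 : (fun x : ℝ => (lamC' P x).re) = lam' P := by
    ext y
    rw [lamC'_ofReal, Complex.ofReal_re]
  rwa [h1] at h

lemma deriv_deriv_lam {x : ℝ} (hx : (x : ℂ) ∈ lamDom P) : deriv (deriv (Lam P)) x = lam'' P x := by
  have h : deriv (Lam P) =ᶠ[𝓝 x] lam' P := by
    have h1 : ∀ᶠ y : ℝ in 𝓝 x, (y : ℂ) ∈ lamDom P :=
      Complex.continuous_ofReal.continuousAt.eventually_mem ((isOpen_lamDom P).mem_nhds hx)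
    filter_upwards [h1] with y hy
    exact (hasDerivAt_lam hy).deriv
  rw [h.deriv_eq, (hasDerivAt_lam' hx).deriv]

lemma lt_lamRadius_iff {x : ℝ} (hx : 0 ≤ x) :
    (x : EReal) < lamRadius P ↔ ENNReal.ofReal (Real.exp x - 1) < seriesRadius (classCoeff P) := by
  have h1 : (x : EReal) = ENNReal.log (ENNReal.ofReal (Real.exp x)) := by
    rw [ENNReal.log_ofReal_of_pos (Real.exp_pos x), Real.log_exp]
  have h2 : ENNReal.ofReal (Real.exp x) = 1 + ENNReal.ofReal (Real.exp x - 1) := by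
    rw [← ENNReal.ofReal_one, ← ENNReal.ofReal_add zero_le_one]
    · congr 1; ring
    · linarith [Real.one_le_exp hx]
  rw [h1, lamRadius, ENNReal.log_lt_log_iff, h2]
  exact ENNReal.add_lt_add_iff_left ENNReal.one_ne_top

lemma mem_lamDom_of_norm_le {w : ℂ} {y : ℝ} (h : ‖w‖ ≤ y)
    (hy : ENNReal.ofReal (Real.exp y - 1) < seriesRadius (classCoeff P)) : w ∈ lamDom P :=
  (ENNReal.ofReal_le_ofReal (norm_exp_sub_one_le h)).trans_lt hy

lemma derivCoeff_nonneg {a : ℕ → ℝ} (h : ∀ n, 0 ≤ a n) (n : ℕ) : 0 ≤ derivCoeff a n :=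
  mul_nonneg (by positivity) (h _)

lemma norm_lamC_le {w : ℂ} {y : ℝ} (h : ‖w‖ ≤ y)
    (hy : ENNReal.ofReal (Real.exp y - 1) < seriesRadius (classCoeff P)) :
    ‖lamC P w‖ ≤ (pser (classCoeff P) (Real.exp y - 1 : ℝ)).re + ‖Complex.exp w - 1 - w‖ :=
  (norm_add_le _ _).trans (add_le_add_left (norm_pser_le (convergesBelow_seriesRadius _)
    (classCoeff_nonneg P) (norm_exp_sub_one_le h) hy) _)

lemma lam_eq (y : ℝ) : Lam P y =
    (pser (classCoeff P) (Real.exp y - 1 : ℝ)).re + (Real.exp y - 1 - y) := by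
  rw [pser_ofReal, Complex.ofReal_re, Lam, classSeries]
  ring

lemma norm_lamC_le_lam {w : ℂ} {y : ℝ} (h : ‖w‖ ≤ y)
    (hy : ENNReal.ofReal (Real.exp y - 1) < seriesRadius (classCoeff P)) :
    ‖lamC P w‖ ≤ Lam P y := by
  rw [lam_eq]
  exact (norm_lamC_le h hy).trans (add_le_add_right (norm_exp_sub_one_sub_le h) _)

lemma norm_lamC'_le {w : ℂ} {y : ℝ} (h : ‖w‖ ≤ y)
    (hy : ENNReal.ofReal (Real.exp y - 1) < seriesRadius (classCoeff P)) :
    ‖lamC' P w‖ ≤ lam' P y := by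
  refine (norm_add_le _ _).trans (add_le_add ?_ (norm_exp_sub_one_le h))
  rw [norm_mul]
  have h1 := norm_pser_le (convergesBelow_seriesRadius (classCoeff P)).derivCoeff
    (derivCoeff_nonneg (classCoeff_nonneg P)) (norm_exp_sub_one_le h) hy
  exact mul_le_mul h1 (norm_exp_le h) (norm_nonneg _) ((norm_nonneg _).trans h1)

/-- The part coming from $P$ is only nondecreasing; strictness comes from the summand $e^x-1$,
whatever the class. -/
lemma lam'_strictMono {x y : ℝ} (hx : 0 ≤ x) (hxy : x < y)
    (hy : ENNReal.ofReal (Real.exp y - 1) < seriesRadius (classCoeff P)) :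
    lam' P x < lam' P y := by
  have h1 := Real.exp_lt_exp.2 hxy
  have h2 : (pser (derivCoeff (classCoeff P)) (Real.exp x - 1 : ℝ)).re ≤
      (pser (derivCoeff (classCoeff P)) (Real.exp y - 1 : ℝ)).re :=
    pser_re_mono (convergesBelow_seriesRadius _).derivCoeff
      (derivCoeff_nonneg (classCoeff_nonneg P)) (by linarith [Real.one_le_exp hx]) (by linarith) hy
  have h3 : 0 ≤ (pser (derivCoeff (classCoeff P)) (Real.exp x - 1 : ℝ)).re :=
    pser_re_nonneg (derivCoeff_nonneg (classCoeff_nonneg P)) (by linarith [Real.one_le_exp hx])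
  refine add_lt_add_of_le_of_lt (mul_le_mul h2 h1.le (Real.exp_pos x).le (h3.trans h2)) (by linarith)

/-- Prime graphs have at least three vertices, so $P$ starts in degree $3$. This yields
$\Lambda(0)=\Lambda'(0)=0$. -/
lemma classCoeff_eq_zero (hP : IsPrimeClass P) {n : ℕ} (hn : n < 3) : classCoeff P n = 0 := by
  have : P n = ∅ := by
    ext G
    refine ⟨fun h => ?_, fun h => absurd h (Set.notMem_empty _)⟩
    have := (hP.1 n G h).1
    omega
  simp [classCoeff, this]

lemma lam_zero (hP : IsPrimeClass P) : Lam P 0 = 0 := by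
  rw [lam_eq]
  simp [pser_zero, classCoeff_eq_zero hP]

lemma lam'_zero (hP : IsPrimeClass P) : lam' P 0 = 0 := by
  rw [lam']
  simp [pser_zero, derivCoeff, classCoeff_eq_zero hP]

lemma deriv_lam {x : ℝ} (hx : 0 ≤ x)
    (h : ENNReal.ofReal (Real.exp x - 1) < seriesRadius (classCoeff P)) :
    deriv (Lam P) x = lam' P x :=
  (hasDerivAt_lam (mem_lamDom_of_norm_le (by simp [abs_of_nonneg hx]) h)).deriv

lemma lam''_pos {x : ℝ} (hx : 0 ≤ x) : 0 < lam'' P x := by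
  have h0 : 0 ≤ Real.exp x - 1 := by linarith [Real.one_le_exp hx]
  have h1 : 0 ≤ (pser (derivCoeff (classCoeff P)) (Real.exp x - 1 : ℝ)).re :=
    pser_re_nonneg (derivCoeff_nonneg (classCoeff_nonneg P)) h0
  have h2 : 0 ≤ (pser (derivCoeff (derivCoeff (classCoeff P))) (Real.exp x - 1 : ℝ)).re :=
    pser_re_nonneg (derivCoeff_nonneg (derivCoeff_nonneg (classCoeff_nonneg P))) h0
  have := Real.exp_pos x
  unfold lam''
  positivity

lemma ofReal_exp_sub_one_lt_of_le {x y : ℝ} (h : x ≤ y)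
    (hy : ENNReal.ofReal (Real.exp y - 1) < seriesRadius (classCoeff P)) :
    ENNReal.ofReal (Real.exp x - 1) < seriesRadius (classCoeff P) :=
  (ENNReal.ofReal_le_ofReal (by linarith [Real.exp_le_exp.2 h])).trans_lt hy

/-- Existence of `κ`. -/
lemma exists_isKappa (hP : IsPrimeClass P) (hC : ConditionC P) : ∃ κ, IsKappa P κ := by
  obtain ⟨hρ, L, hL, hlim⟩ := hC
  have hpos : (0 : EReal) < lamRadius P := by
    have := (lt_lamRadius_iff (P := P) le_rfl).2 (by simpa using hρ)
    simpa using this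
  have hev := hlim.eventually_const_lt hL
  rw [eventually_comap] at hev
  have hev2 : ∀ᶠ b in 𝓝[<] lamRadius P, 0 < b := by
    filter_upwards [mem_nhdsWithin_of_mem_nhds (lt_mem_nhds hpos)] with b hb using hb
  have hev3 : ∀ᶠ b in 𝓝[<] lamRadius P, b < lamRadius P := eventually_mem_nhdsWithin
  -- There are points to the left of the endpoint because $0$ is one. Those chosen next lie between
  -- $0$ and the radius, so they are real even if the radius is infinite.
  have : (𝓝[<] lamRadius P).NeBot := nhdsLT_neBot_of_exists_lt ⟨0, hpos⟩
  obtain ⟨b, h1, h2, h3⟩ := (hev.and (hev2.and hev3)).exists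
  obtain ⟨x, rfl⟩ : ∃ x : ℝ, (x : EReal) = b := by
    refine ⟨b.toReal, EReal.coe_toReal ?_ ?_⟩
    · exact (h3.trans_le le_top).ne
    · exact (bot_le.trans_lt h2).ne'
  have hx0 : 0 ≤ x := by exact_mod_cast h2.le
  have hx := (lt_lamRadius_iff hx0).1 h3
  have h4 : 1 < lam' P x := by
    have := h1 x rfl
    rw [deriv_lam hx0 hx] at this
    exact_mod_cast this
  have hcont : ContinuousOn (lam' P) (Set.Icc 0 x) := fun y hy =>
    (hasDerivAt_lam' (mem_lamDom_of_norm_le (y := x) (by simpa [abs_of_nonneg hy.1] using hy.2)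
      hx)).continuousAt.continuousWithinAt
  -- The intermediate value theorem applies to $\Lambda'$ between $\Lambda'(0)=0$ and
  -- $\Lambda'(x)>1$.
  obtain ⟨κ, hκ, hκ1⟩ := intermediate_value_Icc hx0 hcont
    ⟨by rw [lam'_zero hP]; exact zero_le_one, h4.le⟩
  have hκx := ofReal_exp_sub_one_lt_of_le hκ.2 hx
  exact ⟨κ, hκ.1, (lt_lamRadius_iff hκ.1).2 hκx, by rw [deriv_lam hκ.1 hκx, hκ1]⟩

variable {κ : ℝ}

lemma IsKappa.lt_radius (h : IsKappa P κ) :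
    ENNReal.ofReal (Real.exp κ - 1) < seriesRadius (classCoeff P) :=
  (lt_lamRadius_iff h.1).1 h.2.1

lemma IsKappa.lam'_eq (h : IsKappa P κ) : lam' P κ = 1 := by
  rw [← deriv_lam h.1 h.lt_radius]; exact h.2.2

lemma IsKappa.unique (h : IsKappa P κ) {κ' : ℝ} (h' : IsKappa P κ') : κ' = κ := by
  rcases lt_trichotomy κ' κ with h1 | h1 | h1
  · have := lam'_strictMono h'.1 h1 h.lt_radius
    rw [h.lam'_eq, h'.lam'_eq] at this
    exact absurd this (lt_irrefl _)
  · exact h1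
  · have := lam'_strictMono h.1 h1 h'.lt_radius
    rw [h.lam'_eq, h'.lam'_eq] at this
    exact absurd this (lt_irrefl _)

lemma IsKappa.pos (hP : IsPrimeClass P) (h : IsKappa P κ) : 0 < κ := by
  refine lt_of_le_of_ne h.1 fun h0 => ?_
  have := h.lam'_eq
  rw [← h0, lam'_zero hP] at this
  exact zero_ne_one this

lemma IsKappa.lam'_lt_one (h : IsKappa P κ) {y : ℝ} (hy : 0 ≤ y) (hyκ : y < κ) : lam' P y < 1 := by
  rw [← h.lam'_eq]
  exact lam'_strictMono hy hyκ h.lt_radius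

lemma IsKappa.hasDerivAt_sub_lam (h : IsKappa P κ) {y : ℝ} (hy : y ∈ Set.Icc 0 κ) :
    HasDerivAt (fun x => x - Lam P x) (1 - lam' P y) y :=
  (hasDerivAt_id y).sub (hasDerivAt_lam (mem_lamDom_of_norm_le (y := κ)
    (by simpa [abs_of_nonneg hy.1] using hy.2) h.lt_radius))

lemma IsKappa.continuousOn_sub_lam (h : IsKappa P κ) :
    ContinuousOn (fun x => x - Lam P x) (Set.Icc 0 κ) := fun _ hy =>
  (h.hasDerivAt_sub_lam hy).continuousAt.continuousWithinAt

/-- The derivative $1-\Lambda'$ is positive before $\kappa$. Compared at $0$ and $\kappa$, this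
gives $R>0$. -/
lemma IsKappa.strictMonoOn_sub_lam (h : IsKappa P κ) :
    StrictMonoOn (fun x => x - Lam P x) (Set.Icc 0 κ) := by
  refine strictMonoOn_of_deriv_pos (convex_Icc _ _) h.continuousOn_sub_lam fun y hy => ?_
  rw [interior_Icc] at hy
  rw [(h.hasDerivAt_sub_lam (Set.Ioo_subset_Icc_self hy)).deriv]
  linarith [h.lam'_lt_one hy.1.le hy.2]

lemma IsKappa.RR_pos (hP : IsPrimeClass P) (h : IsKappa P κ) : 0 < RR P κ := by
  have := h.strictMonoOn_sub_lam ⟨le_rfl, h.1⟩ ⟨h.1, le_rfl⟩ (h.pos hP)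
  simpa [lam_zero hP, RR] using this

lemma IsKappa.muu_eq (h : IsKappa P κ) : muu P κ = Real.sqrt (2 * RR P κ * lam'' P κ) := by
  rw [muu, deriv_deriv_lam (mem_lamDom_of_norm_le (y := κ) (by simp [abs_of_nonneg h.1])
    h.lt_radius)]

lemma IsKappa.muu_pos (hP : IsPrimeClass P) (h : IsKappa P κ) : 0 < muu P κ := by
  rw [h.muu_eq]
  have := h.RR_pos hP
  have := lam''_pos (P := P) h.1
  positivity

end Real

/-! ### Local inverses -/

lemma exists_analyticAt_local_inverse {f : ℂ → ℂ} {w₀ f' : ℂ} (hf : AnalyticAt ℂ f w₀)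
    (hd : HasDerivAt f f' w₀) (hf' : f' ≠ 0) :
    ∃ g : ℂ → ℂ, AnalyticAt ℂ g (f w₀) ∧ g (f w₀) = w₀ ∧ HasDerivAt g f'⁻¹ (f w₀) ∧
      ∀ᶠ z in 𝓝 (f w₀), f (g z) = z := by
  obtain rfl := hd.deriv
  exact ⟨_, hf.analyticAt_localInverse hf', HasStrictFDerivAt.localInverse_apply_image ..,
    (HasStrictDerivAt.to_localInverse hf.hasStrictDerivAt hf').hasDerivAt,
    HasStrictDerivAt.eventually_right_inverse ..⟩

lemma analyticAt_dslope {f : ℂ → ℂ} {w₀ : ℂ} (hf : AnalyticAt ℂ f w₀) :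
    AnalyticAt ℂ (dslope f w₀) w₀ := by
  obtain ⟨p, hp⟩ := hf
  exact ⟨_, hp.has_fpower_series_dslope_fslope⟩

/-- A function with a double zero is the square of a coordinate. -/
lemma exists_sqrt_inverse {F F' : ℂ → ℂ} {w₀ : ℂ} {a : ℝ} (ha : 0 < a) (hF : AnalyticAt ℂ F w₀)
    (h0 : F w₀ = 0) (hF' : ∀ᶠ w in 𝓝 w₀, HasDerivAt F (F' w) w) (h1 : F' w₀ = 0)
    (h2 : HasDerivAt F' (2 * a : ℂ) w₀) :
    ∃ S : ℂ → ℂ, AnalyticAt ℂ S 0 ∧ S 0 = w₀ ∧ HasDerivAt S (-((Real.sqrt a)⁻¹ : ℝ) : ℂ) 0 ∧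
      ∀ᶠ q in 𝓝 0, F (S q) = q ^ 2 := by
  have hg : AnalyticAt ℂ (dslope F w₀) w₀ := analyticAt_dslope hF
  set h := dslope (dslope F w₀) w₀ with hh
  have hhan : AnalyticAt ℂ h w₀ := analyticAt_dslope hg
  -- Two divided differences at $w_0$ are exact, because both $F$ and $F'$ vanish there.
  have hFh : ∀ w, F w = (w - w₀) ^ 2 * h w := by
    intro w
    have e1 := sub_smul_dslope F w₀ w
    have e2 := sub_smul_dslope (dslope F w₀) w₀ w
    rw [dslope_same, hF'.self_of_nhds.deriv, h1, sub_zero] at e2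
    rw [h0, sub_zero] at e1
    rw [← e1, ← e2]
    simp only [smul_eq_mul, hh]
    ring
  -- Differentiating $(w-w_0)^2h(w)$ twice at $w_0$ gives $2h(w_0)$, to be compared with
  -- $F''(w_0)=2a$.
  have hha : h w₀ = a := by
    have e1 : F' =ᶠ[𝓝 w₀] fun w => 2 * (w - w₀) * h w + (w - w₀) ^ 2 * deriv h w := by
      filter_upwards [hF', hhan.eventually_analyticAt] with w hw hw'
      have e2 : HasDerivAt (fun w => (w - w₀) ^ 2 * h w)
          (2 * (w - w₀) * h w + (w - w₀) ^ 2 * deriv h w) w := by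
        have := (((hasDerivAt_id w).sub_const w₀).pow 2).mul hw'.differentiableAt.hasDerivAt
        refine this.congr_deriv ?_
        simp
      rw [← funext hFh] at e2
      exact hw.unique e2
    have e3 : HasDerivAt (fun w => 2 * (w - w₀) * h w + (w - w₀) ^ 2 * deriv h w) (2 * h w₀) w₀ := by
      have i1 := (((hasDerivAt_id w₀).sub_const w₀).const_mul 2).mul
        hhan.differentiableAt.hasDerivAt
      have i2 := (((hasDerivAt_id w₀).sub_const w₀).pow 2).mul
        hhan.deriv.differentiableAt.hasDerivAt
      refine (i1.add i2).congr_deriv ?_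
      simp
    have := (h2.congr_of_eventuallyEq e1.symm).unique e3
    exact (mul_left_cancel₀ two_ne_zero this).symm
  have hslit : h w₀ ∈ Complex.slitPlane := by
    rw [hha]; exact Complex.ofReal_mem_slitPlane.2 ha
  -- The sign $w_0-w$ is the choice of square root for which $S'(0)$ is negative, so that $S$ moves
  -- left from $w_0$ when $q$ enters the right half-plane.
  set s : ℂ → ℂ := fun w => (w₀ - w) * h w ^ (2⁻¹ : ℂ) with hs
  have hpow : AnalyticAt ℂ (fun w => h w ^ (2⁻¹ : ℂ)) w₀ := hhan.cpow analyticAt_const hslit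
  have hsan : AnalyticAt ℂ s w₀ := (analyticAt_const.sub analyticAt_id).mul hpow
  have hsq : ∀ w, s w ^ 2 = F w := by
    intro w
    rw [hs, hFh, mul_pow, ← Complex.cpow_nat_mul]
    norm_num
    exact Or.inl (by ring)
  have hs0 : s w₀ = 0 := by simp [hs]
  have hsqrt : h w₀ ^ (2⁻¹ : ℂ) = (Real.sqrt a : ℝ) := by
    rw [hha, Real.sqrt_eq_rpow, Complex.ofReal_cpow ha.le]
    norm_num
  have hsd : HasDerivAt s (-(Real.sqrt a : ℝ) : ℂ) w₀ := by
    have := ((hasDerivAt_id w₀).const_sub w₀).mul hpow.differentiableAt.hasDerivAt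
    refine this.congr_deriv ?_
    simp only [id, sub_self, zero_mul, add_zero, hsqrt]
    ring
  have hne : (-(Real.sqrt a : ℝ) : ℂ) ≠ 0 := by
    have := (Real.sqrt_pos.2 ha).ne'
    exact neg_ne_zero.2 (by exact_mod_cast this)
  obtain ⟨S, hS, hS0, hSd, hSe⟩ := exists_analyticAt_local_inverse hsan hsd hne
  rw [hs0] at hS hS0 hSd hSe
  refine ⟨S, hS, hS0, hSd.congr_deriv ?_, ?_⟩
  · push_cast
    rw [neg_inv]
  · filter_upwards [hSe] with q hq
    rw [← hsq, hq]

/-- To first order $S(q)=\kappa-cq$, and $|\kappa-cq|^2=\kappa^2-2\kappa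
c\,\mathrm{Re}\,q+c^2|q|^2$. In a sector strictly inside the right half-plane the linear term wins:
the norm drops by at least $c\delta|q|/2$, while the error is at most half of that. -/
lemma eventually_norm_lt_of_hasDerivAt {S : ℂ → ℂ} {κ c δ : ℝ} (hκ : 0 < κ) (hc : 0 < c)
    (hδ : 0 < δ) (hS0 : S 0 = κ) (hS : HasDerivAt S (-c : ℂ) 0) :
    ∀ᶠ q in 𝓝 (0 : ℂ), q ≠ 0 → δ * ‖q‖ ≤ q.re → ‖S q‖ < κ := by
  have h1 := (hasDerivAt_iff_isLittleO.1 hS).def (show 0 < c * δ / 4 by positivity)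
  -- The first bound makes $c^2|q|^2$ at most a quarter of $2\kappa c\delta|q|$; the second keeps
  -- $\kappa-c\delta|q|/2$ nonnegative, so that squares can be compared.
  have h2 : ∀ᶠ q in 𝓝 (0 : ℂ), ‖q‖ < min (κ * δ / (2 * c)) (κ / (c * δ)) := by
    have : Tendsto (fun q : ℂ => ‖q‖) (𝓝 0) (𝓝 0) := by simpa using (continuous_norm.tendsto (0:ℂ))
    exact this.eventually_lt_const (by positivity)
  filter_upwards [h1, h2] with q hq hq' hq0 hqre
  rw [lt_min_iff, lt_div_iff₀ (by positivity), lt_div_iff₀ (by positivity)] at hq'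
  have hqpos : 0 < ‖q‖ := norm_pos_iff.2 hq0
  rw [hS0, sub_zero, smul_eq_mul] at hq
  have h3 : ‖(κ : ℂ) - c * q‖ ≤ κ - c * δ * ‖q‖ / 2 := by
    refine abs_le_of_sq_le_sq' ?_ ?_ |>.2
    · have e : ‖(κ : ℂ) - c * q‖ ^ 2 = κ ^ 2 - 2 * κ * c * q.re + c ^ 2 * ‖q‖ ^ 2 := by
        rw [← Complex.normSq_eq_norm_sq, ← Complex.normSq_eq_norm_sq, Complex.normSq_apply,
          Complex.normSq_apply]
        simp
        ring
      rw [e]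
      have i1 : κ * c * (δ * ‖q‖) ≤ κ * c * q.re := by gcongr
      have i2 : c * ‖q‖ * (‖q‖ * (2 * c)) ≤ c * ‖q‖ * (κ * δ) := by
        exact mul_le_mul_of_nonneg_left hq'.1.le (by positivity)
      nlinarith [sq_nonneg (c * δ * ‖q‖)]
    · nlinarith [hq'.2]
  calc ‖S q‖ = ‖(S q - κ - q * -c) + (κ - c * q)‖ := by congr 1; ring
    _ ≤ c * δ / 4 * ‖q‖ + (κ - c * δ * ‖q‖ / 2) := (norm_add_le _ _).trans (add_le_add hq h3)
    _ < κ := by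
      have : 0 < c * δ * ‖q‖ := by positivity
      linarith

/-! ### The inverse of `w - Λ(w)` on the disc of radius `κ` -/

section Inverse

variable {P : GraphClass} {κ : ℝ}

/-- The function `ψ(w) = w - Λ(w)`. -/
noncomputable def psi (P : GraphClass) (w : ℂ) : ℂ := w - lamC P w

lemma IsKappa.mem_lamDom (h : IsKappa P κ) {w : ℂ} (hw : ‖w‖ ≤ κ) : w ∈ lamDom P :=
  mem_lamDom_of_norm_le hw h.lt_radius

lemma hasDerivAt_psi {w : ℂ} (hw : w ∈ lamDom P) : HasDerivAt (psi P) (1 - lamC' P w) w :=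
  (hasDerivAt_id w).sub (hasDerivAt_lamC hw)

lemma analyticAt_psi {w : ℂ} (hw : w ∈ lamDom P) : AnalyticAt ℂ (psi P) w :=
  analyticAt_id.sub (analyticAt_lamC hw)

lemma IsKappa.norm_lamC'_lt (h : IsKappa P κ) {w : ℂ} (hw : ‖w‖ < κ) : ‖lamC' P w‖ < 1 :=
  (norm_lamC'_le le_rfl (ofReal_exp_sub_one_lt_of_le hw.le h.lt_radius)).trans_lt
    (h.lam'_lt_one (norm_nonneg _) hw)

lemma IsKappa.deriv_psi_ne_zero (h : IsKappa P κ) {w : ℂ} (hw : ‖w‖ < κ) : 1 - lamC' P w ≠ 0 := by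
  intro h0
  have h1 := h.norm_lamC'_lt hw
  rw [← sub_eq_zero.1 h0] at h1
  simp at h1

/-- On a closed disc of radius $y<\kappa$ containing both points, $\Lambda$ is a contraction with
constant $\Lambda'(y)<1$. Equal values of $\psi$ would make $\Lambda$ preserve the distance of the
two points. -/
lemma IsKappa.injOn_psi (h : IsKappa P κ) : Set.InjOn (psi P) (Metric.ball 0 κ) := by
  intro w₁ h₁ w₂ h₂ he
  by_contra hne
  rw [mem_ball_zero_iff] at h₁ h₂
  set y := max ‖w₁‖ ‖w₂‖
  have hy : y < κ := max_lt h₁ h₂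
  have hyρ := ofReal_exp_sub_one_lt_of_le hy.le h.lt_radius
  have hmv := (convex_closedBall (0 : ℂ) y).norm_image_sub_le_of_norm_hasDerivWithin_le
    (f := lamC P) (f' := lamC' P) (C := lam' P y) (x := w₁) (y := w₂)
    (fun w hw => (hasDerivAt_lamC (mem_lamDom_of_norm_le (mem_closedBall_zero_iff.1 hw)
      hyρ)).hasDerivWithinAt)
    (fun w hw => norm_lamC'_le (mem_closedBall_zero_iff.1 hw) hyρ)
    (mem_closedBall_zero_iff.2 (le_max_left _ _)) (mem_closedBall_zero_iff.2 (le_max_right _ _))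
  have h1 : lamC P w₂ - lamC P w₁ = w₂ - w₁ := by
    unfold psi at he
    linear_combination he
  rw [h1] at hmv
  have h2 : 0 < ‖w₂ - w₁‖ := norm_pos_iff.2 (sub_ne_zero.2 (Ne.symm hne))
  have h3 := h.lam'_lt_one ((norm_nonneg w₁).trans (le_max_left _ _)) hy
  nlinarith

lemma IsKappa.isOpen_image_psi (h : IsKappa P κ) : IsOpen (psi P '' Metric.ball 0 κ) := by
  rw [isOpen_iff_mem_nhds]
  rintro _ ⟨w, hw, rfl⟩
  have hw' : ‖w‖ < κ := mem_ball_zero_iff.1 hw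
  obtain ⟨g, hg, hgw, -, hge⟩ := exists_analyticAt_local_inverse (analyticAt_psi (h.mem_lamDom hw'.le))
    (hasDerivAt_psi (h.mem_lamDom hw'.le)) (h.deriv_psi_ne_zero hw')
  have : ∀ᶠ z in 𝓝 (psi P w), g z ∈ Metric.ball 0 κ :=
    hg.continuousAt.eventually_mem (Metric.isOpen_ball.mem_nhds (by rwa [hgw]))
  filter_upwards [hge, this] with z hz hz'
  exact ⟨g z, hz', hz⟩

lemma IsKappa.le_norm_psi (h : IsKappa P κ) {w : ℂ} (hw : ‖w‖ = κ) : RR P κ ≤ ‖psi P w‖ := by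
  have h1 := norm_lamC_le_lam hw.le h.lt_radius
  have h2 := norm_sub_norm_le w (lamC P w)
  rw [hw] at h2
  unfold RR psi
  linarith

/-- Strictness comes from the exponential part of $\Lambda$ alone, so no aperiodicity of the class
is needed for $R$ to be the only obstruction on the circle $|z|=R$. -/
lemma IsKappa.lt_norm_psi (hP : IsPrimeClass P) (h : IsKappa P κ) {w : ℂ} (hw : ‖w‖ = κ)
    (hne : w ≠ κ) : RR P κ < ‖psi P w‖ := by
  have h1 := norm_lamC_le hw.le h.lt_radius
  have h2 := norm_sub_norm_le w (lamC P w)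
  have h3 := norm_exp_sub_one_sub_lt hw (h.pos hP) hne
  have h4 := lam_eq (P := P) κ
  rw [hw] at h2
  unfold RR psi
  linarith

lemma IsKappa.psi_kappa : psi P κ = RR P κ := by
  rw [psi, lamC_ofReal, RR]; push_cast; rfl

lemma psi_zero (hP : IsPrimeClass P) : psi P 0 = 0 := by
  have := lamC_ofReal (P := P) 0
  rw [lam_zero hP] at this
  rw [psi, ← Complex.ofReal_zero, this, sub_self, Complex.ofReal_zero]

lemma IsKappa.isCompact_image_psi (h : IsKappa P κ) :
    IsCompact (psi P '' Metric.closedBall 0 κ) :=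
  (isCompact_closedBall _ _).image_of_continuousOn fun _ hw =>
    (hasDerivAt_psi (h.mem_lamDom (mem_closedBall_zero_iff.1 hw))).continuousAt.continuousWithinAt

/-- The image of the open disc is open. Limits of its points are values on the closed disc, and
values on the circle $|w|=\kappa$ lie outside the ball; so the image is also relatively closed in
the ball, which is connected. -/
lemma IsKappa.ball_subset_image_psi (hP : IsPrimeClass P) (h : IsKappa P κ) :
    Metric.ball 0 (RR P κ) ⊆ psi P '' Metric.ball 0 κ := by
  refine (convex_ball (0 : ℂ) (RR P κ)).isPreconnected.subset_of_closure_inter_subset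
    h.isOpen_image_psi ⟨0, Metric.mem_ball_self (h.RR_pos hP), 0,
      Metric.mem_ball_self (h.pos hP), psi_zero hP⟩ ?_
  rintro z ⟨hz, hzR⟩
  have h1 : closure (psi P '' Metric.ball 0 κ) ⊆ psi P '' Metric.closedBall 0 κ :=
    closure_minimal (Set.image_mono Metric.ball_subset_closedBall)
      h.isCompact_image_psi.isClosed
  obtain ⟨w, hw, rfl⟩ := h1 hz
  rw [mem_closedBall_zero_iff] at hw
  rw [mem_ball_zero_iff] at hzR
  refine ⟨w, mem_ball_zero_iff.2 (lt_of_le_of_ne hw fun he => ?_), rfl⟩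
  exact absurd hzR (h.le_norm_psi he).not_gt

/-- By compactness the closed ball is in the image of the closed disc, and a preimage on the circle
$|w|=\kappa$ can only be $\kappa$, whose image is $R$. -/
lemma IsKappa.closedBall_subset_image_psi (hP : IsPrimeClass P) (h : IsKappa P κ) {z : ℂ}
    (hz : ‖z‖ ≤ RR P κ) (hne : z ≠ RR P κ) : z ∈ psi P '' Metric.ball 0 κ := by
  have h1 : Metric.closedBall 0 (RR P κ) ⊆ psi P '' Metric.closedBall 0 κ := by
    rw [← closure_ball _ (h.RR_pos hP).ne']
    exact closure_minimal ((h.ball_subset_image_psi hP).trans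
      (Set.image_mono Metric.ball_subset_closedBall)) h.isCompact_image_psi.isClosed
  obtain ⟨w, hw, rfl⟩ := h1 (mem_closedBall_zero_iff.2 hz)
  rw [mem_closedBall_zero_iff] at hw
  refine ⟨w, mem_ball_zero_iff.2 (lt_of_le_of_ne hw fun he => ?_), rfl⟩
  rcases eq_or_ne w κ with rfl | hwκ
  · exact hne IsKappa.psi_kappa
  · exact absurd hz (h.lt_norm_psi hP he hwκ).not_ge

/-- The inverse of `ψ`. -/
noncomputable def invPsi (P : GraphClass) (κ : ℝ) : ℂ → ℂ :=
  Function.invFunOn (psi P) (Metric.ball 0 κ)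

lemma norm_invPsi_lt {z : ℂ} (hz : z ∈ psi P '' Metric.ball 0 κ) : ‖invPsi P κ z‖ < κ :=
  mem_ball_zero_iff.1 (Function.invFunOn_mem hz)

lemma psi_invPsi {z : ℂ} (hz : z ∈ psi P '' Metric.ball 0 κ) : psi P (invPsi P κ z) = z :=
  Function.invFunOn_eq hz

lemma IsKappa.invPsi_eq (h : IsKappa P κ) {z w : ℂ} (hw : ‖w‖ < κ) (hz : psi P w = z) :
    invPsi P κ z = w :=
  have hz' : z ∈ psi P '' Metric.ball 0 κ := ⟨w, mem_ball_zero_iff.2 hw, hz⟩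
  h.injOn_psi (mem_ball_zero_iff.2 (norm_invPsi_lt hz')) (mem_ball_zero_iff.2 hw)
    ((psi_invPsi hz').trans hz.symm)

lemma IsKappa.analyticAt_invPsi (h : IsKappa P κ) {z : ℂ} (hz : z ∈ psi P '' Metric.ball 0 κ) :
    AnalyticAt ℂ (invPsi P κ) z := by
  obtain ⟨w, hw, rfl⟩ := hz
  have hw' : ‖w‖ < κ := mem_ball_zero_iff.1 hw
  obtain ⟨g, hg, hgw, -, hge⟩ := exists_analyticAt_local_inverse (analyticAt_psi (h.mem_lamDom hw'.le))
    (hasDerivAt_psi (h.mem_lamDom hw'.le)) (h.deriv_psi_ne_zero hw')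
  have : ∀ᶠ z in 𝓝 (psi P w), g z ∈ Metric.ball 0 κ :=
    hg.continuousAt.eventually_mem (Metric.isOpen_ball.mem_nhds (by rwa [hgw]))
  refine hg.congr ?_
  filter_upwards [hge, this] with z hz hz'
  exact (h.invPsi_eq (mem_ball_zero_iff.1 hz') hz).symm

lemma IsKappa.deriv_invPsi (h : IsKappa P κ) {z : ℂ} (hz : z ∈ psi P '' Metric.ball 0 κ) :
    deriv (invPsi P κ) z * (1 - lamC' P (invPsi P κ z)) = 1 := by
  have h1 := (h.analyticAt_invPsi hz).differentiableAt.hasDerivAt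
  have h2 : HasDerivAt (fun z => psi P (invPsi P κ z))
      ((1 - lamC' P (invPsi P κ z)) * deriv (invPsi P κ) z) z :=
    HasDerivAt.comp (h₂ := psi P) z (hasDerivAt_psi (h.mem_lamDom (norm_invPsi_lt hz).le)) h1
  have h3 : (fun z => psi P (invPsi P κ z)) =ᶠ[𝓝 z] fun z => z := by
    filter_upwards [h.isOpen_image_psi.mem_nhds hz] with z' hz' using psi_invPsi hz'
  rw [mul_comm]
  exact (h2.congr_of_eventuallyEq h3.symm).unique (hasDerivAt_id z)

end Inverse

/-! ### The inverse of `w - Λ(w)` on a `Δ`-domain -/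

lemma cpow_inv_two_sq (u : ℂ) : (u ^ (2⁻¹ : ℂ)) ^ 2 = u := by
  rw [← Complex.cpow_nat_mul]
  norm_num

lemma norm_cpow_inv_two (u : ℂ) : ‖u ^ (2⁻¹ : ℂ)‖ = Real.sqrt ‖u‖ := by
  rw [← Real.sqrt_sq (norm_nonneg (u ^ (2⁻¹ : ℂ))), ← norm_pow, cpow_inv_two_sq]

/-- The principal root halves arguments: a sector of half-angle $\theta<\pi$ goes to one strictly
inside the right half-plane, as required by `eventually_norm_lt_of_hasDerivAt`. -/
lemma cos_mul_norm_le_re_cpow_inv_two {u : ℂ} {θ : ℝ} (hu : u ≠ 0) (hθ : θ ≤ Real.pi)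
    (h : |Complex.arg u| < θ) :
    Real.cos (θ / 2) * ‖u ^ (2⁻¹ : ℂ)‖ ≤ (u ^ (2⁻¹ : ℂ)).re := by
  rw [Complex.cpow_def_of_ne_zero hu, Complex.norm_exp, Complex.exp_re, mul_comm]
  refine mul_le_mul_of_nonneg_left ?_ (Real.exp_pos _).le
  have h1 : (Complex.log u * 2⁻¹).im = Complex.arg u / 2 := by
    simp [Complex.mul_im, Complex.log_im]
    ring
  rw [h1, ← Real.cos_abs (Complex.arg u / 2), abs_div, abs_two]
  exact Real.cos_le_cos_of_nonneg_of_le_pi (by positivity) (by linarith [Real.pi_pos]) (by linarith)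

lemma tendsto_one_sub_div_cpow {R : ℝ} (hR : 0 < R) (s : Set ℂ) :
    Tendsto (fun z : ℂ => (1 - z / R) ^ (2⁻¹ : ℂ)) (𝓝[s] (R : ℂ)) (𝓝 0) := by
  rw [tendsto_zero_iff_norm_tendsto_zero]
  simp only [norm_cpow_inv_two]
  have hc : Continuous fun z : ℂ => Real.sqrt ‖1 - z / R‖ := by fun_prop
  have h1 := hc.tendsto (R : ℂ)
  rw [div_self (by exact_mod_cast hR.ne'), sub_self, norm_zero, Real.sqrt_zero] at h1
  exact h1.mono_left nhdsWithin_le_nhds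

variable {P : GraphClass} {κ : ℝ}

/-- Singular behaviour of the inverse of `ψ`: it is an analytic function of `√(1 - z / R)`. -/
lemma IsKappa.exists_singular_expansion (hP : IsPrimeClass P) (h : IsKappa P κ) {δ : ℝ}
    (hδ : 0 < δ) :
    ∃ S : ℂ → ℂ, S 0 = κ ∧
      HasDerivAt S (-((Real.sqrt (lam'' P κ / (2 * RR P κ)))⁻¹ : ℝ) : ℂ) 0 ∧
      ∀ᶠ q in 𝓝 (0 : ℂ), q ≠ 0 → δ * ‖q‖ ≤ q.re → ∀ z : ℂ, 1 - z / RR P κ = q ^ 2 →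
        z ∈ psi P '' Metric.ball 0 κ ∧ invPsi P κ z = S q := by
  have hR := h.RR_pos hP
  have hRC : (RR P κ : ℂ) ≠ 0 := by exact_mod_cast hR.ne'
  have hl := lam''_pos (P := P) h.1
  have hκ : (κ : ℂ) ∈ lamDom P := h.mem_lamDom (by simp [abs_of_nonneg h.1])
  have ha : 0 < lam'' P κ / (2 * RR P κ) := by positivity
  -- At $\kappa$ the second derivative of $1-\psi/R$ is $\Lambda''(\kappa)/R=2a$ with
  -- $a=\Lambda''(\kappa)/(2R)$; the first one vanishes since $\Lambda'(\kappa)=1$.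
  obtain ⟨S, -, hS0, hSd, hSe⟩ := exists_sqrt_inverse (F := fun w => 1 - psi P w / RR P κ)
    (F' := fun w => -((1 - lamC' P w) / RR P κ)) (w₀ := κ) ha
    (analyticAt_const.sub ((analyticAt_psi hκ).div analyticAt_const hRC))
    (by rw [IsKappa.psi_kappa, div_self hRC, sub_self])
    (by
      filter_upwards [(isOpen_lamDom P).mem_nhds hκ] with w hw
      exact ((hasDerivAt_psi hw).div_const _).const_sub 1)
    (by rw [lamC'_ofReal, h.lam'_eq]; simp)
    (by
      refine ((((hasDerivAt_lamC' hκ).const_sub 1).div_const _).fun_neg).congr_deriv ?_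
      rw [lamC''_ofReal]
      push_cast
      field_simp
      )
  refine ⟨S, hS0, hSd, ?_⟩
  filter_upwards [hSe, eventually_norm_lt_of_hasDerivAt (h.pos hP)
    (c := (Real.sqrt (lam'' P κ / (2 * RR P κ)))⁻¹) (by positivity) hδ hS0 hSd]
    with q hq hq' hq0 hqre z hz
  have h1 := hq' hq0 hqre
  have h2 : psi P (S q) = z := by
    rw [← hz] at hq
    exact (div_left_inj' hRC).1 (sub_right_injective hq)
  exact ⟨⟨S q, mem_ball_zero_iff.2 h1, h2⟩, h.invPsi_eq h1 h2⟩

/-- The image of $\psi$ and a small ball at $R$ cover the closed disc of radius $R$, hence, by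
compactness, a slightly larger disc. In the small ball the singular expansion shows that the part in
the sector is in the image as well. -/
lemma IsKappa.exists_deltaDomain (hP : IsPrimeClass P) (h : IsKappa P κ) :
    ∃ D : Set ℂ, IsDeltaDomain (RR P κ : ℂ) D ∧ D ⊆ psi P '' Metric.ball 0 κ ∧
      Metric.ball 0 (RR P κ) ⊆ D ∧
      Tendsto (invPsi P κ) (𝓝[D] (RR P κ : ℂ)) (𝓝 (κ : ℂ)) ∧
      Tendsto (fun z => deriv (invPsi P κ) z * (1 - z / RR P κ) ^ (2⁻¹ : ℂ)) (𝓝[D] (RR P κ : ℂ))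
        (𝓝 ((muu P κ : ℂ)⁻¹)) := by
  have hR := h.RR_pos hP
  have hRC : (RR P κ : ℂ) ≠ 0 := by exact_mod_cast hR.ne'
  have hl := lam''_pos (P := P) h.1
  have hκ : (κ : ℂ) ∈ lamDom P := h.mem_lamDom (by simp [abs_of_nonneg h.1])
  have hpi := Real.pi_pos
  -- Any angle strictly between $\pi/2$ and $\pi$ would do; $\cos(\theta/2)>0$ provides the aperture
  -- of the sector.
  set θ : ℝ := 3 * Real.pi / 4 with hθ
  have hcos : 0 < Real.cos (θ / 2) := Real.cos_pos_of_mem_Ioo ⟨by linarith, by linarith⟩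
  obtain ⟨S, hS0, hSd, hS⟩ := h.exists_singular_expansion hP hcos
  have hsec : ∀ᶠ z : ℂ in 𝓝 (RR P κ : ℂ), 1 - z / RR P κ ≠ 0 →
      |Complex.arg (1 - z / RR P κ)| < θ → z ∈ psi P '' Metric.ball 0 κ ∧
        invPsi P κ z = S ((1 - z / RR P κ) ^ (2⁻¹ : ℂ)) := by
    have ht := tendsto_one_sub_div_cpow hR Set.univ
    rw [nhdsWithin_univ] at ht
    filter_upwards [ht.eventually hS] with z hz hz0 hzθ
    refine hz ?_ (cos_mul_norm_le_re_cpow_inv_two hz0 (by linarith) hzθ) z (cpow_inv_two_sq _).symm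
    rw [← norm_ne_zero_iff, norm_cpow_inv_two]
    exact (Real.sqrt_pos.2 (norm_pos_iff.2 hz0)).ne'
  obtain ⟨ε, hε, hεsec⟩ := Metric.eventually_nhds_iff_ball.1 hsec
  obtain ⟨δ, hδ, hδU⟩ := (isCompact_closedBall (0 : ℂ) (RR P κ)).exists_thickening_subset_open
    (h.isOpen_image_psi.union (Metric.isOpen_ball (x := (RR P κ : ℂ)) (ε := ε)))
    (fun z hz => by
      rcases eq_or_ne z (RR P κ) with rfl | hne
      · exact Or.inr (Metric.mem_ball_self hε)
      · exact Or.inl (h.closedBall_subset_image_psi hP (mem_closedBall_zero_iff.1 hz) hne))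
  rw [thickening_closedBall hδ hR.le] at hδU
  -- This makes $rR=R+\delta/2$, inside the enlarged disc of radius $R+\delta$.
  set r : ℝ := 1 + δ / (2 * RR P κ) with hr
  have hrR : r * RR P κ < δ + RR P κ := by
    rw [hr]; field_simp; linarith
  set D : Set ℂ := (fun z => z * (RR P κ : ℂ)) ''
    {z : ℂ | ‖z‖ ≤ r ∧ z ≠ 1 ∧ |Complex.arg (1 - z)| < θ} with hD
  have hDsec : ∀ z ∈ D, 1 - z / RR P κ ≠ 0 ∧ |Complex.arg (1 - z / RR P κ)| < θ := by
    rintro _ ⟨u, ⟨-, hu1, huθ⟩, rfl⟩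
    simp only [mul_div_assoc, div_self hRC, mul_one]
    exact ⟨sub_ne_zero.2 hu1.symm, huθ⟩
  have hev : ∀ᶠ z in 𝓝[D] (RR P κ : ℂ), invPsi P κ z = S ((1 - z / RR P κ) ^ (2⁻¹ : ℂ)) := by
    filter_upwards [self_mem_nhdsWithin, mem_nhdsWithin_of_mem_nhds hsec] with z hz hz'
    exact (hz' (hDsec z hz).1 (hDsec z hz).2).2
  have hq := tendsto_one_sub_div_cpow hR D
  have hDψ : D ⊆ psi P '' Metric.ball 0 κ := by
    intro z hz
    have hzU : z ∈ Metric.ball 0 (δ + RR P κ) := by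
      obtain ⟨u, ⟨hur, -⟩, rfl⟩ := hz
      rw [mem_ball_zero_iff, norm_mul, Complex.norm_of_nonneg hR.le]
      exact (mul_le_mul_of_nonneg_right hur hR.le).trans_lt hrR
    rcases hδU hzU with h1 | h1
    · exact h1
    · exact (hεsec z h1 (hDsec z hz).1 (hDsec z hz).2).1
  refine ⟨D, ⟨r, θ, ?_, by linarith, by linarith, hD⟩, hDψ, ?_, ?_, ?_⟩
  · have : 0 < δ / (2 * RR P κ) := by positivity
    linarith
  · intro z hz
    rw [mem_ball_zero_iff] at hz
    refine ⟨z / RR P κ, ⟨?_, ?_, ?_⟩, div_mul_cancel₀ _ hRC⟩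
    · rw [norm_div, Complex.norm_of_nonneg hR.le, div_le_iff₀ hR]
      have : 0 < δ / (2 * RR P κ) := by positivity
      nlinarith
    · rw [Ne, div_eq_one_iff_eq hRC]
      rintro rfl
      rw [Complex.norm_of_nonneg hR.le] at hz
      exact lt_irrefl _ hz
    · have h1 : |Complex.arg (1 - z / RR P κ)| < Real.pi / 2 := by
        rw [Complex.abs_arg_lt_pi_div_two_iff]
        left
        have h2 : ‖z / RR P κ‖ < 1 := by
          rwa [norm_div, Complex.norm_of_nonneg hR.le, div_lt_one hR]
        have := (Complex.re_le_norm _).trans_lt h2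
        simpa using this
      linarith
  · have h1 := (hSd.continuousAt.tendsto.comp hq)
    rw [hS0] at h1
    exact h1.congr' (hev.mono fun z hz => hz.symm)
  · -- `(1 - Λ'(S q)) / q` tends to `μ`
    set c : ℝ := Real.sqrt (lam'' P κ / (2 * RR P κ)) with hc
    have hcpos : 0 < c := by positivity
    -- The derivative is $-\Lambda''(\kappa)S'(0)=\Lambda''(\kappa)/c$, and
    -- $c^2=\Lambda''(\kappa)/(2R)$ turns this into $\mu$.
    have hcomp : HasDerivAt (fun q => 1 - lamC' P (S q)) (muu P κ : ℂ) 0 := by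
      have h1 : HasDerivAt (lamC' P) (lamC'' P κ) (S 0) := by
        rw [hS0]; exact hasDerivAt_lamC' hκ
      refine ((HasDerivAt.comp (h₂ := lamC' P) (0 : ℂ) h1 hSd).const_sub 1).congr_deriv ?_
      have h3 : lam'' P κ * c⁻¹ = muu P κ := by
        have hsq : c ^ 2 = lam'' P κ / (2 * RR P κ) := Real.sq_sqrt (by positivity)
        have h4 : lam'' P κ = c ^ 2 * (2 * RR P κ) := by rw [hsq]; field_simp
        rw [h.muu_eq, ← Real.sqrt_sq (show 0 ≤ lam'' P κ * c⁻¹ by positivity)]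
        congr 1
        rw [mul_pow, inv_pow, hsq]
        field_simp
      rw [lamC''_ofReal, ← h3]
      push_cast
      ring
    have hslope : Tendsto (fun q => (1 - lamC' P (S q)) / q) (𝓝[≠] 0) (𝓝 (muu P κ : ℂ)) := by
      have h1 := hasDerivAt_iff_tendsto_slope.1 hcomp
      refine h1.congr fun q => ?_
      rw [slope_def_field, hS0, lamC'_ofReal, h.lam'_eq]
      simp
    have hq' : Tendsto (fun z : ℂ => (1 - z / RR P κ) ^ (2⁻¹ : ℂ)) (𝓝[D] (RR P κ : ℂ)) (𝓝[≠] 0) := by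
      refine tendsto_nhdsWithin_iff.2 ⟨hq, ?_⟩
      filter_upwards [self_mem_nhdsWithin] with z hz
      rw [Set.mem_compl_singleton_iff, ← norm_ne_zero_iff, norm_cpow_inv_two]
      exact (Real.sqrt_pos.2 (norm_pos_iff.2 (hDsec z hz).1)).ne'
    have hμ : (muu P κ : ℂ) ≠ 0 := by exact_mod_cast (h.muu_pos hP).ne'
    refine ((hslope.comp hq').inv₀ hμ).congr' ?_
    filter_upwards [hev, self_mem_nhdsWithin] with z hz hzD
    have h1 := h.deriv_invPsi (hDψ hzD)
    have h2 := eq_inv_of_mul_eq_one_left h1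
    rw [h2, hz, Function.comp_apply, inv_div, div_eq_inv_mul]

end ModDec

namespace ModDec
open STree

/-! ### The generating functions -/

/-- The generating function of the trees that may be attached to nodes of kind `q`. -/
noncomputable def genB (P : GraphClass) (κ : ℝ) (q : Kind) (z : ℂ) : ℂ :=
  if q = Kind.prime then Complex.exp (invPsi P κ z) - 1 else invPsi P κ z

/-- The solution `C` of the linear system `C q' = L + ∑ (T q + X q)`, the sum being over the kinds
`q` compatible with `q'` and `T q` being the series of the trees with a root of kind `q` that is not
a node of the induced tree. -/
noncomputable def solveKinds (P : GraphClass) (κ : ℝ) (L : ℂ) (X : Kind → ℂ) (z : ℂ) : Kind → ℂ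
  | Kind.prime => deriv (invPsi P κ) z *
      (X Kind.join + X Kind.union + Complex.exp (invPsi P κ z) * (X Kind.prime + L))
  | Kind.join => (deriv (invPsi P κ) z *
      (X Kind.join + X Kind.union + Complex.exp (invPsi P κ z) * (X Kind.prime + L)) -
      X Kind.join) * Complex.exp (-invPsi P κ z)
  | Kind.union => (deriv (invPsi P κ) z *
      (X Kind.join + X Kind.union + Complex.exp (invPsi P κ z) * (X Kind.prime + L)) -
      X Kind.union) * Complex.exp (-invPsi P κ z)

open Classical in
/-- The generating function of the trees that induce `τ` and may be attached to nodes of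
kind `q`. -/
noncomputable def genC (P : GraphClass) (κ : ℝ) :
    (τ : STree) → (τ.Node → Prop → Prop) → Kind → ℂ → ℂ
  | leaf _, _ => fun q z => solveKinds P κ 1 (fun _ => 0) z q
  | node _ H c, A => fun q z => solveKinds P κ 0 (fun q =>
      if A rootNode (q ≠ Kind.prime) then pser (ocoef (q.graphs P) H) (genB P κ q z) *
        ∏ j, genC P κ (c j) (fun n => A (childNode j n)) q z else 0) z q

/-- The generating function of the trees that induce `τ`, with a root of kind `q` that is the root
of `τ`. -/
noncomputable def genX (P : GraphClass) (κ : ℝ) (τ : STree) (A : τ.Node → Prop → Prop)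
    (q : Kind) (z : ℂ) : ℂ :=
  branchTerm P (genB P κ q) q τ A (fun τ A => genC P κ τ A q) z

lemma genC_eq (P : GraphClass) (κ : ℝ) (τ : STree) (A : τ.Node → Prop → Prop) (q : Kind) (z : ℂ) :
    genC P κ τ A q z = solveKinds P κ (leafTerm τ) (fun q => genX P κ τ A q z) z q := by
  cases τ with
  | leaf l => rfl
  | node d H c =>
    simp only [genC, genX, branchTerm, leafTerm]

open Classical in
lemma genX_node (P : GraphClass) (κ : ℝ) {d : ℕ} (H : SimpleGraph (Fin d)) (c : Fin d → STree)
    (A : (node d H c).Node → Prop → Prop) (q : Kind) (z : ℂ) :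
    genX P κ (node d H c) A q z = if A rootNode (q ≠ Kind.prime) then
      pser (ocoef (q.graphs P) H) (genB P κ q z) *
        ∏ j, genC P κ (c j) (fun n => A (childNode j n)) q z else 0 := by
  simp only [genX, branchTerm]

variable {P : GraphClass} {κ : ℝ}

lemma norm_genB_le (q : Kind) {z : ℂ}
    (hz : z ∈ psi P '' Metric.ball 0 κ) : ‖genB P κ q z‖ ≤ KK κ := by
  have h1 := (norm_invPsi_lt hz).le
  unfold genB KK
  split_ifs
  · exact norm_exp_sub_one_le h1
  · linarith [Real.add_one_le_exp κ]

lemma IsKappa.norm_genB_lt (h : IsKappa P κ) (q : Kind) {z : ℂ}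
    (hz : z ∈ psi P '' Metric.ball 0 κ) :
    ENNReal.ofReal ‖genB P κ q z‖ < seriesRadius (classCoeff P) :=
  (ENNReal.ofReal_le_ofReal (norm_genB_le q hz)).trans_lt h.lt_radius

lemma IsKappa.analyticAt_genB (h : IsKappa P κ) (q : Kind) {z : ℂ}
    (hz : z ∈ psi P '' Metric.ball 0 κ) : AnalyticAt ℂ (genB P κ q) z := by
  have h1 := h.analyticAt_invPsi hz
  cases q
  · exact h1
  · exact h1
  · exact h1.cexp.sub analyticAt_const

lemma IsKappa.analyticAt_pser_genB (h : IsKappa P κ) (q : Kind) {k : ℕ} (H : SimpleGraph (Fin k))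
    {z : ℂ} (hz : z ∈ psi P '' Metric.ball 0 κ) :
    AnalyticAt ℂ (fun z => pser (ocoef (q.graphs P) H) (genB P κ q z)) z :=
  AnalyticAt.fun_comp ((Kind.convergesBelow P q H).analyticAt (h.norm_genB_lt q hz))
    (h.analyticAt_genB q hz)

lemma IsKappa.analyticAt_solveKinds (h : IsKappa P κ) (L : ℂ) {X : Kind → ℂ → ℂ} {z : ℂ}
    (hz : z ∈ psi P '' Metric.ball 0 κ) (hX : ∀ q, AnalyticAt ℂ (X q) z) (q : Kind) :
    AnalyticAt ℂ (fun z => solveKinds P κ L (fun q => X q z) z q) z := by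
  have h1 := h.analyticAt_invPsi hz
  have hF : AnalyticAt ℂ (fun z => deriv (invPsi P κ) z * (X Kind.join z + X Kind.union z +
      Complex.exp (invPsi P κ z) * (X Kind.prime z + L))) z :=
    h1.deriv.mul (((hX _).add (hX _)).add (h1.cexp.mul ((hX _).add analyticAt_const)))
  cases q
  · exact (hF.sub (hX _)).mul h1.neg.cexp
  · exact (hF.sub (hX _)).mul h1.neg.cexp
  · exact hF

lemma IsKappa.analyticAt_genC (h : IsKappa P κ) (τ : STree) (A : τ.Node → Prop → Prop) (q : Kind)
    {z : ℂ} (hz : z ∈ psi P '' Metric.ball 0 κ) : AnalyticAt ℂ (genC P κ τ A q) z := by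
  induction τ generalizing q with
  | leaf l => exact h.analyticAt_solveKinds 1 hz (fun _ => analyticAt_const) q
  | node d H c ih =>
    simp only [genC]
    refine h.analyticAt_solveKinds 0 hz (fun q => ?_) q
    split_ifs
    · exact (h.analyticAt_pser_genB q H hz).mul
        (analyticAt_finset_prod _ fun j _ => ih j _ q)
    · exact analyticAt_const

/-- The difference of the equations for a prime and a linear parent expresses the linear unknown as
$e^{-W}(C_{\mathrm{prime}}-X)$. After substitution the coefficient of $C_{\mathrm{prime}}$ becomes
$1-\Lambda'(W)$ up to a factor, so the relations $W'(1-\Lambda'(W))=1$ and $e^{-W}e^W=1$ suffice. -/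
lemma IsKappa.solveKinds_eq (h : IsKappa P κ) (L : ℂ) (X : Kind → ℂ) {z : ℂ}
    (hz : z ∈ psi P '' Metric.ball 0 κ) (q' : Kind) :
    solveKinds P κ L X z q' = L + ∑ q with q'.Compatible q,
      (pser (ocoef (q.graphs P) (⊥ : SimpleGraph (Fin 1))) (genB P κ q z) * solveKinds P κ L X z q +
        X q) := by
  have hd := h.deriv_invPsi hz
  have he : Complex.exp (-invPsi P κ z) * Complex.exp (invPsi P κ z) = 1 := by
    rw [← Complex.exp_add, neg_add_cancel, Complex.exp_zero]
  have hj : pser (ocoef (Kind.join.graphs P) (⊥ : SimpleGraph (Fin 1))) (genB P κ Kind.join z) =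
      Complex.exp (invPsi P κ z) - 1 := by
    rw [ocoef_join _ _ (Subsingleton.elim _ _), pser_expCoeff]
    simp [genB]
  have hu : pser (ocoef (Kind.union.graphs P) (⊥ : SimpleGraph (Fin 1))) (genB P κ Kind.union z) =
      Complex.exp (invPsi P κ z) - 1 := by
    rw [ocoef_union _ _ rfl, pser_expCoeff]
    simp [genB]
  have hp : pser (ocoef (Kind.prime.graphs P) (⊥ : SimpleGraph (Fin 1))) (genB P κ Kind.prime z) =
      pser (derivCoeff (classCoeff P)) (Complex.exp (invPsi P κ z) - 1) := by
    rw [ocoef_one]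
    simp [genB, Kind.graphs]
  unfold lamC' at hd
  rw [Finset.sum_filter]
  have hsum : ∀ f : Kind → ℂ, ∑ q, f q = f Kind.join + f Kind.union + f Kind.prime := fun f => by
    rw [show (Finset.univ : Finset Kind) = {Kind.join, Kind.union, Kind.prime} from rfl]
    simp [add_assoc]
  rw [hsum, hj, hu, hp]
  generalize pser (derivCoeff (classCoeff P)) (Complex.exp (invPsi P κ z) - 1) = p at *
  cases q' <;>
    simp only [Kind.Compatible, solveKinds, reduceCtorEq, ne_eq, not_true_eq_false, or_false,
      or_true, not_false_eq_true, if_true, if_false]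
  all_goals
    generalize Complex.exp (-invPsi P κ z) = E' at *
    generalize Complex.exp (invPsi P κ z) = E at *
    generalize deriv (invPsi P κ) z = W' at *
    generalize X Kind.join = x1
    generalize X Kind.union = x2
    generalize X Kind.prime = x3
  · linear_combination E' * (x1 + x2 + E * (x3 + L)) * hd +
      (p * (W' * (x1 + x2 + E * (x3 + L))) + x3 + L + x2) * he
  · linear_combination E' * (x1 + x2 + E * (x3 + L)) * hd +
      (p * (W' * (x1 + x2 + E * (x3 + L))) + x3 + L + x1) * he
  · linear_combination E' * (x1 + x2 + E * (x3 + L)) * hd +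
      ((p - 1) * (W' * (x1 + x2 + E * (x3 + L))) + x3 + L + x1 + x2) * he

lemma IsKappa.zero_mem_image_psi (hP : IsPrimeClass P) (h : IsKappa P κ) :
    (0 : ℂ) ∈ psi P '' Metric.ball 0 κ :=
  ⟨0, Metric.mem_ball_self (h.pos hP), psi_zero hP⟩

/-- The two linear kinds play symmetric roles and share the series $W$; all three equations reduce
to $\psi(W)=z$. -/
lemma genB_eq {z : ℂ} (hz : z ∈ psi P '' Metric.ball 0 κ) (q' : Kind) :
    genB P κ q' z = z + ∑ q with q'.Compatible q,
      pser (ocoef (q.graphs P) (⊥ : SimpleGraph (Fin 0))) (genB P κ q z) := by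
  have hj : pser (ocoef (Kind.join.graphs P) (⊥ : SimpleGraph (Fin 0))) (genB P κ Kind.join z) =
      Complex.exp (invPsi P κ z) - 1 - invPsi P κ z := by
    rw [ocoef_join _ _ (Subsingleton.elim _ _), pser_expCoeff]
    simp [genB]
  have hu : pser (ocoef (Kind.union.graphs P) (⊥ : SimpleGraph (Fin 0))) (genB P κ Kind.union z) =
      Complex.exp (invPsi P κ z) - 1 - invPsi P κ z := by
    rw [ocoef_union _ _ rfl, pser_expCoeff]
    simp [genB]
  have hp : pser (ocoef (Kind.prime.graphs P) (⊥ : SimpleGraph (Fin 0))) (genB P κ Kind.prime z) =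
      pser (classCoeff P) (Complex.exp (invPsi P κ z) - 1) := by
    rw [ocoef_zero]
    simp [genB, Kind.graphs]
  have hψ := psi_invPsi hz
  unfold psi lamC at hψ
  rw [Finset.sum_filter]
  have hsum : ∀ f : Kind → ℂ, ∑ q, f q = f Kind.join + f Kind.union + f Kind.prime := fun f => by
    rw [show (Finset.univ : Finset Kind) = {Kind.join, Kind.union, Kind.prime} from rfl]
    simp [add_assoc]
  rw [hsum, hj, hu, hp]
  generalize pser (classCoeff P) (Complex.exp (invPsi P κ z) - 1) = p at *
  cases q' <;>
    simp only [Kind.Compatible, genB, reduceCtorEq, ne_eq, not_true_eq_false, or_false,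
      or_true, not_false_eq_true, if_true, if_false]
  · linear_combination hψ
  · linear_combination hψ
  · linear_combination hψ

lemma IsKappa.isGenFun (hP : IsPrimeClass P) (h : IsKappa P κ) :
    IsGenFun P (genB P κ) (fun q τ A => genC P κ τ A q) where
  analyticAt_B q := h.analyticAt_genB q (h.zero_mem_image_psi hP)
  B_zero q := by
    have h1 : invPsi P κ 0 = 0 := h.invPsi_eq (by simpa using h.pos hP) (psi_zero hP)
    cases q <;> simp [genB, h1]
  B_eq q' := by
    filter_upwards [h.isOpen_image_psi.mem_nhds (h.zero_mem_image_psi hP)] with z hz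
    exact genB_eq hz q'
  analyticAt_C q τ A := h.analyticAt_genC τ A q (h.zero_mem_image_psi hP)
  C_eq q' τ A := by
    filter_upwards [h.isOpen_image_psi.mem_nhds (h.zero_mem_image_psi hP)] with z hz
    simp only [genC_eq P κ τ]
    exact h.solveKinds_eq _ _ hz q'

end ModDec

namespace ModDec
open STree

/-! ### Singular behaviour of the generating functions -/

lemma STree.prod_node {M : Type*} [CommMonoid M] {d : ℕ} {H : SimpleGraph (Fin d)}
    {c : Fin d → STree} (f : (node d H c).Node → M) :
    ∏ n, f n = f rootNode * ∏ j, ∏ n, f (childNode j n) := by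
  refine (Fintype.prod_option (M := M) (α := Σ i : Fin d, (c i).Node) f).trans ?_
  congr 1
  exact Fintype.prod_sigma _

open Classical in
/-- The contribution of a node with decoration `H` to the constant. -/
noncomputable def nodeWeight (P : GraphClass) (κ : ℝ) (A : Prop → Prop) {d : ℕ}
    (H : SimpleGraph (Fin d)) : ℝ :=
  (if A False then occSeries P H (KK κ) * (1 + KK κ) ^ d else 0) +
    if A True ∧ IsLinear H then 1 else 0

/-- The constant of the singular expansion. -/
noncomputable def treeConst (P : GraphClass) (κ : ℝ) (τ : STree) (A : τ.Node → Prop → Prop) : ℝ :=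
  (∏ n : τ.Node, nodeWeight P κ (A n) (τ.dec n)) / muu P κ ^ τ.numEdges

variable {P : GraphClass} {κ : ℝ}

lemma treeConst_leaf (l : ℕ) (A : (leaf l).Node → Prop → Prop) : treeConst P κ (leaf l) A = 1 := by
  have : IsEmpty (leaf l).Node := inferInstanceAs (IsEmpty Empty)
  simp [treeConst, numEdges]

/-- Each edge from the root takes one factor $1/\mu$, in addition to those of the edges inside the
attached tree. -/
lemma treeConst_node {d : ℕ} (H : SimpleGraph (Fin d)) (c : Fin d → STree)
    (A : (node d H c).Node → Prop → Prop) :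
    treeConst P κ (node d H c) A = nodeWeight P κ (A rootNode) H *
      ∏ j, (treeConst P κ (c j) (fun n => A (childNode j n)) / muu P κ) := by
  simp only [treeConst, prod_node, numEdges, div_div, ← pow_succ]
  rw [Finset.prod_div_distrib, Finset.prod_pow_eq_pow_sum, mul_div_assoc]
  rfl

lemma KK_pos (h : 0 < κ) : 0 < KK κ := by
  have := Real.add_one_lt_exp h.ne'
  unfold KK; linarith

lemma exp_kappa (κ : ℝ) : (1 + KK κ) = Real.exp κ := by
  unfold KK; ring

lemma pser_ocoef_eq_zero {k : ℕ} {H : SimpleGraph (Fin k)} {x : ℝ}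
    (hx : ENNReal.ofReal x < seriesRadius (classCoeff P)) (h0 : occSeries P H x = 0) {z : ℂ}
    (hz : ‖z‖ ≤ x) : pser (ocoef P H) z = 0 := by
  have h1 := norm_pser_le (convergesBelow_ocoef P H) (ocoef_nonneg P H) hz hx
  rw [← occSeries_eq_pser_re, h0] at h1
  exact norm_le_zero_iff.1 h1

lemma occSeries_nonneg {k : ℕ} (H : SimpleGraph (Fin k)) {x : ℝ} (hx : 0 ≤ x) :
    0 ≤ occSeries P H x := by
  rw [occSeries_eq_pser_re]
  exact pser_re_nonneg (ocoef_nonneg P H) hx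

lemma solveKinds_eq_zero {X : Kind → ℂ} (hX : ∀ q, X q = 0) (z : ℂ) (q : Kind) :
    solveKinds P κ 0 X z q = 0 := by
  cases q <;> simp [solveKinds, hX]

/-- If the constant vanishes, then so do the generating functions. -/
lemma IsKappa.genC_eq_zero (hP : IsPrimeClass P) (h : IsKappa P κ) {τ : STree}
    {A : τ.Node → Prop → Prop} (h0 : treeConst P κ τ A = 0) {z : ℂ}
    (hz : z ∈ psi P '' Metric.ball 0 κ) (q : Kind) : genC P κ τ A q z = 0 := by
  classical
  induction τ generalizing q with
  | leaf l => rw [treeConst_leaf] at h0; exact absurd h0 one_ne_zero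
  | node d H c ih =>
    rw [genC_eq]
    refine solveKinds_eq_zero (fun q => ?_) z q
    rw [genX_node]
    split_ifs with hA
    swap
    · rfl
    rw [treeConst_node, mul_eq_zero] at h0
    rcases h0 with h0 | h0
    · rw [nodeWeight] at h0
      have hK := KK_pos (h.pos hP)
      have hocc := occSeries_nonneg (P := P) H hK.le
      have hA1 : 0 ≤ if A rootNode False then occSeries P H (KK κ) * (1 + KK κ) ^ d else 0 := by
        split_ifs <;> positivity
      have hA2 : (0 : ℝ) ≤ if A rootNode True ∧ IsLinear H then 1 else 0 := by
        split_ifs <;> positivity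
      -- Both summands of the weight are nonnegative, so both vanish: the second excludes the
      -- decoration for linear roots, and the first makes the series of occurrences vanish on the
      -- whole disc of radius $K$.
      obtain ⟨h1, h2⟩ := (add_eq_zero_iff_of_nonneg hA1 hA2).1 h0
      cases q with
      | join =>
        have hne : H ≠ ⊤ := fun hH => by
          rw [if_pos ⟨by simpa using hA, Or.inl hH⟩] at h2
          exact one_ne_zero h2
        rw [ocoef_join_of_ne _ _ hne]
        simp [pser]
      | union =>
        have hne : H ≠ ⊥ := fun hH => by
          rw [if_pos ⟨by simpa using hA, Or.inr hH⟩] at h2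
          exact one_ne_zero h2
        rw [ocoef_union_of_ne _ _ hne]
        simp [pser]
      | prime =>
        rw [if_pos (by simpa using hA)] at h1
        have h3 : occSeries P H (KK κ) = 0 := by
          rcases mul_eq_zero.1 h1 with h3 | h3
          · exact h3
          · exact absurd h3 (by positivity)
        have := pser_ocoef_eq_zero h.lt_radius h3 (norm_genB_le Kind.prime hz)
        rw [Kind.graphs, this, zero_mul]
    · obtain ⟨j, -, hj⟩ := Finset.prod_eq_zero_iff.1 h0
      have hμ := (h.muu_pos hP).ne'
      rw [Finset.prod_eq_zero (Finset.mem_univ j)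
        (ih j ((div_eq_zero_iff.1 hj).resolve_right hμ) q), mul_zero]

/-- The square root `√(1 - z / R)`. -/
noncomputable def sqrtVar (P : GraphClass) (κ : ℝ) (z : ℂ) : ℂ := (1 - z / RR P κ) ^ (2⁻¹ : ℂ)

/-- The value at `κ` of the function to be substituted in the series of a node of kind `q`. -/
noncomputable def limB (κ : ℝ) (q : Kind) : ℝ := if q = Kind.prime then KK κ else κ

/-- The factor between the generating function of trees that can be attached to a node of
kind `q` and the one of the trees that can be attached to a linear node. -/
noncomputable def kindFactor (κ : ℝ) (q : Kind) : ℝ := if q = Kind.prime then 1 + KK κ else 1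

lemma limB_lt_radius (h : IsKappa P κ) (q : Kind) :
    ENNReal.ofReal (limB κ q) < seriesRadius (classCoeff P) := by
  refine (ENNReal.ofReal_le_ofReal ?_).trans_lt h.lt_radius
  unfold limB KK
  split_ifs
  · exact le_rfl
  · linarith [Real.add_one_le_exp κ]

lemma limB_nonneg (hP : IsPrimeClass P) (h : IsKappa P κ) (q : Kind) : 0 ≤ limB κ q := by
  unfold limB
  split_ifs
  · exact (KK_pos (h.pos hP)).le
  · exact h.1

/-! ### Limits at the singularity $R$ -/

section Limits

variable {D : Set ℂ} (hP : IsPrimeClass P) (h : IsKappa P κ)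
  (hW : Tendsto (invPsi P κ) (𝓝[D] (RR P κ : ℂ)) (𝓝 (κ : ℂ)))
  (hW' : Tendsto (fun z => deriv (invPsi P κ) z * sqrtVar P κ z) (𝓝[D] (RR P κ : ℂ))
    (𝓝 ((muu P κ : ℂ)⁻¹)))
include hW

lemma tendsto_genB (q : Kind) :
    Tendsto (genB P κ q) (𝓝[D] (RR P κ : ℂ)) (𝓝 (limB κ q : ℂ)) := by
  cases q
  · exact hW
  · exact hW
  · have h1 := ((Complex.continuous_exp.tendsto _).comp hW).sub_const 1
    rw [show Complex.exp (κ : ℂ) - 1 = (limB κ Kind.prime : ℂ) by simp [limB, KK]] at h1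
    exact h1

include hP h

lemma tendsto_pser_genB (q : Kind) {k : ℕ} (H : SimpleGraph (Fin k)) :
    Tendsto (fun z => pser (ocoef (q.graphs P) H) (genB P κ q z)) (𝓝[D] (RR P κ : ℂ))
      (𝓝 (occSeries (q.graphs P) H (limB κ q) : ℂ)) := by
  rw [occSeries_eq_pser]
  refine Tendsto.comp (ContinuousAt.tendsto ?_) (tendsto_genB hW q)
  refine ((Kind.convergesBelow P q H).analyticAt ?_).continuousAt
  rw [Complex.norm_of_nonneg (limB_nonneg hP h q)]
  exact limB_lt_radius h q

include hW'

/-- The factor $W'$ raises the order of the singularity by one half and brings $1/\mu$. The term $X$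
that is subtracted without this factor disappears in the limit, so the three kinds differ only by
the limit $1+K$ of $e^W$. -/
lemma tendsto_solveKinds {L : ℂ} {X : Kind → ℂ → ℂ} {x : Kind → ℝ} {l : ℝ} {e : ℕ}
    (hX : ∀ q, Tendsto (fun z => X q z * sqrtVar P κ z ^ e) (𝓝[D] (RR P κ : ℂ)) (𝓝 (x q : ℂ)))
    (hL : Tendsto (fun z => L * sqrtVar P κ z ^ e) (𝓝[D] (RR P κ : ℂ)) (𝓝 (l : ℂ))) (q : Kind) :
    Tendsto (fun z => solveKinds P κ L (fun q => X q z) z q * sqrtVar P κ z ^ (e + 1))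
      (𝓝[D] (RR P κ : ℂ)) (𝓝 ((kindFactor κ q / muu P κ *
        ((x Kind.join + x Kind.union) / (1 + KK κ) + (x Kind.prime + l)) : ℝ) : ℂ)) := by
  have hE : Tendsto (fun z => Complex.exp (invPsi P κ z)) (𝓝[D] (RR P κ : ℂ))
      (𝓝 ((1 + KK κ : ℝ) : ℂ)) := by
    rw [exp_kappa, Complex.ofReal_exp]
    exact (Complex.continuous_exp.tendsto _).comp hW
  have hEpos : (1 + KK κ : ℝ) ≠ 0 := by rw [exp_kappa]; exact (Real.exp_pos κ).ne'
  have hEC : ((1 + KK κ : ℝ) : ℂ) ≠ 0 := by exact_mod_cast hEpos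
  have hE' : Tendsto (fun z => Complex.exp (-invPsi P κ z)) (𝓝[D] (RR P κ : ℂ))
      (𝓝 (((1 + KK κ : ℝ) : ℂ)⁻¹)) := by
    refine (hE.inv₀ hEC).congr fun z => ?_
    rw [Complex.exp_neg]
  have hq : Tendsto (sqrtVar P κ) (𝓝[D] (RR P κ : ℂ)) (𝓝 0) :=
    tendsto_one_sub_div_cpow (h.RR_pos hP) D
  have hF := hW'.mul (((hX Kind.join).add (hX Kind.union)).add (hE.mul ((hX Kind.prime).add hL)))
  have hlin : ∀ q, Tendsto (fun z => (deriv (invPsi P κ) z * sqrtVar P κ z * (X Kind.join z *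
      sqrtVar P κ z ^ e + X Kind.union z * sqrtVar P κ z ^ e + Complex.exp (invPsi P κ z) *
      (X Kind.prime z * sqrtVar P κ z ^ e + L * sqrtVar P κ z ^ e)) -
      X q z * sqrtVar P κ z ^ e * sqrtVar P κ z) * Complex.exp (-invPsi P κ z))
      (𝓝[D] (RR P κ : ℂ)) (𝓝 ((1 / muu P κ *
        ((x Kind.join + x Kind.union) / (1 + KK κ) + (x Kind.prime + l)) : ℝ) : ℂ)) := by
    intro q
    have h1 := (hF.sub ((hX q).mul hq)).mul hE'
    convert h1 using 2
    push_cast at hEC ⊢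
    field_simp
    ring
  cases q
  · refine (hlin Kind.join).congr fun z => ?_
    simp only [solveKinds]
    ring
  · refine (hlin Kind.union).congr fun z => ?_
    simp only [solveKinds]
    ring
  · have h1 : (muu P κ : ℂ)⁻¹ * ((x Kind.join : ℂ) + x Kind.union +
        ((1 + KK κ : ℝ) : ℂ) * ((x Kind.prime : ℂ) + l)) = ((kindFactor κ Kind.prime / muu P κ *
        ((x Kind.join + x Kind.union) / (1 + KK κ) + (x Kind.prime + l)) : ℝ) : ℂ) := by
      simp only [kindFactor, if_true]
      push_cast at hEC ⊢
      field_simp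
    rw [h1] at hF
    refine hF.congr fun z => ?_
    simp only [solveKinds]
    ring

/-- The singular expansion of the generating functions. -/
lemma tendsto_genC {τ : STree} (hτ : τ.IsOrdered) (A : τ.Node → Prop → Prop) (q : Kind) :
    Tendsto (fun z => genC P κ τ A q z * sqrtVar P κ z ^ (τ.numEdges + 1)) (𝓝[D] (RR P κ : ℂ))
      (𝓝 ((kindFactor κ q / muu P κ * treeConst P κ τ A : ℝ) : ℂ)) := by
  induction τ generalizing q with
  | leaf l =>
    have h1 := tendsto_solveKinds hP h hW hW' (L := 1) (X := fun _ _ => 0) (x := fun _ => 0) (l := 1)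
      (e := 0) (fun _ => by simpa using tendsto_const_nhds) (by simpa using tendsto_const_nhds) q
    rw [treeConst_leaf, show (1 : ℝ) = (0 + 0) / (1 + KK κ) + (0 + 1) by norm_num]
    exact h1
  | node d H c ih =>
    have hq : Tendsto (sqrtVar P κ) (𝓝[D] (RR P κ : ℂ)) (𝓝 0) :=
      tendsto_one_sub_div_cpow (h.RR_pos hP) D
    have hd : 2 ≤ d := hτ.1
    classical
    set y : ℝ := ∏ j, (treeConst P κ (c j) (fun n => A (childNode j n)) / muu P κ) with hy
    set x : Kind → ℝ := fun q => if A rootNode (q ≠ Kind.prime) then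
      occSeries (q.graphs P) H (limB κ q) * (kindFactor κ q ^ d * y) else 0 with hx
    -- The powers of the square root for the children add up to $\sum_j(e_j+1)$, which is the number
    -- of edges of the whole tree.
    have hX : ∀ q, Tendsto (fun z => genX P κ (node d H c) A q z *
        sqrtVar P κ z ^ (node d H c).numEdges) (𝓝[D] (RR P κ : ℂ)) (𝓝 (x q : ℂ)) := by
      intro q
      simp only [genX_node, hx]
      split_ifs with hA
      swap
      · simpa using tendsto_const_nhds
      have h2 := (tendsto_pser_genB hP h hW q H).mul
        (tendsto_finsetProd (Finset.univ : Finset (Fin d)) fun j _ =>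
          ih j (hτ.2.2 j) (fun n => A (childNode j n)) q)
      have h3 : (occSeries (q.graphs P) H (limB κ q) : ℂ) * ∏ j, ((kindFactor κ q / muu P κ *
          treeConst P κ (c j) (fun n => A (childNode j n)) : ℝ) : ℂ) =
          ((occSeries (q.graphs P) H (limB κ q) * (kindFactor κ q ^ d * y) : ℝ) : ℂ) := by
        rw [← Complex.ofReal_prod, ← Complex.ofReal_mul, hy]
        congr 2
        have : kindFactor κ q ^ d = ∏ _j : Fin d, kindFactor κ q := by simp
        rw [this, ← Finset.prod_mul_distrib]
        refine Finset.prod_congr rfl fun j _ => ?_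
        ring
      rw [h3] at h2
      refine h2.congr fun z => ?_
      rw [Finset.prod_mul_distrib, Finset.prod_pow_eq_pow_sum, ← mul_assoc]
      rfl
    have hL : Tendsto (fun z => (0 : ℂ) * sqrtVar P κ z ^ (node d H c).numEdges)
        (𝓝[D] (RR P κ : ℂ)) (𝓝 ((0 : ℝ) : ℂ)) := by
      simpa using tendsto_const_nhds
    have h1 := tendsto_solveKinds hP h hW hW' hX hL q
    simp only [genC_eq P κ (node d H c), leafTerm]
    convert h1 using 4
    -- As $d\ge2$, nothing is truncated, and a linear node contributes the full exponential, with
    -- value $1+K$ at $\kappa$.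
    have hexp : ∀ t : ℝ, (pser (expCoeff d) t).re = Real.exp t := fun t => by
      rw [pser_expCoeff, if_neg (by omega), if_neg (by omega), sub_zero, sub_zero,
        ← Complex.ofReal_exp, Complex.ofReal_re]
    have hj : x Kind.join = if A rootNode True ∧ H = ⊤ then (1 + KK κ) * y else 0 := by
      simp only [hx, ne_eq, reduceCtorEq, not_false_eq_true, limB, kindFactor, if_false, one_pow,
        one_mul]
      by_cases hH : H = ⊤
      · rw [occSeries_eq_pser_re, ocoef_join P H hH, hexp, exp_kappa]
        simp [hH]
      · rw [occSeries_eq_pser_re, ocoef_join_of_ne P H hH]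
        simp [hH, pser]
    have hu : x Kind.union = if A rootNode True ∧ H = ⊥ then (1 + KK κ) * y else 0 := by
      simp only [hx, ne_eq, reduceCtorEq, not_false_eq_true, limB, kindFactor, if_false, one_pow,
        one_mul]
      by_cases hH : H = ⊥
      · rw [occSeries_eq_pser_re, ocoef_union P H hH, hexp, exp_kappa]
        simp [hH]
      · rw [occSeries_eq_pser_re, ocoef_union_of_ne P H hH]
        simp [hH, pser]
    have hp : x Kind.prime = if A rootNode False then
        occSeries P H (KK κ) * (1 + KK κ) ^ d * y else 0 := by
      simp only [hx, ne_eq, not_true_eq_false, limB, kindFactor, if_true, Kind.graphs, mul_assoc]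
    have hEpos : (1 + KK κ : ℝ) ≠ 0 := by rw [exp_kappa]; exact (Real.exp_pos κ).ne'
    -- The value $1+K$ cancels the denominator, leaving weight $1$. At most one of the two kinds
    -- occurs, since $\oplus$ and $\ominus$ differ for $d\ge2$.
    have hlin : (x Kind.join + x Kind.union) / (1 + KK κ) =
        (if A rootNode True ∧ IsLinear H then 1 else 0) * y := by
      rw [hj, hu]
      have htb := top_ne_bot_of_two_le hd
      by_cases hA : A rootNode True
      · by_cases h1 : H = ⊤
        · have h2 : H ≠ ⊥ := h1 ▸ htb
          simp only [hA, IsLinear, h1, htb]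
          field_simp
          simp
        · by_cases h2 : H = ⊥
          · simp only [hA, IsLinear, h2, htb.symm]
            field_simp
            simp
          · simp [hA, IsLinear, h1, h2]
      · simp [hA]
    rw [treeConst_node, hlin, hp, nodeWeight, ← hy]
    split_ifs <;> ring

end Limits

end ModDec

namespace ModDec
open STree

/-! ### Radius of convergence and expansion of the exponential generating functions -/

lemma IsDeltaDomain.ne {w : ℂ} {D : Set ℂ} (h : IsDeltaDomain w D) (hw : w ≠ 0) {z : ℂ}
    (hz : z ∈ D) : z ≠ w := by
  obtain ⟨r, φ, -, -, -, rfl⟩ := h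
  obtain ⟨u, ⟨-, hu, -⟩, rfl⟩ := hz
  intro h
  exact hu (mul_right_cancel₀ hw (h.trans (one_mul w).symm))

lemma le_seriesRadius {a : ℕ → ℝ} {R : ℝ} {g : ℂ → ℂ}
    (h : ∀ z : ℂ, ‖z‖ < R → HasSum (fun n => (a n : ℂ) * z ^ n) (g z)) :
    ENNReal.ofReal R ≤ seriesRadius a := by
  refine ENNReal.le_of_forall_nnreal_lt fun r hr => ?_
  have hr' : (r : ℝ) < R := by
    rw [← ENNReal.ofReal_coe_nnreal] at hr
    exact (ENNReal.ofReal_lt_ofReal_iff_of_nonneg r.coe_nonneg).1 hr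
  refine FormalMultilinearSeries.le_radius_of_tendsto (l := 0) _ ?_
  have h1 := (h (r : ℝ) (by simpa using hr')).summable.tendsto_atTop_zero.norm
  rw [norm_zero] at h1
  refine h1.congr fun n => ?_
  simp

/-- If the radius exceeded $R$, the series would be continuous at $R$, and its product with a
positive power of $\sqrt{1-z/R}$ would tend to $0$ from inside the disc, contrary to $c\ne0$. -/
lemma seriesRadius_le {a : ℕ → ℝ} {R c : ℝ} (hR : 0 < R) (hc : c ≠ 0) {g : ℂ → ℂ} {e : ℕ}
    {D : Set ℂ} (hD : Metric.ball 0 R ⊆ D)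
    (h : ∀ z : ℂ, ‖z‖ < R → HasSum (fun n => (a n : ℂ) * z ^ n) (g z))
    (hlim : Tendsto (fun z : ℂ => g z * ((1 - z / R) ^ (2⁻¹ : ℂ)) ^ (e + 1)) (𝓝[D] (R : ℂ))
      (𝓝 (c : ℂ))) :
    seriesRadius a ≤ ENNReal.ofReal R := by
  by_contra hlt
  rw [not_le] at hlt
  have hcont : ContinuousAt (pser a) (R : ℂ) :=
    ((convergesBelow_seriesRadius a).analyticAt (by
      rwa [Complex.norm_of_nonneg hR.le])).continuousAt
  have hne : (𝓝[Metric.ball 0 R] (R : ℂ)).NeBot := by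
    rw [← mem_closure_iff_nhdsWithin_neBot, closure_ball _ hR.ne']
    simp [abs_of_pos hR]
  have h1 : Tendsto (fun z : ℂ => pser a z * ((1 - z / R) ^ (2⁻¹ : ℂ)) ^ (e + 1))
      (𝓝[Metric.ball 0 R] (R : ℂ)) (𝓝 (pser a R * 0 ^ (e + 1))) :=
    (hcont.tendsto.mono_left nhdsWithin_le_nhds).mul ((tendsto_one_sub_div_cpow hR _).pow _)
  rw [zero_pow (Nat.succ_ne_zero e), mul_zero] at h1
  have h2 := hlim.mono_left (nhdsWithin_mono _ hD)
  have h3 : Tendsto (fun z : ℂ => g z * ((1 - z / R) ^ (2⁻¹ : ℂ)) ^ (e + 1))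
      (𝓝[Metric.ball 0 R] (R : ℂ)) (𝓝 0) := by
    refine h1.congr' ?_
    filter_upwards [self_mem_nhdsWithin] with z hz
    rw [pser, (h z (mem_ball_zero_iff.1 hz)).tsum_eq]
  have := tendsto_nhds_unique h2 h3
  exact hc (by exact_mod_cast this)

lemma cpow_neg_half (u : ℂ) (e : ℕ) :
    u ^ (-((e : ℂ) + 1) / 2) = ((u ^ (2⁻¹ : ℂ)) ^ (e + 1))⁻¹ := by
  rw [← Complex.cpow_mul_nat, ← Complex.cpow_neg]
  congr 1
  push_cast
  ring

/-- Equivalence to the zero function means being eventually zero, so the case $c=0$ does not follow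
from the limit and needs its own hypothesis. -/
lemma isEquivalent_of_tendsto {g : ℂ → ℂ} {R c : ℝ} {e : ℕ} {D : Set ℂ} (hR : R ≠ 0)
    (hD : ∀ z ∈ D, z ≠ R)
    (hlim : Tendsto (fun z : ℂ => g z * ((1 - z / R) ^ (2⁻¹ : ℂ)) ^ (e + 1)) (𝓝[D] (R : ℂ))
      (𝓝 (c : ℂ))) (h0 : c = 0 → ∀ z ∈ D, g z = 0) :
    g ~[𝓝[D] (R : ℂ)] fun z => (c : ℂ) * (1 - z / (R : ℂ)) ^ (-((e : ℂ) + 1) / 2) := by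
  by_cases hc : c = 0
  · have h1 : g =ᶠ[𝓝[D] (R : ℂ)] fun z =>
        (c : ℂ) * (1 - z / (R : ℂ)) ^ (-((e : ℂ) + 1) / 2) := by
      filter_upwards [self_mem_nhdsWithin] with z hz
      rw [h0 hc z hz, hc]
      simp
    exact (IsEquivalent.refl).congr_left h1.symm
  · have h1 := ((isEquivalent_const_iff_tendsto (by exact_mod_cast hc)).2 hlim).mul
      (IsEquivalent.refl (u := fun z : ℂ => (1 - z / (R : ℂ)) ^ (-((e : ℂ) + 1) / 2)))
    refine h1.congr_left ?_
    filter_upwards [self_mem_nhdsWithin] with z hz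
    have h2 : (1 - z / (R : ℂ)) ≠ 0 := by
      rw [sub_ne_zero]
      intro h3
      have hRC : (R : ℂ) ≠ 0 := by exact_mod_cast hR
      exact hD z hz ((div_eq_one_iff_eq hRC).1 h3.symm)
    have h3 : ((1 - z / (R : ℂ)) ^ (2⁻¹ : ℂ)) ^ (e + 1) ≠ 0 :=
      pow_ne_zero _ ((Complex.cpow_ne_zero_iff_of_exponent_ne_zero (by norm_num)).2 h2)
    simp only [Pi.mul_apply, cpow_neg_half]
    rw [mul_assoc, mul_inv_cancel₀ h3, mul_one]

variable {P : GraphClass} {κ : ℝ}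

/-- Radius of convergence and singular expansion for the trees inducing `τ` under a condition `A` on
the nodes. -/
theorem IsKappa.radius_and_expansion (hP : IsPrimeClass P) (h : IsKappa P κ) {τ : STree}
    (hτ : τ.IsSubstitutionTree) (A : τ.Node → Prop → Prop) :
    ((inducingSet P τ A).Nonempty →
      seriesRadius (egf (inducingSet P τ A)) = ENNReal.ofReal (RR P κ)) ∧
    HasDeltaExpansion (egf (inducingSet P τ A)) (RR P κ)
      ((1 + KK κ) / muu P κ * (RR P κ ^ τ.size * treeConst P κ τ A)) τ.numEdges := by
  have hR := h.RR_pos hP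
  have hρ : 0 < seriesRadius (classCoeff P) := bot_le.trans_lt h.lt_radius
  obtain ⟨D, hD, hDψ, hball, hW, hW'⟩ := h.exists_deltaDomain hP
  set g : ℂ → ℂ := fun z => z ^ τ.size * genC P κ τ A Kind.prime z with hg
  have hgan : ∀ z ∈ D, AnalyticAt ℂ g z := fun z hz =>
    (analyticAt_id.pow _).mul (h.analyticAt_genC τ A Kind.prime (hDψ hz))
  have hcoeff : ∀ n, ({p ∈ inducingSet P τ A | p.1.size = n}.ncard : ℂ) = iteratedDeriv n g 0 :=
    ncard_inducingSet_eq_iteratedDeriv hP hρ (h.isGenFun hP) hτ A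
  have hsum : ∀ z : ℂ, ‖z‖ < RR P κ →
      HasSum (fun n => (egf (inducingSet P τ A) n : ℂ) * z ^ n) (g z) := by
    intro z hz
    -- The Taylor series of $g$ converges to $g$ on the ball, which lies in the domain; its
    -- coefficients are the numbers of trees divided by $n!$.
    have h1 := Complex.hasSum_taylorSeries_on_ball (f := g) (c := 0) (r := RR P κ)
      (fun w hw => (hgan w (hball hw)).differentiableAt.differentiableWithinAt)
      (z := z) (mem_ball_zero_iff.2 hz)
    refine h1.congr_fun fun n => ?_
    rw [← hcoeff, egf, sub_zero, smul_eq_mul, smul_eq_mul]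
    push_cast
    ring
  set c : ℝ := (1 + KK κ) / muu P κ * (RR P κ ^ τ.size * treeConst P κ τ A) with hc
  have hlim : Tendsto (fun z : ℂ => g z * ((1 - z / RR P κ) ^ (2⁻¹ : ℂ)) ^ (τ.numEdges + 1))
      (𝓝[D] (RR P κ : ℂ)) (𝓝 (c : ℂ)) := by
    have h1 := tendsto_genC hP h hW hW' hτ.1 A Kind.prime
    have h2 : Tendsto (fun z : ℂ => z ^ τ.size) (𝓝[D] (RR P κ : ℂ))
        (𝓝 ((RR P κ : ℂ) ^ τ.size)) :=
      ((continuous_pow τ.size).tendsto _).mono_left nhdsWithin_le_nhds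
    have h3 := h2.mul h1
    have h4 : (RR P κ : ℂ) ^ τ.size * ((kindFactor κ Kind.prime / muu P κ *
        treeConst P κ τ A : ℝ) : ℂ) = c := by
      rw [hc, kindFactor, if_pos rfl]
      push_cast
      ring
    rw [h4] at h3
    refine h3.congr fun z => ?_
    rw [hg, mul_assoc]
    rfl
  have hK : 0 < 1 + KK κ := by rw [exp_kappa]; exact Real.exp_pos κ
  have hμ := h.muu_pos hP
  have hzero : c = 0 → ∀ z ∈ D, g z = 0 := by
    intro hc0 z hz
    have h1 : treeConst P κ τ A = 0 := by
      rcases mul_eq_zero.1 hc0 with h1 | h1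
      · exact absurd h1 (by positivity)
      · exact (mul_eq_zero.1 h1).resolve_left (by positivity)
    rw [hg]
    simp only [h.genC_eq_zero hP h1 (hDψ hz), mul_zero]
  refine ⟨fun hne => le_antisymm ?_ (le_seriesRadius hsum), D, hD, g, ⟨hgan, hsum⟩,
    isEquivalent_of_tendsto hR.ne'
      (fun z hz => hD.ne (by exact_mod_cast hR.ne') hz) hlim hzero⟩
  refine seriesRadius_le hR (fun hc0 => ?_) hball hsum hlim
  obtain ⟨p, hp⟩ := hne
  -- If the constant were $0$, then $g$ would vanish near $0$ and all numbers of trees would be $0$,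
  -- although `p` is counted.
  have h0 : g =ᶠ[𝓝 0] fun _ => 0 := by
    filter_upwards [Metric.ball_mem_nhds (0 : ℂ) hR] with z hz
    exact hzero hc0 z (hball hz)
  have h1 := hcoeff p.1.size
  rw [h0.iteratedDeriv_eq] at h1
  have h2 : iteratedDeriv p.1.size (fun _ : ℂ => (0 : ℂ)) 0 = 0 := by
    simp
  rw [h2, Nat.cast_eq_zero, Set.ncard_eq_zero (finite_inducingSet P hτ A _)] at h1
  exact (h1 ▸ (⟨hp, rfl⟩ : p ∈ {p' ∈ inducingSet P τ A | p'.1.size = p.1.size}) :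
    p ∈ (∅ : Set (STree × (ℕ ≃. ℕ))))

/-- Without condition, a linear node may come from a linear or a non-linear one and gets the sum of
the two weights; a non-linear node gets only the first. -/
lemma treeConst_true (τ : STree) :
    RR P κ ^ τ.size * treeConst P κ τ (fun _ _ => True) = BB P κ τ := by
  classical
  have h1 : ∏ n : τ.Node, nodeWeight P κ (fun _ => True) (τ.dec n) =
      (∏ n : τ.Node with ¬ τ.LinearNode n,
        occSeries P (τ.dec n) (KK κ) * (1 + KK κ) ^ τ.arity n) *
      ∏ n : τ.Node with τ.LinearNode n,
        (occSeries P (τ.dec n) (KK κ) * (1 + KK κ) ^ τ.arity n + 1) := by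
    rw [← Finset.prod_filter_not_mul_prod_filter Finset.univ (fun n => τ.LinearNode n)]
    congr 1
    · refine Finset.prod_congr rfl fun n hn => ?_
      have h2 : ¬ IsLinear (τ.dec n) := (Finset.mem_filter.1 hn).2
      simp [nodeWeight, h2]
    · refine Finset.prod_congr rfl fun n hn => ?_
      have h2 : IsLinear (τ.dec n) := (Finset.mem_filter.1 hn).2
      simp [nodeWeight, h2]
  rw [treeConst, h1, BB]
  ring_nf

/-- The condition selects one of the two weights at each node. Nodes outside $\mathfrak N$ are
linear by hypothesis, hence have weight $1$ and drop out of the product. -/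
lemma treeConst_iff (τ : STree) {N : Finset τ.Node} (hN : ∀ n, ¬ τ.LinearNode n → n ∈ N) :
    RR P κ ^ τ.size * treeConst P κ τ (fun n p => (n ∈ N ↔ ¬ p)) = CC P κ τ N := by
  classical
  have h1 : ∏ n : τ.Node, nodeWeight P κ (fun p => (n ∈ N ↔ ¬ p)) (τ.dec n) =
      ∏ n ∈ N, (1 + KK κ) ^ τ.arity n * occSeries P (τ.dec n) (KK κ) := by
    rw [← Finset.prod_subset (Finset.subset_univ N)]
    · refine Finset.prod_congr rfl fun n hn => ?_
      simp [nodeWeight, hn, mul_comm]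
    · intro n _ hn
      have h2 : IsLinear (τ.dec n) := by
        by_contra h2
        exact hn (hN n h2)
      simp [nodeWeight, hn, h2]
  rw [treeConst, h1, CC, Finset.prod_mul_distrib, Finset.prod_pow_eq_pow_sum]
  ring

end ModDec

theorem mainTheorem7 (P : ModDec.GraphClass) (hP : ModDec.IsPrimeClass P)
    (hC : ModDec.ConditionC P) :
    ∃ κ : ℝ, (ModDec.IsKappa P κ ∧ ∀ κ', ModDec.IsKappa P κ' → κ' = κ) ∧
      0 < ModDec.RR P κ ∧ 0 < ModDec.muu P κ ∧
      ∀ τ : ModDec.STree, τ.IsSubstitutionTree → 2 ≤ τ.size →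
        (((ModDec.STree.inducing P τ).Nonempty →
            ModDec.seriesRadius (ModDec.egf (ModDec.STree.inducing P τ)) =
              ENNReal.ofReal (ModDec.RR P κ)) ∧
          ModDec.HasDeltaExpansion (ModDec.egf (ModDec.STree.inducing P τ)) (ModDec.RR P κ)
            ((1 + ModDec.KK κ) / ModDec.muu P κ * ModDec.BB P κ τ) τ.numEdges) ∧
        ∀ N : Finset τ.Node, (∀ n, ¬ τ.LinearNode n → n ∈ N) →
          ((ModDec.STree.inducingWith P τ N).Nonempty →
            ModDec.seriesRadius (ModDec.egf (ModDec.STree.inducingWith P τ N)) =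
              ENNReal.ofReal (ModDec.RR P κ)) ∧
          ModDec.HasDeltaExpansion (ModDec.egf (ModDec.STree.inducingWith P τ N)) (ModDec.RR P κ)
            ((1 + ModDec.KK κ) / ModDec.muu P κ * ModDec.CC P κ τ N) τ.numEdges := by
  obtain ⟨κ, hκ⟩ := ModDec.exists_isKappa hP hC
  refine ⟨κ, ⟨hκ, fun κ' h' => hκ.unique h'⟩, hκ.RR_pos hP, hκ.muu_pos hP, fun τ hτ _ => ⟨?_, ?_⟩⟩
  · rw [ModDec.inducing_eq_inducingSet, ← ModDec.treeConst_true]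
    exact hκ.radius_and_expansion hP hτ _
  · intro N hN
    rw [ModDec.inducingWith_eq_inducingSet, ← ModDec.treeConst_iff τ hN]
    exact hκ.radius_and_expansion hP hτ _
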